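/- Let $P$ be the terminal symmetric operad (in sets; its algebras are the commutative monoids). Let $\Phi$ be the signature with one nullary symbol $e$ and one binary symbol $\cdot$, let $E$ be the set of linear equations $$x_1\cdot(x_2\cdot x_3)=(x_1\cdot x_2)\cdot x_3,\qquad e\cdot x_1=x_1,\qquad x_1\cdot e=x_1,\qquad x_1\cdot x_2=x_2\cdot x_1,$$ and let $F_\Sigma$ denote the free symmetric operad on a signature: the $n$-ary operations of $F_\Sigma\Phi$ are the $\Phi$-terms in which each of $x_1,\dots,x_n$ occurs exactly once (trees with permuted leaves). Let $\varphi:F_\Sigma\Phi\to P$ be the unique map. Then $\varphi$ is the coequalizer, in the category of symmetric operads, of the two maps $F_\Sigma E\rightrightarrows F_\Sigma\Phi$ given by the left-hand and right-hand sides of the equations; that is, $(\Phi,E)$ is a presentation of $P$. Let $\mathrm{Wk}_\varphi(P)$ be the symmetric $\mathbf{Cat}$-operad whose 1-cells are the operations of $F_\Sigma\Phi$, with exactly one 2-cell $t_1\to t_2$ if $\varphi(t_1)=\varphi(t_2)$ and none otherwise (the factorization of $\varphi$ as a map that is bijective on 1-cells followed by one that is full and faithful in each arity). A $\varphi$-weak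 $P$-category is a small category $\mathcal C$ with a map $h:\mathrm{Wk}_\varphi(P)\to\mathrm{End}(\mathcal C)$ of symmetric $\mathbf{Cat}$-operads, where $\mathrm{End}(\mathcal C)_n$ is the category of functors $\mathcal C^n\to\mathcal C$. A $\varphi$-weak $P$-functor $(\mathcal C,h)\to(\mathcal D,h')$ is a functor $F:\mathcal C\to\mathcal D$ with isomorphisms $$\psi_{t}: h'(t)(FA_1,\dots,FA_n)\to F\bigl(h(t)(A_1,\dots,A_n)\bigr)$$ for all 1-cells $t$, natural in $A_1,\dots,A_n$ and with respect to the 2-cells of $\mathrm{Wk}_\varphi(P)$, and compatible with operadic identity, composition and symmetric group actions. Let $\mathbf{Wk}\text{-}P\text{-}\mathbf{Cat}$ be the category of these, and let $\mathbf{SMC}$ be the category of small symmetric monoidal categories $(\mathcal C,\otimes,I,\alpha,\lambda,\rho,\tau)$, with $\alpha:A\otimes(B\otimes C)\to(A\otimes B)\otimes C$, $\lambda:I\otimes A\to A$, $\rho:A\otimes I\to A$, $\tau:A\otimes B\to B\otimes A$, and weak symmetric monoidal functors $(F,F_0,F_2)$ ($F_0:I'\to FI$ and $F_2:FA\otimes'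 FB\to F(A\otimes B)$ invertible). Then there are functors $S:\mathbf{SMC}\to\mathbf{Wk}\text{-}P\text{-}\mathbf{Cat}$ and $R:\mathbf{Wk}\text{-}P\text{-}\mathbf{Cat}\to\mathbf{SMC}$ with $RS=1$ and $SR=1$ (equalities of functors), both commuting with the forgetful functors to $\mathbf{Cat}$, such that corresponding objects and morphisms are related as follows. If $SM=(\mathcal C,h)$, or $M=R(\mathcal C,h)$, then $h(\cdot)=\otimes$, $h(e)=I$, and $h$ takes the unique 2-cells $x_1\cdot(x_2\cdot x_3)\to(x_1\cdot x_2)\cdot x_3$, $e\cdot x_1\to x_1$, $x_1\cdot e\to x_1$, $x_1\cdot x_2\to x_2\cdot x_1$ to $\alpha$, $\lambda$, $\rho$, $\tau$. If $S(F,F_0,F_2)=(F',\psi)$, or $(F,F_0,F_2)=R(F',\psi)$, then $F'=F$, $\psi_{\cdot}=F_2$ and $\psi_e=F_0$. -/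

import Mathlib

universe w w' t t' v u

open CategoryTheory

namespace WkOperad

/-! ### Blocks of indices -/

/-- For `k 0 + ⋯ + k (n-1) = m`, the bijection that splits `Fin m` into `n` consecutive blocks,
the `i`-th one of length `k i`. -/
def blockEquiv {n m : ℕ} {k : Fin n → ℕ} (h : ∑ i, k i = m) : (Σ i, Fin (k i)) ≃ Fin m :=
  finSigmaFinEquiv.trans (finCongr h)

/-- The `j`-th index of the `i`-th block. -/
def block {n m : ℕ} {k : Fin n → ℕ} (h : ∑ i, k i = m) (i : Fin n) (j : Fin (k i)) : Fin m :=
  blockEquiv h ⟨i, j⟩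

theorem block_val {n m : ℕ} {k : Fin n → ℕ} (h : ∑ i, k i = m) (i : Fin n) (j : Fin (k i)) :
    (block h i j : ℕ) = (∑ i', if i' < i then k i' else 0) + j := by
  subst h
  simp only [block, blockEquiv, Equiv.trans_apply, finCongr_apply, Fin.val_cast,
    finSigmaFinEquiv_apply]
  congr 1
  rw [← Finset.sum_filter]
  refine Finset.sum_bij' (fun a _ => Fin.castLE i.2.le a)
    (fun b hb => ⟨b, by simpa using (Finset.mem_filter.1 hb).2⟩) ?_ ?_ ?_ ?_ ?_
  · intro a _
    exact Finset.mem_filter.2 ⟨Finset.mem_univ _, a.2⟩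
  · simp
  · intro a _
    rfl
  · intro b _
    rfl
  · intro a _
    rfl

theorem block_lt_block {n m : ℕ} {k : Fin n → ℕ} (h : ∑ i, k i = m) (i i' : Fin n)
    (j : Fin (k i)) (j' : Fin (k i')) (hi : i < i') : block h i j < block h i' j' := by
  rw [Fin.lt_def, block_val, block_val]
  have : (∑ a, if a < i then k a else 0) + k i ≤ ∑ a, if a < i' then k a else 0 := by
    have h1 : k i = ∑ a, if a = i then k a else 0 := by simp
    rw [h1, ← Finset.sum_add_distrib]
    refine Finset.sum_le_sum fun a _ => ?_
    rcases lt_trichotomy a i with ha | ha | ha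
    · simp [ha, ha.ne, ha.trans hi]
    · subst ha
      simp [hi]
    · simp [ha.not_gt, ha.ne']
  have := j.2
  omega

theorem block_lt_iff {n m : ℕ} {k : Fin n → ℕ} (h : ∑ i, k i = m) (i i' : Fin n)
    (j : Fin (k i)) (j' : Fin (k i')) :
    block h i j < block h i' j' ↔ i < i' ∨ i = i' ∧ (j : ℕ) < j' := by
  rcases lt_trichotomy i i' with hi | hi | hi
  · simp [hi, block_lt_block h i i' j j' hi]
  · subst hi
    rw [Fin.lt_def, block_val, block_val]
    simp
  · simp [hi.not_gt, hi.ne', (block_lt_block h i' i j' j hi).not_gt]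

theorem sum_block {n m : ℕ} {k : Fin n → ℕ} (h : ∑ i, k i = m) (f : Fin m → ℕ) :
    ∑ p, f p = ∑ i, ∑ j, f (block h i j) := by
  rw [← (blockEquiv h).sum_comp, Fintype.sum_sigma]
  rfl

theorem sum_sum_block {n m N : ℕ} {k : Fin n → ℕ} (h : ∑ i, k i = m) {l : Fin m → ℕ}
    (hN : ∑ p, l p = N) : ∑ i, ∑ j, l (block h i j) = N :=
  (sum_block h l).symm.trans hN

/-- Cutting into blocks twice: the two ways to number the leaves of a three-level tree agree. -/
theorem block_assoc {n m N : ℕ} {k : Fin n → ℕ} (h : ∑ i, k i = m) {l : Fin m → ℕ}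
    (hN : ∑ p, l p = N) (i : Fin n) (j : Fin (k i)) (t : Fin (l (block h i j))) :
    block hN (block h i j) t =
      block (k := fun i => ∑ j, l (block h i j)) (sum_sum_block h hN) i
        (block (k := fun j => l (block h i j)) rfl j t) := by
  apply Fin.ext
  rw [block_val, block_val, block_val, ← add_assoc]
  congr 1
  rw [sum_block h]
  have : ∀ i' : Fin n, (∑ j', if block h i' j' < block h i j then l (block h i' j') else 0)
      = (if i' < i then ∑ j', l (block h i' j') else 0)
        + if i' = i then (∑ j', if j' < j then l (block h i j') else 0) else 0 := by
    intro i'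
    rcases lt_trichotomy i' i with hi | hi | hi
    · simp [hi, hi.ne, block_lt_iff]
    · subst hi
      simp [block_lt_iff]
    · simp [hi.not_gt, hi.ne', block_lt_iff]
  rw [Finset.sum_congr rfl fun i' _ => this i', Finset.sum_add_distrib]
  simp

theorem block_one_left {n : ℕ} (h : ∑ _i : Fin 1, n = n) (i : Fin 1) (j : Fin n) :
    block (k := fun _ => n) h i j = j := by
  apply Fin.ext
  rw [block_val, Subsingleton.elim i 0]
  simp

theorem block_one_right {n : ℕ} (h : ∑ _i : Fin n, 1 = n) (i : Fin n) (j : Fin 1) :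
    block (k := fun _ => 1) h i j = i := by
  apply Fin.ext
  have h1 : (Finset.univ.filter fun a : Fin n => a < i) = Finset.Iio i := by
    ext a
    simp
  rw [block_val, ← Finset.sum_filter, h1]
  simp

/-- The permutation `σ ∘ (1, …, 1)` that moves whole blocks: it sends the `j`-th index of the
`i`-th block of the lengths `k (σ 0), …, k (σ (n-1))` to the `j`-th index of the `σ i`-th block of
the lengths `k 0, …, k (n-1)`. -/
def blockPerm {n m : ℕ} {k : Fin n → ℕ} (h : ∑ i, k i = m) (σ : Equiv.Perm (Fin n))
    (h' : ∑ i, k (σ i) = m) : Equiv.Perm (Fin m) :=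
  ((blockEquiv (k := fun i => k (σ i)) h').symm.trans
    (Equiv.sigmaCongrLeft (β := fun i => Fin (k i)) σ)).trans (blockEquiv h)

theorem blockPerm_block {n m : ℕ} {k : Fin n → ℕ} (h : ∑ i, k i = m) (σ : Equiv.Perm (Fin n))
    (h' : ∑ i, k (σ i) = m) (i : Fin n) (j : Fin (k (σ i))) :
    blockPerm h σ h' (block (k := fun i => k (σ i)) h' i j) = block h (σ i) j := by
  simp [blockPerm, block, Equiv.sigmaCongrLeft]

/-- The permutation `1 ∘ (τ 0, …, τ (n-1))` that permutes the `i`-th block by `τ i`. -/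
def innerPerm {n m : ℕ} {k : Fin n → ℕ} (h : ∑ i, k i = m) (τ : ∀ i, Equiv.Perm (Fin (k i))) :
    Equiv.Perm (Fin m) :=
  ((blockEquiv h).symm.trans (Equiv.sigmaCongrRight τ)).trans (blockEquiv h)

theorem innerPerm_block {n m : ℕ} {k : Fin n → ℕ} (h : ∑ i, k i = m)
    (τ : ∀ i, Equiv.Perm (Fin (k i))) (i : Fin n) (j : Fin (k i)) :
    innerPerm h τ (block h i j) = block h i (τ i j) := by
  simp [innerPerm, block]

/-! ### Symmetric operads -/

/-- A symmetric operad in sets, with left actions of the symmetric groups.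
`comp h p q` is the composite `p ∘ (q 0, …, q (n-1))`; its arity `m` is any number with a proof
`h` that it is the sum of the arities of the `q i`, so that no casts are needed in the axioms. -/
structure SymmOperad where
  /-- the set of operations of each arity -/
  Op : ℕ → Type w
  one : Op 1
  comp : ∀ {n m : ℕ} {k : Fin n → ℕ}, ∑ i, k i = m → Op n → (∀ i, Op (k i)) → Op m
  act : ∀ {n : ℕ}, Equiv.Perm (Fin n) → Op n → Op n
  one_comp : ∀ {n : ℕ} (h : ∑ _i : Fin 1, n = n) (p : Op n), comp h one (fun _ => p) = p
  comp_one : ∀ {n : ℕ} (h : ∑ _i : Fin n, 1 = n) (p : Op n), comp h p (fun _ => one) = p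
  assoc : ∀ {n m N : ℕ} {k : Fin n → ℕ} (h : ∑ i, k i = m) {l : Fin m → ℕ} (hN : ∑ p, l p = N)
    (p : Op n) (q : ∀ i, Op (k i)) (r : ∀ p, Op (l p)),
    comp hN (comp h p q) r =
      comp (sum_sum_block h hN) p (fun i => comp rfl (q i) (fun j => r (block h i j)))
  act_one : ∀ {n : ℕ} (p : Op n), act 1 p = p
  act_mul : ∀ {n : ℕ} (σ τ : Equiv.Perm (Fin n)) (p : Op n), act (σ * τ) p = act σ (act τ p)
  comp_act_left : ∀ {n m : ℕ} {k : Fin n → ℕ} (h : ∑ i, k i = m) (σ : Equiv.Perm (Fin n))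
    (h' : ∑ i, k (σ i) = m) (p : Op n) (q : ∀ i, Op (k i)),
    comp h (act σ p) q = act (blockPerm h σ h') (comp h' p (fun i => q (σ i)))
  comp_act_right : ∀ {n m : ℕ} {k : Fin n → ℕ} (h : ∑ i, k i = m)
    (τ : ∀ i, Equiv.Perm (Fin (k i))) (p : Op n) (q : ∀ i, Op (k i)),
    comp h p (fun i => act (τ i) (q i)) = act (innerPerm h τ) (comp h p q)

/-- A map of symmetric operads. -/
@[ext]
structure SymmOperad.Hom (P : SymmOperad.{w}) (Q : SymmOperad.{w'}) where
  app : ∀ {n : ℕ}, P.Op n → Q.Op n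
  app_one : app P.one = Q.one
  app_comp : ∀ {n m : ℕ} {k : Fin n → ℕ} (h : ∑ i, k i = m) (p : P.Op n) (q : ∀ i, P.Op (k i)),
    app (P.comp h p q) = Q.comp h (app p) (fun i => app (q i))
  app_act : ∀ {n : ℕ} (σ : Equiv.Perm (Fin n)) (p : P.Op n), app (P.act σ p) = Q.act σ (app p)

/-- The category of symmetric operads. -/
instance : Category SymmOperad.{w} where
  Hom P Q := SymmOperad.Hom P Q
  id P :=
    { app := fun p => p
      app_one := rfl
      app_comp := fun _ _ _ => rfl
      app_act := fun _ _ => rfl }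
  comp f g :=
    { app := fun p => g.app (f.app p)
      app_one := by rw [f.app_one, g.app_one]
      app_comp := fun h p q => by rw [f.app_comp, g.app_comp]
      app_act := fun σ p => by rw [f.app_act, g.app_act] }

/-- The terminal symmetric operad, with one operation of each arity; its algebras in sets are the
commutative monoids. -/
abbrev terminalOperad : SymmOperad.{w} where
  Op _ := PUnit
  one := ⟨⟩
  comp _ _ _ := ⟨⟩
  act _ _ := ⟨⟩
  one_comp _ _ := rfl
  comp_one _ _ := rfl
  assoc _ _ _ _ _ _ := rfl
  act_one _ := rfl
  act_mul _ _ _ := rfl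
  comp_act_left _ _ _ _ _ := rfl
  comp_act_right _ _ _ _ := rfl

/-- The unique map to the terminal symmetric operad. -/
def toTerminal (P : SymmOperad.{w}) : P ⟶ terminalOperad.{w} :=
  { app := fun _ => ⟨⟩
    app_one := rfl
    app_comp := fun _ _ _ => rfl
    app_act := fun _ _ => rfl : SymmOperad.Hom P terminalOperad }

theorem toTerminal_unique {P : SymmOperad.{w}} (f g : P ⟶ terminalOperad.{w}) : f = g :=
  @SymmOperad.Hom.ext _ _ f g (by funext n p; rfl)

/-! ### The free symmetric operad on a signature -/

/-- Terms over a signature `Φ` with variables in `X`. -/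
inductive OpTerm (Φ : ℕ → Type) (X : Type) : Type
  | var (x : X) : OpTerm Φ X
  | op {n : ℕ} (φ : Φ n) (ts : Fin n → OpTerm Φ X) : OpTerm Φ X

namespace OpTerm

variable {Φ Ψ : ℕ → Type} {X Y Z : Type}

/-- Simultaneous substitution (grafting). -/
def bind : OpTerm Φ X → (X → OpTerm Φ Y) → OpTerm Φ Y
  | var x, s => s x
  | op φ ts, s => op φ (fun i => (ts i).bind s)

/-- Renaming of variables. -/
def rename (f : X → Y) (t : OpTerm Φ X) : OpTerm Φ Y :=
  t.bind (fun x => var (f x))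

/-- The number of occurrences of the variable `x`. -/
def count [DecidableEq X] (x : X) : OpTerm Φ X → ℕ
  | var y => if y = x then 1 else 0
  | op _ ts => ∑ i, (ts i).count x

/-- A term is linear if every variable is used exactly once. -/
def IsLinear [DecidableEq X] (t : OpTerm Φ X) : Prop :=
  ∀ x, t.count x = 1

/-- Replace every generating operation by a term over another signature. -/
def expand (s : ∀ {n : ℕ}, Φ n → OpTerm Ψ (Fin n)) : OpTerm Φ X → OpTerm Ψ X
  | var x => var x
  | op φ ts => (s φ).bind (fun i => (ts i).expand s)

theorem bind_bind (t : OpTerm Φ X) (f : X → OpTerm Φ Y) (g : Y → OpTerm Φ Z) :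
    (t.bind f).bind g = t.bind (fun x => (f x).bind g) := by
  induction t with
  | var x => rfl
  | op φ ts ih => simp [bind, ih]

theorem bind_var (t : OpTerm Φ X) : t.bind var = t := by
  induction t with
  | var x => rfl
  | op φ ts ih => simp [bind, ih]

theorem count_bind [DecidableEq X] [DecidableEq Y] [Fintype X] (t : OpTerm Φ X)
    (s : X → OpTerm Φ Y) (y : Y) :
    (t.bind s).count y = ∑ x, t.count x * (s x).count y := by
  induction t with
  | var x => simp [bind, count]
  | op φ ts ih =>
    simp only [bind, count, ih, Finset.sum_mul]
    rw [Finset.sum_comm]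

theorem count_rename [DecidableEq X] [DecidableEq Y] [Fintype X] (t : OpTerm Φ X)
    (f : X → Y) (y : Y) :
    (t.rename f).count y = ∑ x, if f x = y then t.count x else 0 := by
  simp [rename, count_bind, count]

theorem expand_bind (s : ∀ {n : ℕ}, Φ n → OpTerm Ψ (Fin n)) (t : OpTerm Φ X)
    (f : X → OpTerm Φ Y) :
    (t.bind f).expand s = (t.expand s).bind (fun x => (f x).expand s) := by
  induction t with
  | var x => rfl
  | op φ ts ih => simp [bind, expand, ih, bind_bind]

theorem count_expand [DecidableEq X] (s : ∀ {n : ℕ}, Φ n → OpTerm Ψ (Fin n))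
    (hs : ∀ {n : ℕ} (φ : Φ n), (s φ).IsLinear) (t : OpTerm Φ X) (x : X) :
    (t.expand s).count x = t.count x := by
  induction t with
  | var y => rfl
  | op φ ts ih =>
    have key : ∀ {n : ℕ} (r : OpTerm Ψ (Fin n)) (g : Fin n → OpTerm Ψ X),
        (r.bind g).count x = ∑ i, r.count i * (g i).count x := by
      intro n r g
      induction r with
      | var y => simp [bind, count]
      | op φ ts ih =>
        simp only [bind, count, ih, Finset.sum_mul]
        rw [Finset.sum_comm]
    simp only [expand, count, key, ih, hs φ _, one_mul]

end OpTerm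

/-- The free symmetric operad on a signature: an operation of arity `n` is a linear term in `n`
variables, that is, a tree whose nodes are labelled by generating operations and whose leaves are
labelled bijectively by `Fin n` (a permuted tree). Composition is grafting, and `σ` acts by
replacing the label `i` by `σ i`. -/
abbrev freeOperad (Φ : ℕ → Type) : SymmOperad.{0} where
  Op n := {t : OpTerm Φ (Fin n) // t.IsLinear}
  one := ⟨.var 0, fun x => by simp [OpTerm.count, Subsingleton.elim x 0]⟩
  comp h p q := ⟨p.1.bind (fun i => (q i).1.rename (block h i)), fun y => by
    obtain ⟨⟨i, j⟩, rfl⟩ := (blockEquiv h).surjective y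
    rw [OpTerm.count_bind, Finset.sum_eq_single i]
    · rw [p.2 i, OpTerm.count_rename, Finset.sum_eq_single j]
      · simp [block, (q i).2 j]
      · intro j' _ hj
        simp [block, hj]
      · simp
    · intro i' _ hi
      rw [OpTerm.count_rename, Finset.sum_eq_zero, mul_zero]
      intro j' _
      simp [block, hi]
    · simp⟩
  act σ p := ⟨p.1.rename σ, fun y => by
    rw [OpTerm.count_rename, Finset.sum_eq_single (σ.symm y)]
    · simp [p.2 _]
    · intro x _ hx
      rw [if_neg]
      rintro rfl
      simp at hx
    · simp⟩
  one_comp h p := by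
    apply Subtype.ext
    simp [OpTerm.bind, OpTerm.rename, block_one_left, OpTerm.bind_var]
  comp_one h p := by
    apply Subtype.ext
    simp [OpTerm.bind, OpTerm.rename, block_one_right, OpTerm.bind_var]
  assoc h _ hN p q r := by
    apply Subtype.ext
    simp [OpTerm.bind, OpTerm.rename, OpTerm.bind_bind, block_assoc]
  act_one p := by
    apply Subtype.ext
    simp [OpTerm.rename, OpTerm.bind_var]
  act_mul σ τ p := by
    apply Subtype.ext
    simp [OpTerm.bind, OpTerm.rename, OpTerm.bind_bind]
  comp_act_left h σ h' p q := by
    apply Subtype.ext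
    simp [OpTerm.bind, OpTerm.rename, OpTerm.bind_bind, blockPerm_block]
  comp_act_right h τ p q := by
    apply Subtype.ext
    simp [OpTerm.bind, OpTerm.rename, OpTerm.bind_bind, innerPerm_block]

/-- The map of symmetric operads out of a free one, into another free one, that is induced by a
map of signatures `s : Φ → U (F Ψ)`. -/
def freeOperadLift {Φ Ψ : ℕ → Type} (s : ∀ {n : ℕ}, Φ n → (freeOperad Ψ).Op n) :
    freeOperad Φ ⟶ freeOperad Ψ :=
  { app := fun t => ⟨t.1.expand (fun φ => (s φ).1), fun x => by
      rw [OpTerm.count_expand _ (fun φ => (s φ).2), t.2 x]⟩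
    app_one := rfl
    app_comp := fun h p q => by
      apply Subtype.ext
      simp [OpTerm.rename, OpTerm.expand_bind, OpTerm.expand]
    app_act := fun σ p => by
      apply Subtype.ext
      simp [OpTerm.rename, OpTerm.expand_bind, OpTerm.expand] :
    SymmOperad.Hom (freeOperad Φ) (freeOperad Ψ) }

/-! ### Symmetric operads enriched in categories -/

/-- A symmetric `Cat`-operad: its 1-cells form a symmetric operad, the 1-cells of each arity are
the objects of a category, whose arrows are the 2-cells, and operadic composition and the actions
of the symmetric groups are functors that satisfy the axioms of a symmetric operad strictly, on
1-cells and on 2-cells. -/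
structure CatSymmOperad extends SymmOperad.{w} where
  [cat : ∀ n, Category.{t} (Op n)]
  compMap : ∀ {n m : ℕ} {k : Fin n → ℕ} (h : ∑ i, k i = m) {p p' : Op n} {q q' : ∀ i, Op (k i)},
    (p ⟶ p') → (∀ i, q i ⟶ q' i) → (comp h p q ⟶ comp h p' q')
  actMap : ∀ {n : ℕ} (σ : Equiv.Perm (Fin n)) {p p' : Op n}, (p ⟶ p') → (act σ p ⟶ act σ p')
  compMap_id : ∀ {n m : ℕ} {k : Fin n → ℕ} (h : ∑ i, k i = m) (p : Op n) (q : ∀ i, Op (k i)),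
    compMap h (𝟙 p) (fun i => 𝟙 (q i)) = 𝟙 (comp h p q)
  compMap_comp : ∀ {n m : ℕ} {k : Fin n → ℕ} (h : ∑ i, k i = m) {p p' p'' : Op n}
    {q q' q'' : ∀ i, Op (k i)} (a : p ⟶ p') (a' : p' ⟶ p'')
    (b : ∀ i, q i ⟶ q' i) (b' : ∀ i, q' i ⟶ q'' i),
    compMap h (a ≫ a') (fun i => b i ≫ b' i) = compMap h a b ≫ compMap h a' b'
  actMap_id : ∀ {n : ℕ} (σ : Equiv.Perm (Fin n)) (p : Op n), actMap σ (𝟙 p) = 𝟙 (act σ p)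
  actMap_comp : ∀ {n : ℕ} (σ : Equiv.Perm (Fin n)) {p p' p'' : Op n} (a : p ⟶ p')
    (a' : p' ⟶ p''), actMap σ (a ≫ a') = actMap σ a ≫ actMap σ a'
  one_compMap : ∀ {n : ℕ} (h : ∑ _i : Fin 1, n = n) {p p' : Op n} (a : p ⟶ p'),
    HEq (compMap h (𝟙 one) (fun _ => a)) a
  compMap_one : ∀ {n : ℕ} (h : ∑ _i : Fin n, 1 = n) {p p' : Op n} (a : p ⟶ p'),
    HEq (compMap h a (fun _ => 𝟙 one)) a
  assocMap : ∀ {n m N : ℕ} {k : Fin n → ℕ} (h : ∑ i, k i = m) {l : Fin m → ℕ}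
    (hN : ∑ p, l p = N) {p p' : Op n} {q q' : ∀ i, Op (k i)} {r r' : ∀ p, Op (l p)}
    (a : p ⟶ p') (b : ∀ i, q i ⟶ q' i) (c : ∀ p, r p ⟶ r' p),
    HEq (compMap hN (compMap h a b) c)
      (compMap (sum_sum_block h hN) a (fun i => compMap rfl (b i) (fun j => c (block h i j))))
  actMap_one : ∀ {n : ℕ} {p p' : Op n} (a : p ⟶ p'), HEq (actMap 1 a) a
  actMap_mul : ∀ {n : ℕ} (σ τ : Equiv.Perm (Fin n)) {p p' : Op n} (a : p ⟶ p'),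
    HEq (actMap (σ * τ) a) (actMap σ (actMap τ a))
  compMap_act_left : ∀ {n m : ℕ} {k : Fin n → ℕ} (h : ∑ i, k i = m) (σ : Equiv.Perm (Fin n))
    (h' : ∑ i, k (σ i) = m) {p p' : Op n} {q q' : ∀ i, Op (k i)} (a : p ⟶ p')
    (b : ∀ i, q i ⟶ q' i),
    HEq (compMap h (actMap σ a) b)
      (actMap (blockPerm h σ h') (compMap h' a (fun i => b (σ i))))
  compMap_act_right : ∀ {n m : ℕ} {k : Fin n → ℕ} (h : ∑ i, k i = m)
    (τ : ∀ i, Equiv.Perm (Fin (k i))) {p p' : Op n} {q q' : ∀ i, Op (k i)} (a : p ⟶ p')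
    (b : ∀ i, q i ⟶ q' i),
    HEq (compMap h a (fun i => actMap (τ i) (b i))) (actMap (innerPerm h τ) (compMap h a b))

attribute [instance] CatSymmOperad.cat

/-- A map of symmetric `Cat`-operads. -/
structure CatSymmOperad.Hom (P : CatSymmOperad.{w, t}) (Q : CatSymmOperad.{w', t'})
    extends SymmOperad.Hom P.toSymmOperad Q.toSymmOperad where
  map : ∀ {n : ℕ} {p p' : P.Op n}, (p ⟶ p') → (app p ⟶ app p')
  map_id : ∀ {n : ℕ} (p : P.Op n), map (𝟙 p) = 𝟙 (app p)
  map_comp : ∀ {n : ℕ} {p p' p'' : P.Op n} (a : p ⟶ p') (b : p' ⟶ p''),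
    map (a ≫ b) = map a ≫ map b
  map_compMap : ∀ {n m : ℕ} {k : Fin n → ℕ} (h : ∑ i, k i = m) {p p' : P.Op n}
    {q q' : ∀ i, P.Op (k i)} (a : p ⟶ p') (b : ∀ i, q i ⟶ q' i),
    HEq (map (P.compMap h a b)) (Q.compMap h (map a) (fun i => map (b i)))
  map_actMap : ∀ {n : ℕ} (σ : Equiv.Perm (Fin n)) {p p' : P.Op n} (a : p ⟶ p'),
    HEq (map (P.actMap σ a)) (Q.actMap σ (map a))

/-! ### The weakening of a symmetric operad -/

theorem heq_plift {A : Type w} {B : Type w'} (f : A → B) {x x' y y' : A} (hx : x = x')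
    (hy : y = y') (a : PLift (f x = f y)) (b : PLift (f x' = f y')) : HEq a b := by
  subst hx hy
  exact heq_of_eq (Subsingleton.elim a b)

/-- For a map `φ : R ⟶ P` of symmetric operads, the symmetric `Cat`-operad whose 1-cells are the
operations of `R` and that has exactly one 2-cell `x ⟶ y` if `φ x = φ y`, and none otherwise. -/
abbrev weakening {R P : SymmOperad.{w}} (φ : R ⟶ P) : CatSymmOperad.{w, 0} where
  toSymmOperad := R
  cat n :=
    { Hom := fun x y => PLift (SymmOperad.Hom.app φ x = SymmOperad.Hom.app φ y)
      id := fun _ => ⟨rfl⟩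
      comp := fun a b => ⟨a.down.trans b.down⟩ }
  compMap h p p' q q' a b := ⟨by
    rw [SymmOperad.Hom.app_comp φ, SymmOperad.Hom.app_comp φ, a.down]
    congr 1
    funext i
    exact (b i).down⟩
  actMap σ p p' a := ⟨by rw [SymmOperad.Hom.app_act φ, SymmOperad.Hom.app_act φ, a.down]⟩
  compMap_id _ _ _ := rfl
  compMap_comp _ _ _ _ _ _ _ _ _ _ _ := rfl
  actMap_id _ _ := rfl
  actMap_comp _ _ _ _ _ _ := rfl
  one_compMap h _ _ _ := heq_plift φ.app (R.one_comp h _) (R.one_comp h _) _ _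
  compMap_one h _ _ _ := heq_plift φ.app (R.comp_one h _) (R.comp_one h _) _ _
  assocMap h _ hN _ _ _ _ _ _ _ _ _ :=
    heq_plift φ.app (R.assoc h hN _ _ _) (R.assoc h hN _ _ _) _ _
  actMap_one _ := heq_plift φ.app (R.act_one _) (R.act_one _) _ _
  actMap_mul σ τ _ _ _ := heq_plift φ.app (R.act_mul σ τ _) (R.act_mul σ τ _) _ _
  compMap_act_left h σ h' _ _ _ _ _ _ :=
    heq_plift φ.app (R.comp_act_left h σ h' _ _) (R.comp_act_left h σ h' _ _) _ _
  compMap_act_right h τ _ _ _ _ _ _ :=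
    heq_plift φ.app (R.comp_act_right h τ _ _) (R.comp_act_right h τ _ _) _ _

/-- The symmetric operad `P` regarded as a symmetric `Cat`-operad whose only 2-cells are
identities. -/
abbrev discreteOperad (P : SymmOperad.{w}) : CatSymmOperad.{w, 0} :=
  weakening (𝟙 P)

/-- The first factor `D R ⟶ weakening φ` of `D φ`. -/
def weakeningIncl {R P : SymmOperad.{w}} (φ : R ⟶ P) :
    CatSymmOperad.Hom (discreteOperad R) (weakening φ) where
  app p := p
  app_one := rfl
  app_comp _ _ _ := rfl
  app_act _ _ := rfl
  map a := ⟨congrArg (SymmOperad.Hom.app φ) a.down⟩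
  map_id _ := rfl
  map_comp _ _ := rfl
  map_compMap _ _ _ _ _ _ _ := HEq.rfl
  map_actMap _ _ _ _ := HEq.rfl

/-- The second factor `weakening φ ⟶ D P` of `D φ`. -/
def weakeningProj {R P : SymmOperad.{w}} (φ : R ⟶ P) :
    CatSymmOperad.Hom (weakening φ) (discreteOperad P) where
  toHom := φ
  map a := ⟨a.down⟩
  map_id _ := rfl
  map_comp _ _ := rfl
  map_compMap h _ _ _ _ _ _ :=
    heq_plift (fun x => x) (φ.app_comp h _ _) (φ.app_comp h _ _) _ _
  map_actMap σ _ _ _ := heq_plift (fun x => x) (φ.app_act σ _) (φ.app_act σ _) _ _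

/-- `weakening φ` is the factorization of `D φ` into a map that is bijective on 1-cells followed
by one that is full and faithful in each arity. -/
theorem weakening_factorization {R P : SymmOperad.{w}} (φ : R ⟶ P) (n : ℕ) :
    Function.Bijective ((weakeningIncl φ).app (n := n)) ∧
      (∀ p q : R.Op n, Function.Bijective ((weakeningProj φ).map (p := p) (p' := q))) ∧
      ∀ p : R.Op n, (weakeningProj φ).app ((weakeningIncl φ).app p) = SymmOperad.Hom.app φ p :=
  ⟨Function.bijective_id, fun _ _ => ⟨fun x y _ =>
    eq_of_heq (heq_plift (SymmOperad.Hom.app φ) rfl rfl x y), fun b => ⟨⟨b.down⟩, rfl⟩⟩, fun _ => rfl⟩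

/-! ### The endomorphism operad of a category -/

section End

variable {C : Type u} [Category.{v} C]

/-- The projection `x ↦ x 0`. -/
@[simps]
abbrev endOne (C : Type u) [Category.{v} C] : (Fin 1 → C) ⥤ C where
  obj x := x 0
  map f := f 0

/-- The composite `x ↦ F (G 0 (x ∘ b 0), …, G (n-1) (x ∘ b (n-1)))`. -/
@[simps]
abbrev endComp {n m : ℕ} {k : Fin n → ℕ} (b : ∀ i, Fin (k i) → Fin m)
    (F : (Fin n → C) ⥤ C) (G : ∀ i, (Fin (k i) → C) ⥤ C) : (Fin m → C) ⥤ C where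
  obj x := F.obj fun i => (G i).obj fun j => x (b i j)
  map f := F.map fun i => (G i).map fun j => f (b i j)
  map_id _ := by
    refine Eq.trans (congrArg F.map ?_) (F.map_id _)
    funext i
    exact (G i).map_id _
  map_comp _ _ := by
    refine Eq.trans (congrArg F.map ?_) (F.map_comp _ _)
    funext i
    exact (G i).map_comp _ _

/-- The functor `x ↦ F (x ∘ σ)`. -/
@[simps]
abbrev endAct {n m : ℕ} (σ : Fin n → Fin m) (F : (Fin n → C) ⥤ C) : (Fin m → C) ⥤ C where
  obj x := F.obj fun i => x (σ i)
  map f := F.map fun i => f (σ i)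
  map_id _ := F.map_id _
  map_comp _ _ := F.map_comp _ _

/-- The horizontal composite of natural transformations. -/
@[simps]
abbrev endCompMap {n m : ℕ} {k : Fin n → ℕ} (b : ∀ i, Fin (k i) → Fin m)
    {F F' : (Fin n → C) ⥤ C} {G G' : ∀ i, (Fin (k i) → C) ⥤ C} (α : F ⟶ F')
    (β : ∀ i, G i ⟶ G' i) : endComp b F G ⟶ endComp b F' G' where
  app x := F.map (fun i => (β i).app fun j => x (b i j)) ≫
    α.app fun i => (G' i).obj fun j => x (b i j)
  naturality x y f := by
    dsimp
    rw [← Category.assoc, ← F.map_comp, Category.assoc, ← α.naturality, ← Category.assoc,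
      ← F.map_comp]
    congr 2
    funext i
    exact (β i).naturality _

/-- The natural transformation with components `α (x ∘ σ)`. -/
@[simps]
abbrev endActMap {n m : ℕ} (σ : Fin n → Fin m) {F F' : (Fin n → C) ⥤ C} (α : F ⟶ F') :
    endAct σ F ⟶ endAct σ F' where
  app x := α.app fun i => x (σ i)
  naturality _ _ _ := α.naturality _

theorem endComp_congr {n m : ℕ} {k : Fin n → ℕ} {b b' : ∀ i, Fin (k i) → Fin m} (h : b = b')
    (F : (Fin n → C) ⥤ C) (G : ∀ i, (Fin (k i) → C) ⥤ C) : endComp b F G = endComp b' F G := by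
  rw [h]

theorem endCompMap_congr {n m : ℕ} {k : Fin n → ℕ} {b b' : ∀ i, Fin (k i) → Fin m} (h : b = b')
    {F F' : (Fin n → C) ⥤ C} {G G' : ∀ i, (Fin (k i) → C) ⥤ C} (α : F ⟶ F')
    (β : ∀ i, G i ⟶ G' i) : HEq (endCompMap b α β) (endCompMap b' α β) := by
  rw [h]

theorem endAct_id {n : ℕ} {σ : Fin n → Fin n} (h : ∀ i, σ i = i) (F : (Fin n → C) ⥤ C) :
    endAct σ F = F := by
  obtain rfl : σ = fun i => i := funext h
  rfl

theorem endActMap_id {n : ℕ} {σ : Fin n → Fin n} (h : ∀ i, σ i = i) {F F' : (Fin n → C) ⥤ C}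
    (α : F ⟶ F') : HEq (endActMap σ α) α := by
  obtain rfl : σ = fun i => i := funext h
  rfl

theorem endComp_assoc {n m N : ℕ} {k : Fin n → ℕ} {l : Fin m → ℕ} {b : ∀ i, Fin (k i) → Fin m}
    {c : ∀ p, Fin (l p) → Fin N} {s : Fin n → ℕ}
    {d : ∀ i j, Fin (l (b i j)) → Fin (s i)} {e : ∀ i, Fin (s i) → Fin N}
    (h : (fun i j t => c (b i j) t) = fun i j t => e i (d i j t))
    (F : (Fin n → C) ⥤ C) (G : ∀ i, (Fin (k i) → C) ⥤ C) (H : ∀ p, (Fin (l p) → C) ⥤ C) :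
    endComp c (endComp b F G) H = endComp e F (fun i => endComp (d i) (G i) fun j => H (b i j)) := by
  let T (w : ∀ i j, Fin (l (b i j)) → Fin N) : (Fin N → C) ⥤ C :=
    endComp (k := fun _ => N) (fun _ => id) F (fun i => endComp (w i) (G i) fun j => H (b i j))
  exact congrArg T h

theorem endCompMap_assoc {n m N : ℕ} {k : Fin n → ℕ} {l : Fin m → ℕ}
    {b : ∀ i, Fin (k i) → Fin m} {c : ∀ p, Fin (l p) → Fin N} {s : Fin n → ℕ}
    {d : ∀ i j, Fin (l (b i j)) → Fin (s i)} {e : ∀ i, Fin (s i) → Fin N}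
    (h : (fun i j t => c (b i j) t) = fun i j t => e i (d i j t))
    {F F' : (Fin n → C) ⥤ C} {G G' : ∀ i, (Fin (k i) → C) ⥤ C} {H H' : ∀ p, (Fin (l p) → C) ⥤ C}
    (α : F ⟶ F') (β : ∀ i, G i ⟶ G' i) (γ : ∀ p, H p ⟶ H' p) :
    HEq (endCompMap c (endCompMap b α β) γ)
      (endCompMap e α (fun i => endCompMap (d i) (β i) fun j => γ (b i j))) := by
  let T (w : ∀ i j, Fin (l (b i j)) → Fin N) :=
    endCompMap (k := fun _ => N) (fun _ => id) α
      (fun i => endCompMap (w i) (β i) fun j => γ (b i j))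
  have h1 : endCompMap c (endCompMap b α β) γ = T (fun i j t => c (b i j) t) := by
    ext x
    change F.map _ ≫ (F.map _ ≫ α.app _) = F.map _ ≫ α.app _
    rw [← Category.assoc, ← F.map_comp]
    rfl
  have h2 : endCompMap e α (fun i => endCompMap (d i) (β i) fun j => γ (b i j))
      = T (fun i j t => e i (d i j t)) := rfl
  exact (heq_of_eq h1).trans ((congr_arg_heq T h).trans (heq_of_eq h2.symm))

/-- The endomorphism operad of a category in `Cat`: the operations of arity `n` are the functors
`C ^ n ⥤ C`, the 2-cells are natural transformations, composition is substitution, and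
`(σ • F) (x) = F (x ∘ σ)`. -/
abbrev endOperad (C : Type u) [Category.{v} C] :
    CatSymmOperad.{max u v, max u v} where
  Op n := (Fin n → C) ⥤ C
  one := endOne C
  comp h F G := endComp (block h) F G
  act σ F := endAct σ F
  one_comp h F := endAct_id (σ := fun j => block (k := fun _ => _) h 0 j)
    (fun j => block_one_left h 0 j) F
  comp_one h F := endAct_id (σ := fun i => block (k := fun _ => 1) h i 0)
    (fun i => block_one_right h i 0) F
  assoc h _ hN F G H := endComp_assoc
    (by funext i j t; exact block_assoc h hN i j t) F G H
  act_one _ := rfl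
  act_mul _ _ _ := rfl
  comp_act_left h σ h' F G :=
    endComp_congr (by funext i j; exact (blockPerm_block h σ h' i j).symm) F (fun i => G (σ i))
  comp_act_right h τ F G :=
    endComp_congr (by funext i j; exact (innerPerm_block h τ i j).symm) F G
  compMap h _ _ _ _ α β := endCompMap (block h) α β
  actMap σ _ _ α := endActMap σ α
  compMap_id h F G := by
    ext x
    exact (Category.comp_id _).trans (F.map_id _)
  compMap_comp h F _ _ _ _ _ α α' β β' := by
    ext x
    change F.map ((fun i => (β i).app _) ≫ fun i => (β' i).app _) ≫ α.app _ ≫ α'.app _ =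
      (F.map _ ≫ α.app _) ≫ _ ≫ α'.app _
    rw [F.map_comp, Category.assoc, Category.assoc, α.naturality_assoc]
  actMap_id _ _ := rfl
  actMap_comp _ _ _ _ _ _ := rfl
  one_compMap h F _ α := by
    refine HEq.trans (heq_of_eq ?_) (endActMap_id (σ := fun j => block (k := fun _ => _) h 0 j)
      (fun j => block_one_left h 0 j) α)
    ext x
    exact Category.comp_id _
  compMap_one h F _ α := by
    refine HEq.trans (heq_of_eq ?_) (endActMap_id (σ := fun i => block (k := fun _ => 1) h i 0)
      (fun i => block_one_right h i 0) α)
    ext x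
    exact (congrArg (· ≫ _) (F.map_id _)).trans (Category.id_comp _)
  assocMap h _ hN _ _ _ _ _ _ α β γ := endCompMap_assoc
    (by funext i j t; exact block_assoc h hN i j t) α β γ
  actMap_one _ := HEq.rfl
  actMap_mul _ _ _ _ _ := HEq.rfl
  compMap_act_left h σ h' _ _ _ _ α β :=
    endCompMap_congr (by funext i j; exact (blockPerm_block h σ h' i j).symm) α (fun i => β (σ i))
  compMap_act_right h τ _ _ _ _ α β :=
    endCompMap_congr (by funext i j; exact (innerPerm_block h τ i j).symm) α β

end End

/-! ### Algebras in `Cat` and their weak maps -/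

/-- An algebra structure on the category `C` for a symmetric `Cat`-operad `Q`. -/
abbrev Algebra (Q : CatSymmOperad.{w, t}) (C : Type u) [Category.{v} C] :=
  CatSymmOperad.Hom Q (endOperad C)

section Algebra

variable {Q : CatSymmOperad.{w, t}}

/-- The functor `C ^ n ⥤ C` that interprets a 1-cell. -/
abbrev Algebra.fn {C : Type u} [Category.{v} C] (h : Algebra Q C) {n : ℕ} (q : Q.Op n) :
    (Fin n → C) ⥤ C :=
  h.app q

/-- The natural transformation that interprets a 2-cell. -/
abbrev Algebra.trans {C : Type u} [Category.{v} C] (h : Algebra Q C) {n : ℕ} {q q' : Q.Op n}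
    (δ : q ⟶ q') : Algebra.fn h q ⟶ Algebra.fn h q' :=
  h.map δ

theorem Algebra.one_obj {C : Type u} [Category.{v} C] (h : Algebra Q C) (x : Fin 1 → C) :
    (Algebra.fn h Q.one).obj x = x 0 :=
  congrArg (fun T : (Fin 1 → C) ⥤ C => T.obj x) h.app_one

theorem Algebra.comp_obj {C : Type u} [Category.{v} C] (h : Algebra Q C) {n m : ℕ}
    {k : Fin n → ℕ} (hm : ∑ i, k i = m) (q : Q.Op n) (r : ∀ i, Q.Op (k i)) (x : Fin m → C) :
    (Algebra.fn h (Q.comp hm q r)).obj x =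
      (Algebra.fn h q).obj fun i => (Algebra.fn h (r i)).obj fun j => x (block hm i j) :=
  congrArg (fun T : (Fin m → C) ⥤ C => T.obj x) (h.app_comp hm q r)

theorem Algebra.comp_map {C : Type u} [Category.{v} C] (h : Algebra Q C) {n m : ℕ}
    {k : Fin n → ℕ} (hm : ∑ i, k i = m) (q : Q.Op n) (r : ∀ i, Q.Op (k i)) {x y : Fin m → C}
    (f : ∀ p, x p ⟶ y p) :
    HEq ((Algebra.fn h (Q.comp hm q r)).map f) ((Algebra.fn h q).map (X := fun _ => _)
      (Y := fun _ => _) fun i => (Algebra.fn h (r i)).map (X := fun j => x (block hm i j))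
        (Y := fun j => y (block hm i j)) fun j => f (block hm i j)) :=
  congr_arg_heq (fun T : (Fin m → C) ⥤ C => T.map f) (h.app_comp hm q r)

theorem Algebra.act_obj {C : Type u} [Category.{v} C] (h : Algebra Q C) {n : ℕ}
    (σ : Equiv.Perm (Fin n)) (q : Q.Op n) (x : Fin n → C) :
    (Algebra.fn h (Q.act σ q)).obj x = (Algebra.fn h q).obj fun i => x (σ i) :=
  congrArg (fun T : (Fin n → C) ⥤ C => T.obj x) (h.app_act σ q)

/-- A weak map of `Q`-algebras: a functor `F` with invertible 2-cells
`h' q (F x₁, …, F xₙ) ⟶ F (h q (x₁, …, xₙ))` that are natural in the `xᵢ` and in the 1-cell `q` and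
compatible with the identity, composition and the symmetric group actions of `Q`.
In the last three axioms the two sides have equal, but not definitionally equal, types. -/
@[ext]
structure WeakMap {A B : Type u} [Category.{v} A] [Category.{v} B] (h : Algebra Q A)
    (h' : Algebra Q B) where
  functor : A ⥤ B
  coh : ∀ {n : ℕ} (q : Q.Op n) (x : Fin n → A),
    (Algebra.fn h' q).obj (fun i => functor.obj (x i)) ≅ functor.obj ((Algebra.fn h q).obj x)
  coh_naturality : ∀ {n : ℕ} (q : Q.Op n) {x y : Fin n → A} (f : x ⟶ y),
    (Algebra.fn h' q).map (X := fun i => functor.obj (x i)) (Y := fun i => functor.obj (y i))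
      (fun i => functor.map (f i)) ≫ (coh q y).hom =
      (coh q x).hom ≫ functor.map ((Algebra.fn h q).map f)
  coh_trans : ∀ {n : ℕ} {q q' : Q.Op n} (δ : q ⟶ q') (x : Fin n → A),
    (Algebra.trans h' δ).app (fun i => functor.obj (x i)) ≫ (coh q' x).hom =
      (coh q x).hom ≫ functor.map ((Algebra.trans h δ).app x)
  coh_one : ∀ x : Fin 1 → A, HEq (coh Q.one x).hom (𝟙 (functor.obj (x 0)))
  coh_comp : ∀ {n m : ℕ} {k : Fin n → ℕ} (hm : ∑ i, k i = m) (q : Q.Op n) (r : ∀ i, Q.Op (k i))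
    (x : Fin m → A),
    HEq (coh (Q.comp hm q r) x).hom
      ((Algebra.fn h' q).map
          (X := fun i => (Algebra.fn h' (r i)).obj fun j => functor.obj (x (block hm i j)))
          (Y := fun i => functor.obj ((Algebra.fn h (r i)).obj fun j => x (block hm i j)))
          (fun i => (coh (r i) fun j => x (block hm i j)).hom) ≫
        (coh q fun i => (Algebra.fn h (r i)).obj fun j => x (block hm i j)).hom)
  coh_act : ∀ {n : ℕ} (σ : Equiv.Perm (Fin n)) (q : Q.Op n) (x : Fin n → A),
    HEq (coh (Q.act σ q) x).hom (coh q fun i => x (σ i)).hom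

theorem heq_comp {A : Type u} [Category.{v} A] {a b c a' b' c' : A} {f : a ⟶ b} {g : b ⟶ c}
    {f' : a' ⟶ b'} {g' : b' ⟶ c'} (ha : a = a') (hb : b = b') (hc : c = c') (hf : HEq f f')
    (hg : HEq g g') : HEq (f ≫ g) (f' ≫ g') := by
  subst ha hb hc
  rw [eq_of_heq hf, eq_of_heq hg]

theorem heq_map {A B : Type u} [Category.{v} A] [Category.{v} B] (F : A ⥤ B) {a b a' b' : A}
    {f : a ⟶ b} {f' : a' ⟶ b'} (ha : a = a') (hb : b = b') (hf : HEq f f') :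
    HEq (F.map f) (F.map f') := by
  subst ha hb
  rw [eq_of_heq hf]

theorem heq_id {A : Type u} [Category.{v} A] {a a' : A} (h : a = a') : HEq (𝟙 a) (𝟙 a') := by
  rw [h]

/-- The identity weak map. -/
def WeakMap.id {A : Type u} [Category.{v} A] (h : Algebra Q A) : WeakMap h h where
  functor := 𝟭 A
  coh q x := Iso.refl ((Algebra.fn h q).obj x)
  coh_naturality q x y f := (Category.comp_id _).trans (Category.id_comp _).symm
  coh_trans δ x := (Category.comp_id _).trans (Category.id_comp _).symm
  coh_one x := heq_id (Algebra.one_obj h x)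
  coh_comp hm q r x := by
    refine (heq_id (Algebra.comp_obj h hm q r x)).trans (heq_of_eq ?_)
    exact ((Category.comp_id _).trans ((Algebra.fn h q).map_id _)).symm
  coh_act σ q x := heq_id (Algebra.act_obj h σ q x)

/-- The composite of weak maps. -/
def WeakMap.comp {A B D : Type u} [Category.{v} A] [Category.{v} B] [Category.{v} D]
    {h : Algebra Q A} {h' : Algebra Q B} {h'' : Algebra Q D} (F : WeakMap h h')
    (G : WeakMap h' h'') : WeakMap h h'' where
  functor := F.functor ⋙ G.functor
  coh q x := G.coh q (fun i => F.functor.obj (x i)) ≪≫ G.functor.mapIso (F.coh q x)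
  coh_naturality q x y f := by
    have h1 := G.coh_naturality q (x := fun i => F.functor.obj (x i))
      (y := fun i => F.functor.obj (y i)) (fun i => F.functor.map (f i))
    have h2 := congrArg G.functor.map (F.coh_naturality q f)
    rw [G.functor.map_comp, G.functor.map_comp] at h2
    simp only [Iso.trans_hom, Functor.mapIso_hom, Functor.comp_map, Category.assoc] at h1 h2 ⊢
    rw [← h2, reassoc_of% h1]
  coh_trans δ x := by
    have h1 := G.coh_trans δ (fun i => F.functor.obj (x i))
    have h2 := congrArg G.functor.map (F.coh_trans δ x)
    rw [G.functor.map_comp, G.functor.map_comp] at h2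
    simp only [Iso.trans_hom, Functor.mapIso_hom, Functor.comp_map, Category.assoc] at h1 h2 ⊢
    rw [← h2]
    exact (Category.assoc _ _ _).symm.trans ((congrArg (· ≫ _) h1).trans (Category.assoc _ _ _))
  coh_one x := by
    refine (heq_comp (Algebra.one_obj h'' _) (congrArg _ (Algebra.one_obj h' _))
      (congrArg (fun a => G.functor.obj (F.functor.obj a)) (Algebra.one_obj h _)) (G.coh_one _)
      (heq_map G.functor (Algebra.one_obj h' _) (congrArg _ (Algebra.one_obj h _))
        (F.coh_one x))).trans (heq_of_eq ?_)
    rw [G.functor.map_id]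
    exact Category.comp_id _
  coh_comp hm q r x := by
    refine (heq_comp (Algebra.comp_obj h'' _ _ _ _) (congrArg _ (Algebra.comp_obj h' _ _ _ _))
      (congrArg (fun a => G.functor.obj (F.functor.obj a)) (Algebra.comp_obj h _ _ _ _))
      (G.coh_comp hm q r _)
      (heq_map G.functor (Algebra.comp_obj h' _ _ _ _) (congrArg _ (Algebra.comp_obj h _ _ _ _))
        (F.coh_comp hm q r x))).trans (heq_of_eq ?_)
    have h1 := G.coh_naturality q
      (x := fun i => (Algebra.fn h' (r i)).obj fun j => F.functor.obj (x (block hm i j)))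
      (y := fun i => F.functor.obj ((Algebra.fn h (r i)).obj fun j => x (block hm i j)))
      (fun i => (F.coh (r i) fun j => x (block hm i j)).hom)
    have h2 := (Algebra.fn h'' q).map_comp
      (X := fun i => (Algebra.fn h'' (r i)).obj fun j =>
        G.functor.obj (F.functor.obj (x (block hm i j))))
      (Y := fun i => G.functor.obj ((Algebra.fn h' (r i)).obj fun j =>
        F.functor.obj (x (block hm i j))))
      (Z := fun i => G.functor.obj (F.functor.obj
        ((Algebra.fn h (r i)).obj fun j => x (block hm i j))))
      (fun i => (G.coh (r i) fun j => F.functor.obj (x (block hm i j))).hom)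
      (fun i => G.functor.map (F.coh (r i) fun j => x (block hm i j)).hom)
    rw [G.functor.map_comp, Category.assoc, ← reassoc_of% h1, ← Category.assoc]
    refine (congrArg (· ≫ _) h2.symm).trans ?_
    rfl
  coh_act σ q x :=
    heq_comp (Algebra.act_obj h'' _ _ _) (congrArg _ (Algebra.act_obj h' _ _ _))
      (congrArg (fun a => G.functor.obj (F.functor.obj a)) (Algebra.act_obj h _ _ _))
      (G.coh_act σ q _)
      (heq_map G.functor (Algebra.act_obj h' _ _ _) (congrArg _ (Algebra.act_obj h _ _ _))
        (F.coh_act σ q x))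

end Algebra

/-- A small category with the structure of a `Q`-algebra. -/
structure AlgCat (Q : CatSymmOperad.{w, t}) where
  C : Type u
  [cat : Category.{v} C]
  alg : Algebra Q C

attribute [instance] AlgCat.cat

/-- The category of `Q`-algebras in `Cat` and weak maps. -/
instance (Q : CatSymmOperad.{w, t}) : Category (AlgCat.{w, t, v, u} Q) where
  Hom A B := WeakMap A.alg B.alg
  id A := WeakMap.id A.alg
  comp F G := WeakMap.comp F G
  id_comp F := by
    refine WeakMap.ext rfl (heq_of_eq ?_)
    funext n q x
    ext
    simp [WeakMap.comp, WeakMap.id]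
  comp_id F := by
    refine WeakMap.ext rfl (heq_of_eq ?_)
    funext n q x
    ext
    exact Category.id_comp _
  assoc F G H := by
    refine WeakMap.ext rfl (heq_of_eq ?_)
    funext n q x
    ext
    simp [WeakMap.comp]

/-- The underlying category of a `Q`-algebra. -/
def AlgCat.forget (Q : CatSymmOperad.{w, t}) : AlgCat.{w, t, v, u} Q ⥤ Cat.{v, u} where
  obj A := Cat.of A.C
  map F := (WeakMap.functor F).toCatHom

/-! ### Symmetric monoidal categories -/

open MonoidalCategory Functor.LaxMonoidal

/-- A small symmetric monoidal category. -/
structure SMC where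
  C : Type u
  [cat : Category.{v} C]
  [monoidal : MonoidalCategory C]
  [symmetric : SymmetricCategory C]

attribute [instance] SMC.cat SMC.monoidal SMC.symmetric

/-- A weak symmetric monoidal functor: a functor with invertible `F₀` and `F₂`. -/
structure SMC.Hom (M N : SMC.{v, u}) where
  functor : M.C ⥤ N.C
  [braided : functor.Braided]

attribute [instance] SMC.Hom.braided

theorem SMC.Hom.ext' {M N : SMC.{v, u}} {F G : SMC.Hom M N} (h : F.functor = G.functor)
    (h0 : HEq (ε F.functor) (ε G.functor))
    (h2 : ∀ A B : M.C, HEq (μ F.functor A B) (μ G.functor A B)) : F = G := by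
  obtain ⟨F, bF⟩ := F
  obtain ⟨G, bG⟩ := G
  dsimp only at h h0 h2
  subst h
  congr 1
  apply Functor.Braided.toMonoidal_injective
  apply Functor.Monoidal.toLaxMonoidal_injective
  refine Functor.LaxMonoidal.ext (eq_of_heq h0) ?_
  funext A B
  exact eq_of_heq (h2 A B)

/-- The category of symmetric monoidal categories and weak symmetric monoidal functors. -/
instance : Category SMC.{v, u} where
  Hom := SMC.Hom
  id M := { functor := 𝟭 M.C }
  comp F G := { functor := F.functor ⋙ G.functor }
  id_comp F := SMC.Hom.ext' rfl (by simp) (by simp)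
  comp_id F := SMC.Hom.ext' rfl (by simp) (by simp)
  assoc F G H := SMC.Hom.ext' rfl (by simp) (by simp)

/-- The underlying category of a symmetric monoidal category. -/
def SMC.forget : SMC.{v, u} ⥤ Cat.{v, u} where
  obj M := Cat.of M.C
  map F := (SMC.Hom.functor F).toCatHom

/-! ### The presentation of the operad for commutative monoids -/

/-- The signature of commutative monoids. -/
inductive CMonOp : ℕ → Type
  | e : CMonOp 0
  | dot : CMonOp 2

/-- The names of the equations, with the number of variables that they involve. -/
inductive CMonEq : ℕ → Type
  | assoc : CMonEq 3
  | unitl : CMonEq 1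
  | unitr : CMonEq 1
  | comm : CMonEq 2

namespace CMonEq

open OpTerm

/-- The product of two terms. -/
abbrev mul {X : Type} (s t : OpTerm CMonOp X) : OpTerm CMonOp X :=
  .op .dot ![s, t]

/-- The unit term. -/
abbrev unit {X : Type} : OpTerm CMonOp X :=
  .op .e ![]

/-- The generating operation `e`. -/
abbrev e : (freeOperad CMonOp).Op 0 :=
  ⟨unit, fun x => x.elim0⟩

/-- The generating operation `x₁ . x₂`. -/
abbrev dot : (freeOperad CMonOp).Op 2 :=
  ⟨mul (var 0) (var 1), fun x => by fin_cases x <;> simp [count]⟩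

/-- The left-hand sides: `x₁.(x₂.x₃)`, `e.x₁`, `x₁.e`, `x₁.x₂`. -/
abbrev lhs : ∀ {n : ℕ}, CMonEq n → (freeOperad CMonOp).Op n
  | _, assoc => ⟨mul (var 0) (mul (var 1) (var 2)), fun x => by
      fin_cases x <;> simp [count]⟩
  | _, unitl => ⟨mul unit (var 0), fun x => by fin_cases x; simp [count]⟩
  | _, unitr => ⟨mul (var 0) unit, fun x => by fin_cases x; simp [count]⟩
  | _, comm => dot

/-- The right-hand sides: `(x₁.x₂).x₃`, `x₁`, `x₁`, `x₂.x₁`. -/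
abbrev rhs : ∀ {n : ℕ}, CMonEq n → (freeOperad CMonOp).Op n
  | _, assoc => ⟨mul (mul (var 0) (var 1)) (var 2), fun x => by
      fin_cases x <;> simp [count]⟩
  | _, unitl => (freeOperad CMonOp).one
  | _, unitr => (freeOperad CMonOp).one
  | _, comm => ⟨mul (var 1) (var 0), fun x => by fin_cases x <;> simp [count]⟩

/-- The map `φ` from the free symmetric operad on `e` and `.` to the terminal operad. -/
abbrev φ : freeOperad CMonOp ⟶ terminalOperad.{0} :=
  toTerminal (freeOperad CMonOp)

theorem condition : freeOperadLift lhs ≫ φ = freeOperadLift rhs ≫ φ :=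
  toTerminal_unique _ _

/-- The 2-cell of the weakening from the left-hand side of an equation to its right-hand side. -/
abbrev cell {n : ℕ} (E : CMonEq n) :
    ((weakening φ).cat n).Hom (lhs E) (rhs E) :=
  ⟨rfl⟩

end CMonEq

/-- The category of `φ`-weak `P`-categories and `φ`-weak `P`-functors, for the terminal operad
`P`. -/
abbrev WkPCat :=
  AlgCat.{0, 0, v, u} (weakening CMonEq.φ)

/-- The algebra structure `h` on `C` and the symmetric monoidal structure of `C` correspond to each
other: `.` is interpreted by `⊗`, `e` by the unit object, and the 2-cells
`x₁.(x₂.x₃) ⟶ (x₁.x₂).x₃`, `e.x₁ ⟶ x₁`, `x₁.e ⟶ x₁`, `x₁.x₂ ⟶ x₂.x₁` by the associativity, unit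
and symmetry isomorphisms. (Mathlib's `α_` points in the other direction.) -/
structure Matches (C : Type u) [Category.{v} C] [MonoidalCategory C] [SymmetricCategory C]
    (h : Algebra (weakening CMonEq.φ) C) : Prop where
  dot_obj : ∀ A B : C, (Algebra.fn h CMonEq.dot).obj ![A, B] = A ⊗ B
  dot_map : ∀ {x y : Fin 2 → C} (f : x ⟶ y),
    HEq ((Algebra.fn h CMonEq.dot).map f) (f 0 ⊗ₘ f 1)
  e_obj : (Algebra.fn h CMonEq.e).obj ![] = 𝟙_ C
  assoc : ∀ A B D : C,
    HEq ((Algebra.trans h (CMonEq.cell .assoc)).app ![A, B, D]) (α_ A B D).inv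
  unitl : ∀ A : C, HEq ((Algebra.trans h (CMonEq.cell .unitl)).app ![A]) (λ_ A).hom
  unitr : ∀ A : C, HEq ((Algebra.trans h (CMonEq.cell .unitr)).app ![A]) (ρ_ A).hom
  comm : ∀ A B : C, HEq ((Algebra.trans h (CMonEq.cell .comm)).app ![A, B]) (β_ A B).hom

/-- `M` and `X` have the same underlying category, and their structures correspond. -/
def Corresponds (M : SMC.{v, u}) (X : WkPCat.{v, u}) : Prop :=
  ∃ h : Algebra (weakening CMonEq.φ) M.C, X = ⟨M.C, h⟩ ∧ Matches M.C h

/-- `F` and `G` are morphisms between corresponding objects, have the same underlying functor, and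
the components of `G` at `.` and `e` are `F₂` and `F₀`. -/
def CorrespondsHom {M N : SMC.{v, u}} {X Y : WkPCat.{v, u}} (F : M ⟶ N) (G : X ⟶ Y) : Prop :=
  ∃ (h : Algebra (weakening CMonEq.φ) M.C) (h' : Algebra (weakening CMonEq.φ) N.C)
    (G' : WeakMap h h'),
    X = ⟨M.C, h⟩ ∧ Matches M.C h ∧ Y = ⟨N.C, h'⟩ ∧ Matches N.C h' ∧ HEq G G' ∧
    G'.functor = SMC.Hom.functor F ∧
    (∀ A B : M.C, HEq (G'.coh CMonEq.dot ![A, B]).hom (μ (SMC.Hom.functor F) A B)) ∧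
    HEq (G'.coh CMonEq.e ![]).hom (ε (SMC.Hom.functor F))

end WkOperad

/-!
The operations of the free operad are linear terms in `·` and `e`. Two such terms in the same
variables can be rebracketed to the right-bracketed products of their variables, and these differ by
a permutation of the factors, which adjacent transpositions generate (`nonempty_coh`). Each such
rebracketing is a derivation from the equations (`CMonEq.rel_of_coh`), so the congruence that the
equations generate identifies all operations of equal arity (`CMonEq.rel_all`), and the terminal
operad is the coequalizer (`CMonEq.isColimit`).

Since `φ` identifies all operations of equal arity, an algebra of the weakening interprets each
linear term by a functor and any two linear terms in the same variables by one specified natural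
isomorphism. For a symmetric monoidal category the functors are iterated tensor products, and the
isomorphisms are given by coherence (`MonTerm.Coh.iso_hom_eq`): any two composites of structural
isomorphisms between terms without repeated variables agree. To see this, write each object `x i` as
`x i ⊗ I` or `I ⊗ x i`, and use that the tensor product `C × C ⥤ C` is symmetric monoidal to reduce
the claim to the case in which all variables but one are isomorphic to the unit object. There, both
terms contract to a single object, and the contractions absorb all structural isomorphisms. A
symmetric monoidal functor yields a weak map whose components are composed of `F₀` and `F₂`
(`comparison`).

Conversely, an algebra determines a tensor product, a unit object and structural isomorphisms. Each
edge in a coherence diagram is the interpretation of a 2-cell between linear terms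
(`Algebra.cell_subst`, `Algebra.cell_mul`), and there is only one 2-cell between given terms; so the
axioms hold. The axioms of a symmetric monoidal functor follow in the same way from the
naturality of a weak map in the 2-cells (`WeakMap.cell_comparison`).

The two constructions are inverse to each other because the interpretation of the generating
operations and of the 2-cells that name the equations determines an algebra (`algebra_ext`), the
components at the generating operations determine a weak map (`weakMap_ext`), and the same data
determine a symmetric monoidal structure (`Matches.smc_eq`) or functor.

The axioms of an operad hold in `End(C)` as equalities of functors, so that many equations between
morphisms have sides of types that are equal only propositionally; these are stated as heterogeneous
equalities. To reduce their number, an algebra is replaced by an equal one in which composite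
operations are by definition interpreted by iterates of the generating ones (`Algebra.strict`).
-/

namespace WkOperad

/-! ### Decomposition of linear terms -/

namespace OpTerm

variable {Φ : ℕ → Type} {X Y Z : Type}

theorem rename_rename (t : OpTerm Φ X) (f : X → Y) (g : Y → Z) :
    (t.rename f).rename g = t.rename (g ∘ f) := by
  simp [rename, bind_bind, bind]

theorem rename_op {n : ℕ} (φ : Φ n) (ts : Fin n → OpTerm Φ X) (f : X → Y) :
    (op φ ts).rename f = op φ fun i => (ts i).rename f :=
  rfl

theorem count_rename_apply [DecidableEq X] [DecidableEq Y] [Fintype X] (t : OpTerm Φ X)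
    {f : X → Y} (hf : Function.Injective f) (x : X) : (t.rename f).count (f x) = t.count x := by
  simp [count_rename, hf.eq_iff]

theorem exists_rename_eq [DecidableEq Y] (f : X → Y) (t : OpTerm Φ Y)
    (h : ∀ y, t.count y ≠ 0 → y ∈ Set.range f) : ∃ s : OpTerm Φ X, s.rename f = t := by
  induction t with
  | var y =>
    obtain ⟨x, rfl⟩ := h y (by simp [count])
    exact ⟨var x, rfl⟩
  | op φ ts ih =>
    choose s hs using fun i => ih i fun y hy => h y fun h0 =>
      hy ((Finset.sum_eq_zero_iff.1 (show ∑ i, (ts i).count y = 0 from h0)) i (Finset.mem_univ i))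
    exact ⟨op φ s, by simp [rename_op, hs]⟩

/-- A family of maps into `Fin n` that together hit every element once is, up to a permutation of
`Fin n`, the splitting of `Fin n` into consecutive blocks. -/
theorem exists_perm_block {m n : ℕ} {k : Fin m → ℕ} (g : ∀ i, Fin (k i) → Fin n)
    (hg : Function.Bijective fun p : Σ i, Fin (k i) => g p.1 p.2) :
    ∃ (h : ∑ i, k i = n) (σ : Equiv.Perm (Fin n)), ∀ i j, g i j = σ (block h i j) := by
  have h : ∑ i, k i = n := by
    have := Fintype.card_congr (Equiv.ofBijective _ hg)
    simpa using this
  refine ⟨h, (blockEquiv h).symm.trans (Equiv.ofBijective _ hg), fun i j => ?_⟩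
  simp [block]

/-- If terms over `Fin n` together use every variable once, then each of them is a relabelled
linear term, and the labels fit together to a permutation of `Fin n`. Any other family in which
the variables are distributed in the same way is decomposed with the same labels. -/
theorem exists_linear_decomposition {m n : ℕ} (us : Fin m → OpTerm Φ (Fin n))
    (hus : ∀ y, ∑ i, (us i).count y = 1) :
    ∃ (k : Fin m → ℕ) (h : ∑ i, k i = n) (σ : Equiv.Perm (Fin n)),
      ∀ us' : Fin m → OpTerm Φ (Fin n), (∀ i y, (us' i).count y = (us i).count y) →
        ∃ qs : ∀ i, (freeOperad Φ).Op (k i),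
          ∀ i, us' i = (qs i).1.rename fun j => σ (block h i j) := by
  have hle (i y) : (us i).count y ≤ 1 :=
    (hus y) ▸ Finset.single_le_sum (f := fun i => (us i).count y) (fun _ _ => Nat.zero_le _)
      (Finset.mem_univ i)
  let S (i : Fin m) : Finset (Fin n) := Finset.univ.filter fun y => (us i).count y ≠ 0
  let g (i : Fin m) : Fin (S i).card → Fin n := fun j => ((S i).equivFin.symm j).1
  have hginj (i) : Function.Injective (g i) :=
    Subtype.val_injective.comp (S i).equivFin.symm.injective
  have hgrange (i y) : y ∈ Set.range (g i) ↔ (us i).count y ≠ 0 := by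
    constructor
    · rintro ⟨j, rfl⟩
      exact (Finset.mem_filter.1 ((S i).equivFin.symm j).2).2
    · intro hy
      exact ⟨(S i).equivFin ⟨y, Finset.mem_filter.2 ⟨Finset.mem_univ _, hy⟩⟩, by simp [g]⟩
  have hg : Function.Bijective fun p : Σ i, Fin (S i).card => g p.1 p.2 := by
    constructor
    · rintro ⟨i, j⟩ ⟨i', j'⟩ hij
      dsimp only at hij
      have h1 : (us i).count (g i j) ≠ 0 := (hgrange _ _).1 ⟨j, rfl⟩
      have h2 : (us i').count (g i j) ≠ 0 := (hgrange _ _).1 ⟨j', hij.symm⟩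
      have hii : i = i' := by
        by_contra hne
        have := Finset.add_le_sum (f := fun a => (us a).count (g i j)) (s := Finset.univ)
          (fun _ _ => Nat.zero_le _) (Finset.mem_univ i) (Finset.mem_univ i') hne
        rw [hus] at this
        omega
      subst hii
      rw [hginj i hij]
    · intro y
      obtain ⟨i, -, hi⟩ := Finset.exists_ne_zero_of_sum_ne_zero (by rw [hus y]; exact one_ne_zero)
      obtain ⟨j, hj⟩ := (hgrange i y).2 hi
      exact ⟨⟨i, j⟩, hj⟩
  obtain ⟨h, σ, hσ⟩ := exists_perm_block g hg
  refine ⟨fun i => (S i).card, h, σ, fun us' hus' => ?_⟩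
  choose q hq using fun i => exists_rename_eq (g i) (us' i) fun y hy =>
    (hgrange i y).2 (by rwa [← hus'])
  refine ⟨fun i => ⟨q i, fun j => ?_⟩, fun i => ?_⟩
  · rw [← count_rename_apply (q i) (hginj i), hq, hus']
    have := hle i (g i j)
    have := (hgrange i (g i j)).1 ⟨j, rfl⟩
    omega
  · rw [← hq i]
    exact congrArg (fun f => (q i).rename f) (funext (hσ i))

end OpTerm

open OpTerm

/-- The generating operation of the free operad that is named by `φ`. -/
def freeOperad.gen {Φ : ℕ → Type} {n : ℕ} (φ : Φ n) : (freeOperad Φ).Op n :=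
  ⟨.op φ .var, fun x => by simp [count]⟩

theorem freeOperad.act_comp_val {Φ : ℕ → Type} {n m : ℕ} {k : Fin n → ℕ} (h : ∑ i, k i = m)
    (σ : Equiv.Perm (Fin m)) (p : (freeOperad Φ).Op n) (q : ∀ i, (freeOperad Φ).Op (k i)) :
    ((freeOperad Φ).act σ ((freeOperad Φ).comp h p q)).1 =
      p.1.bind fun i => (q i).1.rename fun j => σ (block h i j) := by
  simp [rename, bind_bind, OpTerm.bind]

/-- The operations of a free operad are generated by the identity and the generating operations
under composition and the symmetric group actions. -/
theorem freeOperad.induction {Φ : ℕ → Type} {P : ∀ {n : ℕ}, (freeOperad Φ).Op n → Prop}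
    (one : P (freeOperad Φ).one) (gen : ∀ {n : ℕ} (φ : Φ n), P (freeOperad.gen φ))
    (comp : ∀ {n m : ℕ} {k : Fin n → ℕ} (h : ∑ i, k i = m) (p : (freeOperad Φ).Op n)
      (q : ∀ i, (freeOperad Φ).Op (k i)), P p → (∀ i, P (q i)) → P ((freeOperad Φ).comp h p q))
    (act : ∀ {n : ℕ} (σ : Equiv.Perm (Fin n)) (p : (freeOperad Φ).Op n), P p →
      P ((freeOperad Φ).act σ p))
    {n : ℕ} (p : (freeOperad Φ).Op n) : P p := by
  -- The subterms of a linear term are linear only up to relabelling.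
  suffices key : ∀ {X : Type} (t : OpTerm Φ X) {n : ℕ} (g : Fin n → X) (p : (freeOperad Φ).Op n),
      p.1.rename g = t → P p from key _ id p rfl
  intro X t
  induction t with
  | var x =>
    intro n g p hp
    obtain ⟨t, ht⟩ := p
    cases t with
    | op φ us => cases hp
    | var y =>
      have hy (z : Fin n) : y = z := by
        by_contra hne
        have := ht z
        simp [count, hne] at this
      obtain rfl : n = 1 := by
        have h1 : Subsingleton (Fin n) := ⟨fun a b => (hy a).symm.trans (hy b)⟩
        have h2 := Fintype.card_le_one_iff_subsingleton.2 h1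
        have := y.2
        simp only [Fintype.card_fin] at h2
        omega
      obtain rfl : y = 0 := Subsingleton.elim _ _
      exact one
  | op φ ts ih =>
    intro n g p hp
    obtain ⟨t, ht⟩ := p
    cases t with
    | var y => cases hp
    | op ψ us =>
      dsimp only [rename_op] at hp
      injection hp with hm hφ hu
      subst hm
      obtain rfl := eq_of_heq hφ
      replace hu := congrFun (eq_of_heq hu)
      obtain ⟨k, h, σ, H⟩ := exists_linear_decomposition us ht
      obtain ⟨qs, hqs⟩ := H us fun _ _ => rfl
      have : (⟨.op ψ us, ht⟩ : (freeOperad Φ).Op n) =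
          (freeOperad Φ).act σ ((freeOperad Φ).comp h (freeOperad.gen ψ) qs) := by
        apply Subtype.ext
        rw [freeOperad.act_comp_val]
        exact congrArg (op ψ) (funext hqs)
      rw [this]
      refine act σ _ (comp h _ _ (gen ψ) fun i => ih i (fun j => g (σ (block h i j))) _ ?_)
      rw [← hu i, hqs i, rename_rename]
      rfl

end WkOperad

namespace WkOperad

/-! ### Binary terms and formal coherence isomorphisms -/

/-- Terms in a binary operation and a constant, with variables in `X`. Unlike the isomorphic
`OpTerm CMonOp X`, whose nodes carry functions on `Fin 0` and `Fin 2`, they are determined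
definitionally by their subterms. -/
inductive MonTerm (X : Type) : Type
  | var (x : X) : MonTerm X
  | unit : MonTerm X
  | mul (s t : MonTerm X) : MonTerm X

namespace MonTerm

variable {X Y Z : Type}

/-- Simultaneous substitution. -/
def bind : MonTerm X → (X → MonTerm Y) → MonTerm Y
  | var x, s => s x
  | unit, _ => unit
  | mul a b, s => mul (a.bind s) (b.bind s)

/-- Renaming of variables. -/
def rename (f : X → Y) (t : MonTerm X) : MonTerm Y :=
  t.bind fun x => var (f x)

/-- The variables of a term, from left to right. -/
def leaves : MonTerm X → List X
  | var x => [x]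
  | unit => []
  | mul s t => s.leaves ++ t.leaves

theorem leaves_rename (f : X → Y) (t : MonTerm X) : (t.rename f).leaves = t.leaves.map f := by
  induction t with
  | var x => rfl
  | unit => rfl
  | mul s t hs ht => exact (congrArg₂ (· ++ ·) hs ht).trans List.map_append.symm

theorem rename_eq_mul {f : X → Y} {t : MonTerm X} {a b : MonTerm Y} (h : t.rename f = mul a b) :
    ∃ a' b', t = mul a' b' ∧ a'.rename f = a ∧ b'.rename f = b := by
  cases t with
  | var x => cases h
  | unit => cases h
  | mul a' b' =>
    injection h with h1 h2
    exact ⟨a', b', rfl, h1, h2⟩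

theorem rename_eq_unit {f : X → Y} {t : MonTerm X} (h : t.rename f = unit) : t = unit := by
  cases t with
  | var x => cases h
  | unit => rfl
  | mul a b => cases h

theorem rename_injective {f : X → Y} (hf : Function.Injective f) :
    Function.Injective (rename f) := by
  intro s
  induction s with
  | var x =>
    intro t h
    cases t with
    | var y =>
      injection h with h
      rw [hf h]
    | unit => cases h
    | mul a b => cases h
  | unit => exact fun t h => (rename_eq_unit h.symm).symm
  | mul a b ha hb =>
    intro t h
    obtain ⟨a', b', rfl, h1, h2⟩ := rename_eq_mul h.symm
    rw [ha h1.symm, hb h2.symm]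

theorem exists_rename_eq (f : X → Y) (t : MonTerm Y) (h : ∀ y ∈ t.leaves, y ∈ Set.range f) :
    ∃ s : MonTerm X, s.rename f = t := by
  induction t with
  | var y =>
    obtain ⟨x, rfl⟩ := h y List.mem_cons_self
    exact ⟨var x, rfl⟩
  | unit => exact ⟨unit, rfl⟩
  | mul a b ha hb =>
    obtain ⟨a', rfl⟩ := ha fun y hy => h y (List.mem_append_left _ hy)
    obtain ⟨b', rfl⟩ := hb fun y hy => h y (List.mem_append_right _ hy)
    exact ⟨mul a' b', rfl⟩

/-- Formal coherence isomorphisms between terms: the expressions built from identities, inverses,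
composites, tensor products and the structural isomorphisms of a symmetric monoidal category. -/
inductive Coh : MonTerm X → MonTerm X → Type
  | refl (t : MonTerm X) : Coh t t
  | symm {s t : MonTerm X} : Coh s t → Coh t s
  | trans {s t r : MonTerm X} : Coh s t → Coh t r → Coh s r
  | tensor {s s' t t' : MonTerm X} : Coh s s' → Coh t t' → Coh (mul s t) (mul s' t')
  | assoc (s t r : MonTerm X) : Coh (mul s (mul t r)) (mul (mul s t) r)
  | unitl (t : MonTerm X) : Coh (mul unit t) t
  | unitr (t : MonTerm X) : Coh (mul t unit) t
  | comm (s t : MonTerm X) : Coh (mul s t) (mul t s)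

theorem Coh.leaves_perm {s t : MonTerm X} (f : Coh s t) : s.leaves.Perm t.leaves := by
  induction f with
  | refl t => exact .refl _
  | symm _ h => exact h.symm
  | trans _ _ h h' => exact h.trans h'
  | tensor _ _ h h' => exact h.append h'
  | assoc s t r => simp [leaves]
  | unitl t => simp [leaves]
  | unitr t => simp [leaves]
  | comm s t => exact List.perm_append_comm

/-- The right-bracketed product of a list of variables. -/
def prod : List X → MonTerm X
  | [] => unit
  | x :: l => mul (var x) (prod l)

/-- Rebracketing of a product of two normal forms. -/
def Coh.prodAppend : ∀ l l' : List X, Coh (mul (prod l) (prod l')) (prod (l ++ l'))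
  | [], _ => .unitl _
  | _ :: l, l' => .trans (.symm (.assoc _ _ _)) (.tensor (.refl _) (prodAppend l l'))

/-- Rebracketing of a term to the product of its variables. -/
def Coh.toProd : ∀ t : MonTerm X, Coh t (prod t.leaves)
  | var _ => .symm (.unitr _)
  | unit => .refl _
  | mul s t => .trans (.tensor (toProd s) (toProd t)) (prodAppend _ _)

theorem Coh.nonempty_prod {l l' : List X} (h : l.Perm l') : Nonempty (Coh (prod l) (prod l')) := by
  induction h with
  | nil => exact ⟨.refl _⟩
  | cons x _ ih => exact ih.map fun f => .tensor (.refl _) f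
  | swap x y l =>
    exact ⟨.trans (.assoc _ _ _)
      (.trans (.tensor (.comm _ _) (.refl _)) (.symm (.assoc _ _ _)))⟩
  | trans _ _ h h' => exact h.elim fun f => h'.map fun g => f.trans g

theorem Coh.nonempty_of_perm {s t : MonTerm X} (h : s.leaves.Perm t.leaves) :
    Nonempty (Coh s t) :=
  (Coh.nonempty_prod h).map fun f => .trans (toProd s) (.trans f (.symm (toProd t)))

end MonTerm

open MonTerm

/-- The binary term that corresponds to a term over the signature of commutative monoids. -/
def toMon {X : Type} : OpTerm CMonOp X → MonTerm X
  | .var x => .var x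
  | .op .e _ => .unit
  | .op .dot ts => .mul (toMon (ts 0)) (toMon (ts 1))

/-- The term over the signature of commutative monoids that corresponds to a binary term. -/
def ofMon {X : Type} : MonTerm X → OpTerm CMonOp X
  | .var x => .var x
  | .unit => CMonEq.unit
  | .mul s t => CMonEq.mul (ofMon s) (ofMon t)

theorem toMon_ofMon {X : Type} (t : MonTerm X) : toMon (ofMon t) = t := by
  induction t with
  | var x => rfl
  | unit => rfl
  | mul s t hs ht => exact congrArg₂ mul hs ht

theorem ofMon_toMon {X : Type} (t : OpTerm CMonOp X) : ofMon (toMon t) = t := by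
  induction t with
  | var x => rfl
  | op φ ts ih =>
    cases φ with
    | e => exact congrArg (OpTerm.op CMonOp.e) (funext fun i => i.elim0)
    | dot =>
      refine congrArg (OpTerm.op CMonOp.dot) (funext fun i => ?_)
      fin_cases i
      · exact ih 0
      · exact ih 1

theorem toMon_bind {X Y : Type} (t : OpTerm CMonOp X) (s : X → OpTerm CMonOp Y) :
    toMon (t.bind s) = (toMon t).bind fun x => toMon (s x) := by
  induction t with
  | var x => rfl
  | op φ ts ih =>
    cases φ with
    | e => rfl
    | dot => exact congrArg₂ mul (ih 0) (ih 1)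

theorem toMon_rename {X Y : Type} (t : OpTerm CMonOp X) (f : X → Y) :
    toMon (t.rename f) = (toMon t).rename f :=
  toMon_bind t _

theorem eq_bind_of_toMon_eq {X Y : Type} {t : OpTerm CMonOp Y} {p : OpTerm CMonOp X}
    {us : X → MonTerm Y} (h : toMon t = (toMon p).bind us) : t = p.bind fun x => ofMon (us x) := by
  rw [← ofMon_toMon t, h, ← ofMon_toMon (p.bind _), toMon_bind]
  simp only [toMon_ofMon]

theorem count_toMon {X : Type} [DecidableEq X] (t : OpTerm CMonOp X) (x : X) :
    (toMon t).leaves.count x = t.count x := by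
  induction t with
  | var y => simp [toMon, leaves, OpTerm.count, List.count_cons]
  | op φ ts ih =>
    cases φ with
    | e => rfl
    | dot =>
      simp [toMon, leaves, OpTerm.count, ih, Fin.sum_univ_two]

/-- Any two linear terms in the same variables are related by a formal coherence isomorphism. -/
theorem nonempty_coh {n : ℕ} (p q : (freeOperad CMonOp).Op n) :
    Nonempty (Coh (toMon p.1) (toMon q.1)) :=
  Coh.nonempty_of_perm (List.perm_iff_count.2 fun x => by
    rw [count_toMon, count_toMon, p.2, q.2])

/-! ### The operadic congruence generated by the equations -/

/-- The operadic congruence on the free operad that is generated by the equations of commutative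
monoids. -/
inductive CMonEq.Rel : ∀ {n : ℕ}, (freeOperad CMonOp).Op n → (freeOperad CMonOp).Op n → Prop
  | refl {n : ℕ} (p : (freeOperad CMonOp).Op n) : Rel p p
  | symm {n : ℕ} {p q : (freeOperad CMonOp).Op n} : Rel p q → Rel q p
  | trans {n : ℕ} {p q r : (freeOperad CMonOp).Op n} : Rel p q → Rel q r → Rel p r
  | eqn {n : ℕ} (E : CMonEq n) : Rel (lhs E) (rhs E)
  | comp {n m : ℕ} {k : Fin n → ℕ} (h : ∑ i, k i = m) {p p' : (freeOperad CMonOp).Op n}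
      {q q' : ∀ i, (freeOperad CMonOp).Op (k i)} : Rel p p' → (∀ i, Rel (q i) (q' i)) →
      Rel ((freeOperad CMonOp).comp h p q) ((freeOperad CMonOp).comp h p' q')
  | act {n : ℕ} (σ : Equiv.Perm (Fin n)) {p q : (freeOperad CMonOp).Op n} : Rel p q →
      Rel ((freeOperad CMonOp).act σ p) ((freeOperad CMonOp).act σ q)

namespace CMonEq

/-- Substitution instances of congruent operations are congruent. -/
theorem Rel.bind {m n : ℕ} {p p' : (freeOperad CMonOp).Op m} (hp : Rel p p')
    (us : Fin m → OpTerm CMonOp (Fin n)) {q q' : (freeOperad CMonOp).Op n}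
    (hq : q.1 = p.1.bind us) (hq' : q'.1 = p'.1.bind us) : Rel q q' := by
  obtain ⟨k, h, σ, H⟩ := OpTerm.exists_linear_decomposition us fun y => by
    have := q.2 y
    rw [hq, OpTerm.count_bind] at this
    simpa [p.2 _] using this
  obtain ⟨r, hr⟩ := H us fun _ _ => rfl
  obtain rfl := funext hr
  have h1 : q = (freeOperad CMonOp).act σ ((freeOperad CMonOp).comp h p r) :=
    Subtype.ext (hq.trans (freeOperad.act_comp_val h σ p r).symm)
  have h2 : q' = (freeOperad CMonOp).act σ ((freeOperad CMonOp).comp h p' r) :=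
    Subtype.ext (hq'.trans (freeOperad.act_comp_val h σ p' r).symm)
  rw [h1, h2]
  exact .act σ (.comp h hp fun _ => .refl _)

/-- A formal coherence isomorphism between linear terms yields a derivation from the equations. The
subterms of a linear term contain only some of the variables, so the induction is over terms in an
arbitrary set `X` into which the variables of the operations are embedded. -/
theorem rel_of_coh {X : Type} {s t : MonTerm X} (f : Coh s t) :
    ∀ {n : ℕ} (g : Fin n → X), Function.Injective g → ∀ p q : (freeOperad CMonOp).Op n,
      (toMon p.1).rename g = s → (toMon q.1).rename g = t → Rel p q := by
  induction f with
  | refl t =>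
    intro n g hg p q hp hq
    have h1 := rename_injective hg (hp.trans hq.symm)
    have h2 : p = q := Subtype.ext (by rw [← ofMon_toMon p.1, h1, ofMon_toMon])
    rw [h2]
    exact .refl q
  | symm _ ih => exact fun g hg p q hp hq => (ih g hg q p hq hp).symm
  | @trans s t r f f' ih ih' =>
    intro n g hg p q hp hq
    obtain ⟨w, hw⟩ := exists_rename_eq g t fun y hy => by
      rw [← f.leaves_perm.mem_iff, ← hp, leaves_rename] at hy
      obtain ⟨x, -, rfl⟩ := List.mem_map.1 hy
      exact ⟨x, rfl⟩
    have hperm : w.leaves.Perm (toMon p.1).leaves := by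
      have := f.leaves_perm
      rw [← hp, ← hw, leaves_rename, leaves_rename] at this
      exact ((List.map_perm_map_iff hg).1 this).symm
    let r : (freeOperad CMonOp).Op n := ⟨ofMon w, fun x => by
      rw [← count_toMon, toMon_ofMon, hperm.count_eq, count_toMon, p.2]⟩
    have hr : (toMon r.1).rename g = t := by rw [toMon_ofMon, hw]
    exact (ih g hg p r hp hr).trans (ih' g hg r q hr hq)
  | @tensor s s' t t' f f' ih ih' =>
    intro n g hg p q hp hq
    obtain ⟨a, b, hab, ha, hb⟩ := rename_eq_mul hp
    obtain ⟨a', b', hab', ha', hb'⟩ := rename_eq_mul hq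
    have hperm := f.leaves_perm
    have hperm' := f'.leaves_perm
    rw [← ha, ← ha', leaves_rename, leaves_rename, List.map_perm_map_iff hg] at hperm
    rw [← hb, ← hb', leaves_rename, leaves_rename, List.map_perm_map_iff hg] at hperm'
    have hp' : p.1 = .op .dot ![ofMon a, ofMon b] := by rw [← ofMon_toMon p.1, hab]; rfl
    have hq' : q.1 = .op .dot ![ofMon a', ofMon b'] := by rw [← ofMon_toMon q.1, hab']; rfl
    obtain ⟨k, h, σ, H⟩ := OpTerm.exists_linear_decomposition ![ofMon a, ofMon b] fun y => by
      have := p.2 y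
      rwa [hp'] at this
    obtain ⟨r, hr⟩ := H _ fun _ _ => rfl
    obtain ⟨r', hr'⟩ := H ![ofMon a', ofMon b'] fun i y => by
      fin_cases i
      · change (ofMon a').count y = (ofMon a).count y
        rw [← count_toMon, ← count_toMon, toMon_ofMon, toMon_ofMon, hperm.count_eq]
      · change (ofMon b').count y = (ofMon b).count y
        rw [← count_toMon, ← count_toMon, toMon_ofMon, toMon_ofMon, hperm'.count_eq]
    have h1 : p = (freeOperad CMonOp).act σ
        ((freeOperad CMonOp).comp h (freeOperad.gen CMonOp.dot) r) :=
      Subtype.ext ((hp'.trans (congrArg _ (funext hr))).trans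
        (freeOperad.act_comp_val h σ (freeOperad.gen CMonOp.dot) r).symm)
    have h2 : q = (freeOperad CMonOp).act σ
        ((freeOperad CMonOp).comp h (freeOperad.gen CMonOp.dot) r') :=
      Subtype.ext ((hq'.trans (congrArg _ (funext hr'))).trans
        (freeOperad.act_comp_val h σ (freeOperad.gen CMonOp.dot) r').symm)
    have key (i : Fin 2) {c : MonTerm X} {u : OpTerm CMonOp (Fin n)} {z : OpTerm CMonOp (Fin (k i))}
        (hz : u = z.rename fun j => σ (block h i j)) (hc : (toMon u).rename g = c) :
        (toMon z).rename (fun j => g (σ (block h i j))) = c := by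
      rw [← hc, hz, ← toMon_rename, ← toMon_rename, OpTerm.rename_rename]
      rfl
    have hinj (i : Fin 2) : Function.Injective fun j => g (σ (block h i j)) :=
      hg.comp (σ.injective.comp fun j j' hj => by
        simpa using (blockEquiv h).injective hj)
    rw [h1, h2]
    refine .act σ (.comp h (.refl _) fun i => ?_)
    match i with
    | 0 => exact ih _ (hinj 0) _ _ (key 0 (hr 0) (by simpa [toMon_ofMon] using ha))
            (key 0 (hr' 0) (by simpa [toMon_ofMon] using ha'))
    | 1 => exact ih' _ (hinj 1) _ _ (key 1 (hr 1) (by simpa [toMon_ofMon] using hb))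
            (key 1 (hr' 1) (by simpa [toMon_ofMon] using hb'))
  | assoc s t r =>
    intro n g hg p q hp hq
    obtain ⟨a, d, h1, ha, hd⟩ := rename_eq_mul hp
    obtain ⟨b, c, rfl, hb, hc⟩ := rename_eq_mul hd
    obtain ⟨d', c', h1', hd', hc'⟩ := rename_eq_mul hq
    obtain ⟨a', b', rfl, ha', hb'⟩ := rename_eq_mul hd'
    obtain rfl := rename_injective hg (ha.trans ha'.symm)
    obtain rfl := rename_injective hg (hb.trans hb'.symm)
    obtain rfl := rename_injective hg (hc.trans hc'.symm)
    exact (Rel.eqn .assoc).bind (fun i => ofMon (![a, b, c] i)) (eq_bind_of_toMon_eq h1)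
      (eq_bind_of_toMon_eq h1')
  | unitl t =>
    intro n g hg p q hp hq
    obtain ⟨d, a, h1, hd, ha⟩ := rename_eq_mul hp
    obtain rfl := rename_eq_unit hd
    obtain rfl := rename_injective hg (ha.trans hq.symm)
    exact (Rel.eqn .unitl).bind (fun i => ofMon (![toMon q.1] i)) (eq_bind_of_toMon_eq h1)
      (eq_bind_of_toMon_eq rfl)
  | unitr t =>
    intro n g hg p q hp hq
    obtain ⟨a, d, h1, ha, hd⟩ := rename_eq_mul hp
    obtain rfl := rename_eq_unit hd
    obtain rfl := rename_injective hg (ha.trans hq.symm)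
    exact (Rel.eqn .unitr).bind (fun i => ofMon (![toMon q.1] i)) (eq_bind_of_toMon_eq h1)
      (eq_bind_of_toMon_eq rfl)
  | comm s t =>
    intro n g hg p q hp hq
    obtain ⟨a, b, h1, ha, hb⟩ := rename_eq_mul hp
    obtain ⟨b', a', h1', hb', ha'⟩ := rename_eq_mul hq
    obtain rfl := rename_injective hg (ha.trans ha'.symm)
    obtain rfl := rename_injective hg (hb.trans hb'.symm)
    exact (Rel.eqn .comm).bind (fun i => ofMon (![a, b] i)) (eq_bind_of_toMon_eq h1)
      (eq_bind_of_toMon_eq h1')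

/-- The equations of commutative monoids identify all operations of the same arity. -/
theorem rel_all {n : ℕ} (p q : (freeOperad CMonOp).Op n) : Rel p q := by
  obtain ⟨f⟩ := nonempty_coh p q
  refine rel_of_coh f id Function.injective_id p q ?_ ?_
  · rw [← toMon_rename]
    exact congrArg toMon (OpTerm.bind_var _)
  · rw [← toMon_rename]
    exact congrArg toMon (OpTerm.bind_var _)

/-- A map that coequalizes the two sides of the equations identifies congruent operations. -/
theorem app_eq_of_rel {Q : SymmOperad.{0}} (f : freeOperad CMonOp ⟶ Q)
    (hf : freeOperadLift lhs ≫ f = freeOperadLift rhs ≫ f) {n : ℕ}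
    {p q : (freeOperad CMonOp).Op n} (h : Rel p q) :
    SymmOperad.Hom.app f p = SymmOperad.Hom.app f q := by
  induction h with
  | refl p => rfl
  | symm _ ih => exact ih.symm
  | trans _ _ ih ih' => exact ih.trans ih'
  | eqn E =>
    have h := congrArg (fun F : freeOperad CMonEq ⟶ Q => SymmOperad.Hom.app F (freeOperad.gen E)) hf
    have hE (s : ∀ {n : ℕ}, CMonEq n → (freeOperad CMonOp).Op n) :
        SymmOperad.Hom.app (freeOperadLift s) (freeOperad.gen E) = s E :=
      Subtype.ext (OpTerm.bind_var _)
    change SymmOperad.Hom.app f (SymmOperad.Hom.app (freeOperadLift lhs) (freeOperad.gen E)) =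
      SymmOperad.Hom.app f (SymmOperad.Hom.app (freeOperadLift rhs) (freeOperad.gen E)) at h
    rwa [hE, hE] at h
  | comp h _ _ ih ih' =>
    rw [SymmOperad.Hom.app_comp, SymmOperad.Hom.app_comp, ih, funext ih']
  | act σ _ ih => rw [SymmOperad.Hom.app_act, SymmOperad.Hom.app_act, ih]

theorem exists_op (n : ℕ) : Nonempty ((freeOperad CMonOp).Op n) :=
  ⟨⟨ofMon (MonTerm.prod (List.finRange n)), fun x => by
    have h (l : List (Fin n)) : (MonTerm.prod l).leaves = l := by
      induction l with
      | nil => rfl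
      | cons a l ih => exact congrArg (a :: ·) ih
    rw [← count_toMon, toMon_ofMon, h]
    exact List.count_eq_one_of_mem (List.nodup_finRange n) (List.mem_finRange x)⟩⟩

/-- `φ` is the coequalizer of the two maps that name the sides of the equations. -/
noncomputable def isColimit : Limits.IsColimit (Limits.Cofork.ofπ φ condition) :=
  Limits.Cofork.IsColimit.mk' _ fun s => by
    have hs {n : ℕ} (p q : (freeOperad CMonOp).Op n) :
        SymmOperad.Hom.app s.π p = SymmOperad.Hom.app s.π q :=
      app_eq_of_rel s.π s.condition (rel_all p q)
    -- The unique operation of arity `n` goes to the common value of `s` at the `n`-ary operations.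
    refine ⟨{ app := fun {n} _ => SymmOperad.Hom.app s.π (exists_op n).some
              app_one := ?_
              app_comp := fun h p q => ?_
              app_act := fun σ p => ?_ : SymmOperad.Hom terminalOperad _ }, ?_, fun {m} hm => ?_⟩
    · rw [← SymmOperad.Hom.app_one s.π]
      exact hs _ _
    · rw [← SymmOperad.Hom.app_comp s.π]
      exact hs _ _
    · rw [← SymmOperad.Hom.app_act s.π]
      exact hs _ _
    · refine SymmOperad.Hom.ext ?_
      funext n p
      exact hs _ _
    · refine SymmOperad.Hom.ext ?_
      funext n p
      exact congrArg (fun F : freeOperad CMonOp ⟶ s.pt =>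
        SymmOperad.Hom.app F (exists_op n).some) hm

end CMonEq

end WkOperad

namespace WkOperad

open MonoidalCategory MonTerm Functor.LaxMonoidal

/-! ### Interpretation of terms -/

namespace MonTerm

section Functor

variable {C : Type u} [Category.{v} C] {X Y : Type}

/-- The functor `C ^ X ⥤ C` that interprets a term, for a binary functor `B` and a constant `I`. -/
def functor (B : C × C ⥤ C) (I : C) : MonTerm X → ((X → C) ⥤ C)
  | var x => Pi.eval (fun _ => C) x
  | unit => (Functor.const _).obj I
  | mul s t => (functor B I s).prod' (functor B I t) ⋙ B

theorem functor_bind (B : C × C ⥤ C) (I : C) (t : MonTerm X) (s : X → MonTerm Y) :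
    (t.bind s).functor B I = Functor.pi' (fun x => (s x).functor B I) ⋙ t.functor B I := by
  induction t with
  | var x => rfl
  | unit => rfl
  | mul a b ha hb =>
    exact congrArg₂ (fun F G : (Y → C) ⥤ C => F.prod' G ⋙ B) ha hb

end Functor

section Coherence

variable (C : Type u) [Category.{v} C] [MonoidalCategory C] {X Y : Type}

/-- The interpretation of a term by the tensor product of a monoidal category. -/
abbrev ev (t : MonTerm X) : (X → C) ⥤ C :=
  t.functor (tensor C) (𝟙_ C)

variable {C}

theorem ev_mul_map (s t : MonTerm X) {x y : X → C} (f : x ⟶ y) :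
    ((mul s t).ev C).map f = (s.ev C).map f ⊗ₘ (t.ev C).map f :=
  rfl

/-- The number of variables in a term, counted with multiplicities `w`. -/
def weight (w : X → ℕ) : MonTerm X → ℕ
  | var x => w x
  | unit => 0
  | mul s t => s.weight w + t.weight w

theorem Coh.weight_eq (w : X → ℕ) {s t : MonTerm X} (f : Coh s t) : s.weight w = t.weight w := by
  induction f with
  | refl t => rfl
  | symm _ ih => exact ih.symm
  | trans _ _ ih ih' => exact ih.trans ih'
  | tensor _ _ ih ih' => exact congrArg₂ (· + ·) ih ih'
  | assoc s t r => exact (Nat.add_assoc _ _ _).symm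
  | unitl t => exact Nat.zero_add _
  | unitr t => exact Nat.add_zero _
  | comm s t => exact Nat.add_comm _ _

theorem weight_zero (t : MonTerm X) : t.weight (fun _ => 0) = 0 := by
  induction t with
  | var x => rfl
  | unit => rfl
  | mul s t hs ht => exact congrArg₂ (· + ·) hs ht

theorem weight_ite [DecidableEq X] (a : X) (t : MonTerm X) :
    t.weight (fun i => if i = a then 1 else 0) = t.leaves.count a := by
  induction t with
  | var x => simp [weight, leaves, List.count_cons]
  | unit => rfl
  | mul s t hs ht => simp [weight, leaves, hs, ht]

section Contraction

variable {x : X → C} {A : C} {w : X → ℕ}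

/-- A term of weight zero contracts to the unit object if every variable of weight zero does. -/
def contractZero (u : ∀ i, w i = 0 → (x i ≅ 𝟙_ C)) :
    ∀ t : MonTerm X, t.weight w = 0 → ((t.ev C).obj x ≅ 𝟙_ C)
  | var i, h => u i h
  | unit, _ => Iso.refl _
  | mul s t, h => (contractZero u s (Nat.add_eq_zero_iff.1 h).1 ⊗ᵢ
      contractZero u t (Nat.add_eq_zero_iff.1 h).2) ≪≫ λ_ (𝟙_ C)

/-- A term of weight one contracts to `A` if every variable of weight zero contracts to the unit
object and every variable of weight one to `A`. -/
def contractOne (u : ∀ i, w i = 0 → (x i ≅ 𝟙_ C)) (u' : ∀ i, w i = 1 → (x i ≅ A)) :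
    ∀ t : MonTerm X, t.weight w = 1 → ((t.ev C).obj x ≅ A)
  | var i, h => u' i h
  | unit, h => absurd h Nat.zero_ne_one
  | mul s t, h =>
    if hs : s.weight w = 0 then
      (contractZero u s hs ⊗ᵢ contractOne u u' t (by change _ + _ = 1 at h; omega)) ≪≫ λ_ A
    else
      (contractOne u u' s (by change _ + _ = 1 at h; omega) ⊗ᵢ
        contractZero u t (by change _ + _ = 1 at h; omega)) ≪≫ ρ_ A

theorem contractOne_mul_left (u : ∀ i, w i = 0 → (x i ≅ 𝟙_ C)) (u' : ∀ i, w i = 1 → (x i ≅ A))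
    {s t : MonTerm X} (h : (mul s t).weight w = 1) (hs : s.weight w = 0) (ht : t.weight w = 1) :
    contractOne u u' (mul s t) h = (contractZero u s hs ⊗ᵢ contractOne u u' t ht) ≪≫ λ_ A :=
  dif_pos hs

theorem contractOne_mul_right (u : ∀ i, w i = 0 → (x i ≅ 𝟙_ C)) (u' : ∀ i, w i = 1 → (x i ≅ A))
    {s t : MonTerm X} (h : (mul s t).weight w = 1) (hs : s.weight w = 1) (ht : t.weight w = 0) :
    contractOne u u' (mul s t) h = (contractOne u u' s hs ⊗ᵢ contractZero u t ht) ≪≫ ρ_ A :=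
  dif_neg (by omega)

theorem unit_assoc_square {S T R : C} (f : S ⟶ 𝟙_ C) (g : T ⟶ 𝟙_ C) (h : R ⟶ A) :
    (α_ S T R).inv ≫ (((f ⊗ₘ g) ≫ (λ_ (𝟙_ C)).hom) ⊗ₘ h) ≫ (λ_ A).hom =
      (f ⊗ₘ ((g ⊗ₘ h) ≫ (λ_ A).hom)) ≫ (λ_ A).hom := by
  monoidal

theorem unit_assoc_square_middle {S T R : C} (f : S ⟶ 𝟙_ C) (g : T ⟶ A) (h : R ⟶ 𝟙_ C) :
    (α_ S T R).inv ≫ (((f ⊗ₘ g) ≫ (λ_ A).hom) ⊗ₘ h) ≫ (ρ_ A).hom =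
      (f ⊗ₘ ((g ⊗ₘ h) ≫ (ρ_ A).hom)) ≫ (λ_ A).hom := by
  monoidal

theorem unit_assoc_square_left {S T R : C} (f : S ⟶ A) (g : T ⟶ 𝟙_ C) (h : R ⟶ 𝟙_ C) :
    (α_ S T R).inv ≫ (((f ⊗ₘ g) ≫ (ρ_ A).hom) ⊗ₘ h) ≫ (ρ_ A).hom =
      (f ⊗ₘ ((g ⊗ₘ h) ≫ (λ_ (𝟙_ C)).hom)) ≫ (ρ_ A).hom := by
  monoidal

theorem unit_unitl_square {S : C} (f : S ⟶ A) :
    (λ_ S).hom ≫ f = (𝟙 (𝟙_ C) ⊗ₘ f) ≫ (λ_ A).hom := by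
  simp

theorem unit_unitr_square {S : C} (f : S ⟶ A) :
    (ρ_ S).hom ≫ f = (f ⊗ₘ 𝟙 (𝟙_ C)) ≫ (ρ_ A).hom := by
  simp

theorem tensor_square {S T S' T' A B D : C} {f : S ⟶ S'} {g : T ⟶ T'} {a : S ⟶ A} {b : T ⟶ B}
    {a' : S' ⟶ A} {b' : T' ⟶ B} (hf : f ≫ a' = a) (hg : g ≫ b' = b) (r : A ⊗ B ⟶ D) :
    (f ⊗ₘ g) ≫ (a' ⊗ₘ b') ≫ r = (a ⊗ₘ b) ≫ r := by
  rw [tensorHom_comp_tensorHom_assoc, hf, hg]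

end Contraction

variable [SymmetricCategory C]

/-- The isomorphism that is denoted by a formal coherence isomorphism. -/
def Coh.iso (x : X → C) : ∀ {s t : MonTerm X}, Coh s t → ((s.ev C).obj x ≅ (t.ev C).obj x)
  | _, _, refl _ => Iso.refl _
  | _, _, symm f => (f.iso x).symm
  | _, _, trans f g => f.iso x ≪≫ g.iso x
  | _, _, tensor f g => f.iso x ⊗ᵢ g.iso x
  | _, _, assoc s t r => (α_ ((s.ev C).obj x) ((t.ev C).obj x) ((r.ev C).obj x)).symm
  | _, _, unitl t => λ_ ((t.ev C).obj x)
  | _, _, unitr t => ρ_ ((t.ev C).obj x)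
  | _, _, comm s t => β_ ((s.ev C).obj x) ((t.ev C).obj x)

theorem Coh.iso_naturality {s t : MonTerm X} (f : Coh s t) {x y : X → C} (g : x ⟶ y) :
    (s.ev C).map g ≫ (f.iso y).hom = (f.iso x).hom ≫ (t.ev C).map g := by
  induction f with
  | refl t => exact (Category.comp_id _).trans (Category.id_comp _).symm
  | symm f ih => exact ((Iso.inv_comp_eq _).2 (by rw [← Category.assoc, ← ih]; simp [iso])).symm
  | trans f f' ih ih' => simp only [iso, Iso.trans_hom, reassoc_of% ih, ih', Category.assoc]
  | tensor f f' ih ih' =>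
    simp only [iso, ev_mul_map, tensorIso_hom]
    refine (tensorHom_comp_tensorHom _ _ _ _).trans (Eq.trans ?_
      (tensorHom_comp_tensorHom _ _ _ _).symm)
    rw [ih, ih']
  | assoc s t r => exact associator_inv_naturality _ _ _
  | unitl t => exact (congrArg (· ≫ _) (id_tensorHom _ _)).trans (leftUnitor_naturality _)
  | unitr t => exact (congrArg (· ≫ _) (tensorHom_id _ _)).trans (rightUnitor_naturality _)
  | comm s t => exact BraidedCategory.braiding_naturality _ _

section Squares

variable {A B D A₁ A₂ B₁ B₂ D₁ D₂ : C}

theorem tensorμ_tensor_square {A' B' A₁' A₂' B₁' B₂' : C} {f : A ⟶ A'} {g : B ⟶ B'}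
    {a : A ⟶ A₁ ⊗ A₂} {b : B ⟶ B₁ ⊗ B₂} {a' : A' ⟶ A₁' ⊗ A₂'} {b' : B' ⟶ B₁' ⊗ B₂'}
    {f₁ : A₁ ⟶ A₁'} {f₂ : A₂ ⟶ A₂'} {g₁ : B₁ ⟶ B₁'} {g₂ : B₂ ⟶ B₂'}
    (hf : f ≫ a' = a ≫ (f₁ ⊗ₘ f₂)) (hg : g ≫ b' = b ≫ (g₁ ⊗ₘ g₂)) :
    (f ⊗ₘ g) ≫ (a' ⊗ₘ b') ≫ tensorμ _ _ _ _ =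
      ((a ⊗ₘ b) ≫ tensorμ _ _ _ _) ≫ ((f₁ ⊗ₘ g₁) ⊗ₘ (f₂ ⊗ₘ g₂)) := by
  rw [tensorHom_comp_tensorHom_assoc, hf, hg, ← tensorHom_comp_tensorHom_assoc, tensorμ_natural,
    Category.assoc]

theorem tensorμ_assoc_square (a : A ⟶ A₁ ⊗ A₂) (b : B ⟶ B₁ ⊗ B₂) (d : D ⟶ D₁ ⊗ D₂) :
    (α_ A B D).inv ≫ ((((a ⊗ₘ b) ≫ tensorμ _ _ _ _) ⊗ₘ d) ≫ tensorμ _ _ _ _) =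
      ((a ⊗ₘ ((b ⊗ₘ d) ≫ tensorμ _ _ _ _)) ≫ tensorμ _ _ _ _) ≫
        ((α_ A₁ B₁ D₁).inv ⊗ₘ (α_ A₂ B₂ D₂).inv) := by
  rw [Iso.inv_comp_eq, ← cancel_mono ((α_ A₁ B₁ D₁).hom ⊗ₘ (α_ A₂ B₂ D₂).hom)]
  simp only [Category.assoc, tensorHom_comp_tensorHom, Iso.inv_hom_id, id_tensorHom_id,
    Category.comp_id]
  have h1 : ((a ⊗ₘ b) ≫ tensorμ A₁ A₂ B₁ B₂) ⊗ₘ d =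
      ((a ⊗ₘ b) ⊗ₘ d) ≫ (tensorμ A₁ A₂ B₁ B₂ ▷ (D₁ ⊗ D₂)) := by
    rw [← tensorHom_id, tensorHom_comp_tensorHom, Category.comp_id]
  have h2 : a ⊗ₘ ((b ⊗ₘ d) ≫ tensorμ B₁ B₂ D₁ D₂) =
      (a ⊗ₘ (b ⊗ₘ d)) ≫ ((A₁ ⊗ A₂) ◁ tensorμ B₁ B₂ D₁ D₂) := by
    rw [← id_tensorHom, tensorHom_comp_tensorHom, Category.comp_id]
  rw [h1, h2, Category.assoc, tensor_associativity, Category.assoc, associator_naturality_assoc]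

theorem tensorμ_unitl_square (a : A ⟶ A₁ ⊗ A₂) :
    (λ_ A).hom ≫ a =
      (((λ_ (𝟙_ C)).inv ⊗ₘ a) ≫ tensorμ _ _ _ _) ≫ ((λ_ A₁).hom ⊗ₘ (λ_ A₂).hom) := by
  rw [← leftUnitor_naturality, tensor_left_unitality, ← id_tensorHom, ← tensorHom_id,
    tensorHom_comp_tensorHom_assoc, Category.id_comp, Category.comp_id, Category.assoc]

theorem tensorμ_unitr_square (a : A ⟶ A₁ ⊗ A₂) :
    (ρ_ A).hom ≫ a =
      ((a ⊗ₘ (λ_ (𝟙_ C)).inv) ≫ tensorμ _ _ _ _) ≫ ((ρ_ A₁).hom ⊗ₘ (ρ_ A₂).hom) := by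
  rw [← rightUnitor_naturality, tensor_right_unitality, ← id_tensorHom, ← tensorHom_id,
    tensorHom_comp_tensorHom_assoc, Category.id_comp, Category.comp_id, Category.assoc]

theorem tensorμ_comp_braiding (A₁ A₂ B₁ B₂ : C) :
    (β_ (A₁ ⊗ A₂) (B₁ ⊗ B₂)).hom ≫ tensorμ B₁ B₂ A₁ A₂ =
      tensorμ A₁ A₂ B₁ B₂ ≫ ((β_ A₁ B₁).hom ⊗ₘ (β_ A₂ B₂).hom) := by
  simp [tensorμ, SymmetricCategory.braiding_swap_eq_inv_braiding B₁ A₂,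
    SymmetricCategory.braiding_swap_eq_inv_braiding B₂ A₁, MonoidalCategory.tensorHom_def]

theorem tensorμ_comm_square (a : A ⟶ A₁ ⊗ A₂) (b : B ⟶ B₁ ⊗ B₂) :
    (β_ A B).hom ≫ (b ⊗ₘ a) ≫ tensorμ _ _ _ _ =
      ((a ⊗ₘ b) ≫ tensorμ _ _ _ _) ≫ ((β_ A₁ B₁).hom ⊗ₘ (β_ A₂ B₂).hom) := by
  rw [← BraidedCategory.braiding_naturality_assoc, tensorμ_comp_braiding, Category.assoc]

end Squares

/-- The isomorphism `t(x) ≅ t(y) ⊗ t(z)` that is induced by isomorphisms `x i ≅ y i ⊗ z i`: the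
tensor product `C × C ⥤ C` is a monoidal functor, with structure isomorphisms `tensorμ`. -/
def split {x y z : X → C} (v : ∀ i, x i ≅ y i ⊗ z i) :
    ∀ t : MonTerm X, (t.ev C).obj x ≅ (t.ev C).obj y ⊗ (t.ev C).obj z
  | var i => v i
  | unit => (λ_ (𝟙_ C)).symm
  | mul s t => (split v s ⊗ᵢ split v t) ≪≫
      { hom := tensorμ ((s.ev C).obj y) ((s.ev C).obj z) ((t.ev C).obj y) ((t.ev C).obj z)
        inv := tensorδ ((s.ev C).obj y) ((s.ev C).obj z) ((t.ev C).obj y) ((t.ev C).obj z)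
        hom_inv_id := tensorμ_tensorδ _ _ _ _
        inv_hom_id := tensorδ_tensorμ _ _ _ _ }

/-- Splitting of the variables is compatible with coherence isomorphisms, because the tensor product
is a symmetric monoidal functor. -/
theorem Coh.iso_split {x y z : X → C} (v : ∀ i, x i ≅ y i ⊗ z i) {s t : MonTerm X}
    (f : Coh s t) :
    (f.iso x).hom ≫ (split v t).hom =
      (split v s).hom ≫ ((f.iso y).hom ⊗ₘ (f.iso z).hom) := by
  induction f with
  | refl t =>
    refine (Category.id_comp _).trans (Eq.trans (Category.comp_id _).symm ?_)
    exact congrArg (_ ≫ ·) (id_tensorHom_id _ _).symm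
  | symm f ih =>
    refine (Iso.inv_comp_eq _).2 ?_
    rw [← Category.assoc, ih, Category.assoc]
    simp [iso]
  | trans f f' ih ih' =>
    simp only [iso, Iso.trans_hom, Category.assoc, ih', reassoc_of% ih, tensorHom_comp_tensorHom]
  | @tensor s s' t t' f f' ih ih' =>
    exact tensorμ_tensor_square ih ih'
  | assoc s t r => exact tensorμ_assoc_square (split v s).hom (split v t).hom (split v r).hom
  | unitl t => exact tensorμ_unitl_square (split v t).hom
  | unitr t => exact tensorμ_unitr_square (split v t).hom
  | comm s t => exact tensorμ_comm_square (split v s).hom (split v t).hom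

section Contraction

variable {x : X → C} {A : C} {w : X → ℕ}

theorem unit_comm_square {S T : C} (f : S ⟶ 𝟙_ C) (g : T ⟶ A) :
    (β_ S T).hom ≫ (g ⊗ₘ f) ≫ (ρ_ A).hom = (f ⊗ₘ g) ≫ (λ_ A).hom := by
  rw [← BraidedCategory.braiding_naturality_assoc, braiding_rightUnitor]

theorem unit_comm_square_right {S T : C} (f : S ⟶ A) (g : T ⟶ 𝟙_ C) :
    (β_ S T).hom ≫ (g ⊗ₘ f) ≫ (λ_ A).hom = (f ⊗ₘ g) ≫ (ρ_ A).hom := by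
  rw [← BraidedCategory.braiding_naturality_assoc, braiding_leftUnitor]

/-- Contraction to the unit object absorbs coherence isomorphisms. -/
theorem Coh.iso_contractZero (u : ∀ i, w i = 0 → (x i ≅ 𝟙_ C)) {s t : MonTerm X} (f : Coh s t) :
    ∀ (hs : s.weight w = 0) (ht : t.weight w = 0),
      (f.iso x).hom ≫ (contractZero u t ht).hom = (contractZero u s hs).hom := by
  induction f with
  | refl t => exact fun _ _ => Category.id_comp _
  | symm f ih => exact fun hs ht => (Iso.inv_comp_eq _).2 (ih ht hs).symm
  | trans f f' ih ih' =>
    intro hs ht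
    have hr := (f.weight_eq w).symm.trans hs
    exact (Category.assoc _ _ _).trans ((congrArg (_ ≫ ·) (ih' hr ht)).trans (ih hs hr))
  | tensor f f' ih ih' =>
    intro hs ht
    exact tensor_square (ih (Nat.add_eq_zero_iff.1 hs).1 (Nat.add_eq_zero_iff.1 ht).1)
      (ih' (Nat.add_eq_zero_iff.1 hs).2 (Nat.add_eq_zero_iff.1 ht).2) _
  | assoc s t r => exact fun _ _ => unit_assoc_square _ _ _
  | unitl t => exact fun _ _ => unit_unitl_square _
  | unitr t =>
    exact fun _ _ => (unit_unitr_square _).trans (congrArg (_ ≫ ·) unitors_equal.symm)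
  | comm s t =>
    exact fun _ _ => (congrArg (fun e => _ ≫ _ ≫ e) unitors_equal).trans (unit_comm_square _ _)

/-- Contraction to the object at the only variable of weight one absorbs coherence isomorphisms. -/
theorem Coh.iso_contractOne (u : ∀ i, w i = 0 → (x i ≅ 𝟙_ C)) (u' : ∀ i, w i = 1 → (x i ≅ A))
    {s t : MonTerm X} (f : Coh s t) : ∀ (hs : s.weight w = 1) (ht : t.weight w = 1),
      (f.iso x).hom ≫ (contractOne u u' t ht).hom = (contractOne u u' s hs).hom := by
  induction f with
  | refl t => exact fun _ _ => Category.id_comp _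
  | symm f ih => exact fun hs ht => (Iso.inv_comp_eq _).2 (ih ht hs).symm
  | trans f f' ih ih' =>
    intro hs ht
    have hr := (f.weight_eq w).symm.trans hs
    exact (Category.assoc _ _ _).trans ((congrArg (_ ≫ ·) (ih' hr ht)).trans (ih hs hr))
  | @tensor s s' t t' f f' ih ih' =>
    intro hs ht
    have h1 := f.weight_eq w
    have h2 := f'.weight_eq w
    have h3 : s.weight w + t.weight w = 1 := hs
    obtain h | h : s.weight w = 0 ∨ s.weight w = 1 := by omega
    · have h' : t.weight w = 1 := by omega
      rw [contractOne_mul_left u u' hs h h',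
        contractOne_mul_left u u' ht (h1.symm.trans h) (h2.symm.trans h')]
      exact tensor_square (f.iso_contractZero u _ _) (ih' _ _) _
    · have h' : t.weight w = 0 := by omega
      rw [contractOne_mul_right u u' hs h h',
        contractOne_mul_right u u' ht (h1.symm.trans h) (h2.symm.trans h')]
      exact tensor_square (ih _ _) (f'.iso_contractZero u _ _) _
  | assoc s t r =>
    intro hs ht
    have h3 : s.weight w + (t.weight w + r.weight w) = 1 := hs
    obtain h | h : s.weight w = 0 ∨ s.weight w = 1 := by omega
    · obtain h' | h' : t.weight w = 0 ∨ t.weight w = 1 := by omega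
      · have h'' : r.weight w = 1 := by omega
        have hst : (mul s t).weight w = 0 := Nat.add_eq_zero_iff.2 ⟨h, h'⟩
        have htr : (mul t r).weight w = 1 := by change _ + _ = 1; omega
        rw [contractOne_mul_left u u' hs h htr, contractOne_mul_left u u' ht hst h'',
          contractOne_mul_left u u' htr h' h'']
        exact unit_assoc_square _ _ _
      · have h'' : r.weight w = 0 := by omega
        have hst : (mul s t).weight w = 1 := by change _ + _ = 1; omega
        have htr : (mul t r).weight w = 1 := by change _ + _ = 1; omega
        rw [contractOne_mul_left u u' hs h htr, contractOne_mul_right u u' ht hst h'',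
          contractOne_mul_right u u' htr h' h'', contractOne_mul_left u u' hst h h']
        exact unit_assoc_square_middle _ _ _
    · have h' : t.weight w = 0 := by omega
      have h'' : r.weight w = 0 := by omega
      have hst : (mul s t).weight w = 1 := by change _ + _ = 1; omega
      have htr : (mul t r).weight w = 0 := Nat.add_eq_zero_iff.2 ⟨h', h''⟩
      rw [contractOne_mul_right u u' hs h htr, contractOne_mul_right u u' ht hst h'',
        contractOne_mul_right u u' hst h h']
      exact unit_assoc_square_left _ _ _
  | unitl t =>
    intro hs ht
    rw [contractOne_mul_left u u' hs rfl ht]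
    exact unit_unitl_square _
  | unitr t =>
    intro hs ht
    rw [contractOne_mul_right u u' hs ht rfl]
    exact unit_unitr_square _
  | comm s t =>
    intro hs ht
    have h3 : s.weight w + t.weight w = 1 := hs
    obtain h | h : s.weight w = 0 ∨ s.weight w = 1 := by omega
    · have h' : t.weight w = 1 := by omega
      rw [contractOne_mul_left u u' hs h h', contractOne_mul_right u u' ht h' h]
      exact unit_comm_square _ _
    · have h' : t.weight w = 0 := by omega
      rw [contractOne_mul_right u u' hs h h', contractOne_mul_left u u' ht h' h]
      exact unit_comm_square_right _ _

end Contraction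

/-- Coherence for symmetric monoidal categories: between terms in which no variable is repeated
all coherence isomorphisms are equal. The variables that are not yet known to be isomorphic to the
unit object are split off one by one; a term in which at most one variable is not isomorphic to the
unit object contracts to that variable or to the unit object. -/
theorem Coh.iso_hom_eq [Finite X] {s t : MonTerm X} (hs : s.leaves.Nodup) (f g : Coh s t)
    (x : X → C) : (f.iso x).hom = (g.iso x).hom := by
  classical
  cases nonempty_fintype X
  suffices key : ∀ (S : Finset X) (x : X → C), (∀ i ∉ S, Nonempty (x i ≅ 𝟙_ C)) →
      (f.iso x).hom = (g.iso x).hom from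
    key Finset.univ x fun i hi => absurd (Finset.mem_univ i) hi
  intro S
  induction S using Finset.induction_on with
  | empty =>
    intro x hx
    let u (i : X) (_ : (fun _ : X => 0) i = 0) : x i ≅ 𝟙_ C := (hx i (Finset.notMem_empty i)).some
    rw [← cancel_mono (contractZero u t (weight_zero t)).hom,
      f.iso_contractZero u (weight_zero s), g.iso_contractZero u (weight_zero s)]
  | insert a S ha ih =>
    intro x hx
    -- `y` has only the variable `a`, and `z` all others.
    let y (i : X) : C := if i = a then x a else 𝟙_ C
    let z (i : X) : C := if i = a then 𝟙_ C else x i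
    have v : Nonempty (∀ i, x i ≅ y i ⊗ z i) := ⟨fun i =>
      if h : i = a then
        eqToIso (by rw [h]) ≪≫ (ρ_ (x a)).symm ≪≫
          (eqToIso (by simp [y, h]) ⊗ᵢ eqToIso (by simp [z, h]))
      else
        (λ_ (x i)).symm ≪≫ (eqToIso (by simp [y, h]) ⊗ᵢ eqToIso (by simp [z, h]))⟩
    obtain ⟨v⟩ := v
    have hz : (f.iso z).hom = (g.iso z).hom := ih z fun i hi => by
      by_cases h : i = a
      · exact ⟨eqToIso (by simp [z, h])⟩
      · exact (hx i (by simp [h, hi])).map fun e => eqToIso (by simp [z, h]) ≪≫ e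
    have hy : (f.iso y).hom = (g.iso y).hom := by
      let w (i : X) : ℕ := if i = a then 1 else 0
      let u (i : X) (h : w i = 0) : y i ≅ 𝟙_ C := eqToIso (if_neg fun h' => by simp [w, h'] at h)
      let u' (i : X) (h : w i = 1) : y i ≅ x a :=
        eqToIso (if_pos (by by_contra h'; simp [w, h'] at h))
      have h1 : s.weight w ≤ 1 := (weight_ite a s).trans_le (List.nodup_iff_count_le_one.1 hs a)
      obtain h | h : s.weight w = 0 ∨ s.weight w = 1 := by omega
      · have h' := (f.weight_eq w).symm.trans h
        rw [← cancel_mono (contractZero u t h').hom, f.iso_contractZero u h,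
          g.iso_contractZero u h]
      · have h' := (f.weight_eq w).symm.trans h
        rw [← cancel_mono (contractOne u u' t h').hom, f.iso_contractOne u u' h,
          g.iso_contractOne u u' h]
    rw [← cancel_mono (split v t).hom, f.iso_split v, g.iso_split v, hy, hz]

end Coherence

end MonTerm

/-! ### Heterogeneous equality of morphisms -/

theorem natTrans_heq {J : Type w} [Category.{w'} J] {C : Type u} [Category.{v} C]
    {F G F' G' : J ⥤ C} (hF : F = F') (hG : G = G') {α : F ⟶ G} {β : F' ⟶ G'}
    (h : ∀ x, HEq (α.app x) (β.app x)) : HEq α β := by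
  subst hF hG
  exact heq_of_eq (NatTrans.ext (funext fun x => eq_of_heq (h x)))

theorem heq_map_pi {C D : Type u} [Category.{v} C] [Category.{v} D] {X : Type} (F : (X → C) ⥤ D)
    {x y x' y' : X → C} {f : x ⟶ y} {f' : x' ⟶ y'} (hx : ∀ i, x i = x' i) (hy : ∀ i, y i = y' i)
    (hf : ∀ i, HEq (f i) (f' i)) : HEq (F.map f) (F.map f') := by
  obtain rfl := funext hx
  obtain rfl := funext hy
  obtain rfl : f = f' := funext fun i => eq_of_heq (hf i)
  rfl

theorem heq_inv {C : Type u} [Category.{v} C] {a b a' b' : C} {f : a ≅ b} {f' : a' ≅ b'}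
    (ha : a = a') (hb : b = b') (h : HEq f.hom f'.hom) : HEq f.inv f'.inv := by
  subst ha hb
  obtain rfl := Iso.ext (eq_of_heq h)
  rfl

theorem heq_map_prod {C D : Type u} [Category.{v} C] [Category.{v} D] (B : C × C ⥤ D)
    {a b c d a' b' c' d' : C} {f : a ⟶ b} {g : c ⟶ d} {f' : a' ⟶ b'} {g' : c' ⟶ d'}
    (ha : a = a') (hb : b = b') (hc : c = c') (hd : d = d') (hf : HEq f f') (hg : HEq g g') :
    HEq (B.map (X := (a, c)) (Y := (b, d)) (f, g))
      (B.map (X := (a', c')) (Y := (b', d')) (f', g')) := by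
  subst ha hb hc hd
  rw [eq_of_heq hf, eq_of_heq hg]

/-! ### Substitution into formal coherence isomorphisms -/

namespace MonTerm

section Substitution

variable {C : Type u} [Category.{v} C] {X Y : Type}

theorem functor_rename (B : C × C ⥤ C) (I : C) (t : MonTerm X) (f : X → Y) :
    (t.rename f).functor B I = Functor.pi' (fun x => Pi.eval (fun _ => C) (f x)) ⋙
      t.functor B I :=
  functor_bind B I t _

theorem functor_bind_obj (B : C × C ⥤ C) (I : C) (t : MonTerm X) (s : X → MonTerm Y) (x : Y → C) :
    ((t.bind s).functor B I).obj x =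
      (t.functor B I).obj fun i => ((s i).functor B I).obj x :=
  congrArg (fun F : (Y → C) ⥤ C => F.obj x) (functor_bind B I t s)

/-- Substitution of terms into a formal coherence isomorphism. -/
def Coh.bind (us : X → MonTerm Y) : ∀ {s t : MonTerm X}, Coh s t → Coh (s.bind us) (t.bind us)
  | _, _, refl _ => refl _
  | _, _, symm f => symm (f.bind us)
  | _, _, trans f g => trans (f.bind us) (g.bind us)
  | _, _, tensor f g => tensor (f.bind us) (g.bind us)
  | _, _, assoc _ _ _ => assoc _ _ _
  | _, _, unitl _ => unitl _
  | _, _, unitr _ => unitr _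
  | _, _, comm _ _ => comm _ _

/-- Substitution of formal coherence isomorphisms into a term. -/
def Coh.bindMap {us us' : X → MonTerm Y} (g : ∀ i, Coh (us i) (us' i)) :
    ∀ t : MonTerm X, Coh (t.bind us) (t.bind us')
  | var i => g i
  | unit => refl _
  | mul s t => tensor (bindMap g s) (bindMap g t)

variable [MonoidalCategory C] [SymmetricCategory C]

theorem Coh.iso_bind (us : X → MonTerm Y) {s t : MonTerm X} (f : Coh s t) (x : Y → C) :
    HEq ((f.bind us).iso x).hom (f.iso fun i => ((us i).ev C).obj x).hom := by
  have hob (t : MonTerm X) := functor_bind_obj (MonoidalCategory.tensor C) (𝟙_ C) t us x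
  induction f with
  | refl t => exact heq_id (hob t)
  | symm f ih => exact heq_inv (hob _) (hob _) ih
  | trans f f' ih ih' => exact heq_comp (hob _) (hob _) (hob _) ih ih'
  | tensor f f' ih ih' =>
    exact heq_map_prod (MonoidalCategory.tensor C) (hob _) (hob _) (hob _) (hob _) ih ih'
  | assoc s t r =>
    have key {a b c a' b' c' : C} (ha : a = a') (hb : b = b') (hc : c = c') :
        HEq (α_ a b c).inv (α_ a' b' c').inv := by
      rw [ha, hb, hc]
    exact key (hob _) (hob _) (hob _)
  | unitl t =>
    have key {a a' : C} (ha : a = a') : HEq (λ_ a).hom (λ_ a').hom := by rw [ha]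
    exact key (hob _)
  | unitr t =>
    have key {a a' : C} (ha : a = a') : HEq (ρ_ a).hom (ρ_ a').hom := by rw [ha]
    exact key (hob _)
  | comm s t =>
    have key {a b a' b' : C} (ha : a = a') (hb : b = b') : HEq (β_ a b).hom (β_ a' b').hom := by
      rw [ha, hb]
    exact key (hob _) (hob _)

theorem Coh.iso_bindMap {us us' : X → MonTerm Y} (g : ∀ i, Coh (us i) (us' i)) (t : MonTerm X)
    (x : Y → C) : HEq ((bindMap g t).iso x).hom ((t.ev C).map
      (X := fun i => ((us i).ev C).obj x) (Y := fun i => ((us' i).ev C).obj x)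
      fun i => ((g i).iso x).hom) := by
  have hob (us : X → MonTerm Y) (t : MonTerm X) :=
    functor_bind_obj (MonoidalCategory.tensor C) (𝟙_ C) t us x
  induction t with
  | var i => rfl
  | unit => rfl
  | mul s t ih ih' =>
    exact heq_map_prod (MonoidalCategory.tensor C) (hob _ _) (hob _ _) (hob _ _) (hob _ _) ih ih'

/-- Coherence, for terms that are equal only propositionally. -/
theorem Coh.iso_heq [Finite X] {s t s' t' : MonTerm X} (hs : s = s') (ht : t = t')
    (h : s.leaves.Nodup) (f : Coh s t) (f' : Coh s' t') (x : X → C) :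
    HEq (f.iso x).hom (f'.iso x).hom := by
  subst hs ht
  exact heq_of_eq (f.iso_hom_eq h f' x)

end Substitution

end MonTerm

/-! ### The algebra of a symmetric monoidal category -/

theorem nodup_leaves {n : ℕ} (p : (freeOperad CMonOp).Op n) : (toMon p.1).leaves.Nodup :=
  List.nodup_iff_count_le_one.2 fun x => ((count_toMon p.1 x).trans (p.2 x)).le

/-- A formal coherence isomorphism between two operations of the same arity. -/
noncomputable def someCoh {n : ℕ} (p q : (freeOperad CMonOp).Op n) :
    Coh (toMon p.1) (toMon q.1) :=
  (nonempty_coh p q).some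

theorem toMon_comp {n m : ℕ} {k : Fin n → ℕ} (h : ∑ i, k i = m) (p : (freeOperad CMonOp).Op n)
    (q : ∀ i, (freeOperad CMonOp).Op (k i)) :
    toMon ((freeOperad CMonOp).comp h p q).1 =
      (toMon p.1).bind fun i => (toMon (q i).1).rename (block h i) := by
  simp only [← toMon_rename]
  exact toMon_bind _ _

theorem toMon_act {n : ℕ} (σ : Equiv.Perm (Fin n)) (p : (freeOperad CMonOp).Op n) :
    toMon ((freeOperad CMonOp).act σ p).1 = (toMon p.1).rename σ :=
  toMon_rename _ _

section

variable {C : Type u} [Category.{v} C]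

theorem functor_comp (B : C × C ⥤ C) (I : C) {n m : ℕ} {k : Fin n → ℕ} (h : ∑ i, k i = m)
    (p : (freeOperad CMonOp).Op n) (q : ∀ i, (freeOperad CMonOp).Op (k i)) :
    (toMon ((freeOperad CMonOp).comp h p q).1).functor B I =
      endComp (block h) ((toMon p.1).functor B I) fun i => (toMon (q i).1).functor B I := by
  rw [toMon_comp, functor_bind]
  simp only [functor_rename]
  rfl

theorem functor_act (B : C × C ⥤ C) (I : C) {n : ℕ} (σ : Equiv.Perm (Fin n))
    (p : (freeOperad CMonOp).Op n) :
    (toMon ((freeOperad CMonOp).act σ p).1).functor B I =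
      endAct σ ((toMon p.1).functor B I) := by
  rw [toMon_act, functor_rename]
  rfl

variable [MonoidalCategory C] [SymmetricCategory C]

theorem someCoh_comp {n m : ℕ} {k : Fin n → ℕ} (h : ∑ i, k i = m)
    (p p' : (freeOperad CMonOp).Op n) (q q' : ∀ i, (freeOperad CMonOp).Op (k i)) (x : Fin m → C) :
    HEq ((someCoh ((freeOperad CMonOp).comp h p q) ((freeOperad CMonOp).comp h p' q')).iso x).hom
      (((toMon p.1).ev C).map
        (X := fun i => ((toMon (q i).1).ev C).obj fun j => x (block h i j))
        (Y := fun i => ((toMon (q' i).1).ev C).obj fun j => x (block h i j))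
        (fun i => ((someCoh (q i) (q' i)).iso fun j => x (block h i j)).hom) ≫
      ((someCoh p p').iso fun i => ((toMon (q' i).1).ev C).obj fun j => x (block h i j)).hom) := by
  let us (q : ∀ i, (freeOperad CMonOp).Op (k i)) (i : Fin n) : MonTerm (Fin m) :=
    (toMon (q i).1).rename (block h i)
  let g (i : Fin n) : Coh (us q i) (us q' i) := (someCoh (q i) (q' i)).bind _
  have hus (q : ∀ i, (freeOperad CMonOp).Op (k i)) (i : Fin n) :
      ((us q i).ev C).obj x = ((toMon (q i).1).ev C).obj fun j => x (block h i j) :=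
    functor_bind_obj _ _ _ _ x
  have hob (p : (freeOperad CMonOp).Op n) (q : ∀ i, (freeOperad CMonOp).Op (k i)) :
      (((toMon p.1).bind (us q)).ev C).obj x = ((toMon p.1).ev C).obj fun i =>
        ((toMon (q i).1).ev C).obj fun j => x (block h i j) :=
    (functor_bind_obj _ _ _ _ x).trans (congrArg _ (funext fun i => hus q i))
  -- By coherence the chosen isomorphism may be replaced by one that is built by substitution.
  refine (Coh.iso_heq (toMon_comp h p q) (toMon_comp h p' q') (nodup_leaves _) _
    (.trans (Coh.bindMap g (toMon p.1)) ((someCoh p p').bind (us q'))) x).trans ?_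
  refine heq_comp (hob _ _) (hob _ _) (hob _ _) ?_ ?_
  · refine (Coh.iso_bindMap g _ x).trans ?_
    exact heq_map_pi _ (hus q) (hus q') fun i => Coh.iso_bind _ _ x
  · refine (Coh.iso_bind _ _ x).trans ?_
    rw [show (fun i => ((us q' i).ev C).obj x) = _ from funext (hus q')]

theorem someCoh_act {n : ℕ} (σ : Equiv.Perm (Fin n)) (p p' : (freeOperad CMonOp).Op n)
    (x : Fin n → C) :
    HEq ((someCoh ((freeOperad CMonOp).act σ p) ((freeOperad CMonOp).act σ p')).iso x).hom
      ((someCoh p p').iso fun i => x (σ i)).hom :=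
  (Coh.iso_heq (toMon_act σ p) (toMon_act σ p') (nodup_leaves _) _ ((someCoh p p').bind _) x).trans
    (Coh.iso_bind _ _ x)

variable (C)

/-- The algebra that is given by a symmetric monoidal category: an operation is interpreted by the
corresponding iterated tensor product, and a 2-cell by the coherence isomorphism. -/
noncomputable def smcAlgebra : Algebra (weakening CMonEq.φ) C where
  app p := (toMon p.1).ev C
  app_one := rfl
  app_comp h p q := functor_comp _ _ h p q
  app_act σ p := functor_act _ _ σ p
  map {_ p q} _ :=
    { app := fun x => ((someCoh p q).iso x).hom
      naturality := fun _ _ f => (someCoh p q).iso_naturality f }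
  map_id p := by
    refine NatTrans.ext (funext fun x => ?_)
    exact (someCoh p p).iso_hom_eq (nodup_leaves p) (.refl _) x
  map_comp {_ p q r} _ _ := by
    refine NatTrans.ext (funext fun x => ?_)
    exact (someCoh p r).iso_hom_eq (nodup_leaves p) (.trans (someCoh p q) (someCoh q r)) x
  map_compMap h p p' q q' _ _ :=
    natTrans_heq (functor_comp _ _ h p q) (functor_comp _ _ h p' q')
      fun x => someCoh_comp h p p' q q' x
  map_actMap σ p p' _ :=
    natTrans_heq (functor_act _ _ σ p) (functor_act _ _ σ p') fun x => someCoh_act σ p p' x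

theorem smcAlgebra_trans_app {n : ℕ} {p q : (freeOperad CMonOp).Op n}
    (δ : ((weakening CMonEq.φ).cat n).Hom p q) (f : Coh (toMon p.1) (toMon q.1)) (x : Fin n → C) :
    (Algebra.trans (smcAlgebra C) δ).app x = (f.iso x).hom :=
  (someCoh p q).iso_hom_eq (nodup_leaves p) f x

theorem smcAlgebra_matches : Matches C (smcAlgebra C) where
  dot_obj _ _ := rfl
  dot_map _ := HEq.rfl
  e_obj := rfl
  assoc _ _ _ := heq_of_eq
    (smcAlgebra_trans_app C (CMonEq.cell .assoc) (.assoc (var 0) (var 1) (var 2)) _)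
  unitl _ := heq_of_eq (smcAlgebra_trans_app C (CMonEq.cell .unitl) (.unitl (var 0)) _)
  unitr _ := heq_of_eq (smcAlgebra_trans_app C (CMonEq.cell .unitr) (.unitr (var 0)) _)
  comm _ _ := heq_of_eq (smcAlgebra_trans_app C (CMonEq.cell .comm) (.comm (var 0) (var 1)) _)

end

/-! ### Comparison isomorphisms of a functor -/

section Comparison

variable {C D : Type u} [Category.{v} C] [Category.{v} D] {X Y : Type} {B : C × C ⥤ C} {I : C}
  {B' : D × D ⥤ D} {I' : D} (F : C ⥤ D) (e : I' ≅ F.obj I)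
  (m : ∀ a b, B'.obj (F.obj a, F.obj b) ≅ F.obj (B.obj (a, b)))

/-- The extension to all terms of isomorphisms that compare the images under `F` of a binary
operation and of a constant with another binary operation and another constant. -/
def comparison (x : X → C) : ∀ t : MonTerm X,
    (t.functor B' I').obj (fun i => F.obj (x i)) ≅ F.obj ((t.functor B I).obj x)
  | .var _ => Iso.refl _
  | .unit => e
  | .mul s t => B'.mapIso ((comparison x s).prod (comparison x t)) ≪≫ m _ _

theorem comparison_bind (x : Y → C) (us : X → MonTerm Y) (t : MonTerm X) :
    HEq (comparison F e m x (t.bind us)).hom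
      ((t.functor B' I').map (X := fun i => ((us i).functor B' I').obj fun j => F.obj (x j))
        (Y := fun i => F.obj (((us i).functor B I).obj x))
        (fun i => (comparison F e m x (us i)).hom) ≫
      (comparison F e m (fun i => ((us i).functor B I).obj x) t).hom) := by
  induction t with
  | var i => exact heq_of_eq (Category.comp_id _).symm
  | unit => exact heq_of_eq (Category.id_comp _).symm
  | mul a b ih ih' =>
    have h1 (t : MonTerm X) := functor_bind_obj B' I' t us fun i => F.obj (x i)
    have h2 (t : MonTerm X) := functor_bind_obj B I t us x
    have hm {a b a' b' : C} (ha : a = a') (hb : b = b') : HEq (m a b).hom (m a' b').hom := by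
      rw [ha, hb]
    have key {p q p' q' : D} {p'' q'' : C} (f : p ⟶ p') (f' : p' ⟶ F.obj p'') (g : q ⟶ q')
        (g' : q' ⟶ F.obj q'') :
        B'.map (X := (_, _)) (Y := (_, _)) (f ≫ f', g ≫ g') ≫ (m p'' q'').hom =
          B'.map (X := (_, _)) (Y := (_, _)) (f, g) ≫
            B'.map (X := (_, _)) (Y := (_, _)) (f', g') ≫ (m p'' q'').hom := by
      rw [← Category.assoc, ← B'.map_comp]
      rfl
    refine (heq_comp (congrArg B'.obj (Prod.ext (h1 a) (h1 b)))
      (congrArg B'.obj (Prod.ext (congrArg F.obj (h2 a)) (congrArg F.obj (h2 b))))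
      (congrArg F.obj (congrArg B.obj (Prod.ext (h2 a) (h2 b))))
      (heq_map_prod B' (h1 a) (congrArg F.obj (h2 a)) (h1 b) (congrArg F.obj (h2 b)) ih ih')
      (hm (h2 a) (h2 b))).trans (heq_of_eq (key _ _ _ _))

theorem comparison_rename (x : Y → C) (f : X → Y) (t : MonTerm X) :
    HEq (comparison F e m x (t.rename f)).hom (comparison F e m (fun i => x (f i)) t).hom := by
  refine (comparison_bind F e m x _ t).trans (heq_of_eq ?_)
  exact (congrArg (· ≫ _) ((t.functor B' I').map_id _)).trans (Category.id_comp _)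

theorem comparison_comp {n k : ℕ} {l : Fin n → ℕ} (h : ∑ i, l i = k)
    (p : (freeOperad CMonOp).Op n) (q : ∀ i, (freeOperad CMonOp).Op (l i)) (x : Fin k → C) :
    HEq (comparison F e m x (toMon ((freeOperad CMonOp).comp h p q).1)).hom
      (((toMon p.1).functor B' I').map
        (X := fun i => ((toMon (q i).1).functor B' I').obj fun j => F.obj (x (block h i j)))
        (Y := fun i => F.obj (((toMon (q i).1).functor B I).obj fun j => x (block h i j)))
        (fun i => (comparison F e m (fun j => x (block h i j)) (toMon (q i).1)).hom) ≫
      (comparison F e m (fun i => ((toMon (q i).1).functor B I).obj fun j => x (block h i j))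
        (toMon p.1)).hom) := by
  have h1 (i : Fin n) := functor_bind_obj B' I' (toMon (q i).1) (fun j => var (block h i j))
    fun i => F.obj (x i)
  have h2 (i : Fin n) := functor_bind_obj B I (toMon (q i).1) (fun j => var (block h i j)) x
  rw [toMon_comp]
  refine (comparison_bind F e m x _ _).trans ?_
  refine heq_comp (congrArg _ (funext h1)) (congrArg _ (funext fun i => congrArg F.obj (h2 i)))
    (congrArg (fun y => F.obj (((toMon p.1).functor B I).obj y)) (funext h2)) ?_ ?_
  · exact heq_map_pi _ h1 (fun i => congrArg F.obj (h2 i)) fun i => comparison_rename F e m x _ _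
  · have key {y y' : Fin n → C} (hy : y = y') :
        HEq (comparison F e m y (toMon p.1)).hom (comparison F e m y' (toMon p.1)).hom := by
      rw [hy]
    exact key (funext h2)

theorem comparison_act {n : ℕ} (σ : Equiv.Perm (Fin n)) (p : (freeOperad CMonOp).Op n)
    (x : Fin n → C) :
    HEq (comparison F e m x (toMon ((freeOperad CMonOp).act σ p).1)).hom
      (comparison F e m (fun i => x (σ i)) (toMon p.1)).hom := by
  rw [toMon_act]
  exact comparison_rename F e m x σ _

theorem comparison_naturality
    (hm : ∀ {a a' b b' : C} (f : a ⟶ a') (g : b ⟶ b'),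
      B'.map (X := (_, _)) (Y := (_, _)) (F.map f, F.map g) ≫ (m a' b').hom =
        (m a b).hom ≫ F.map (B.map (X := (a, b)) (Y := (a', b')) (f, g)))
    (t : MonTerm X) {x y : X → C} (f : x ⟶ y) :
    (t.functor B' I').map (X := fun i => F.obj (x i)) (Y := fun i => F.obj (y i))
        (fun i => F.map (f i)) ≫ (comparison F e m y t).hom =
      (comparison F e m x t).hom ≫ F.map ((t.functor B I).map f) := by
  induction t with
  | var i => exact (Category.comp_id _).trans (Category.id_comp _).symm
  | unit =>
    exact (Category.id_comp _).trans ((congrArg (_ ≫ ·) (F.map_id _)).trans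
      (Category.comp_id _)).symm
  | mul s t ih ih' =>
    have key {p q p' q' : D} {c d c' d' : C} {f : p ⟶ p'} {g : q ⟶ q'} {k : p' ⟶ F.obj c'}
        {l : q' ⟶ F.obj d'} {k' : p ⟶ F.obj c} {l' : q ⟶ F.obj d} {f' : c ⟶ c'} {g' : d ⟶ d'}
        (h : f ≫ k = k' ≫ F.map f') (h' : g ≫ l = l' ≫ F.map g') :
        B'.map (X := (_, _)) (Y := (_, _)) (f, g) ≫
            B'.map (X := (_, _)) (Y := (_, _)) (k, l) ≫ (m c' d').hom =
          (B'.map (X := (_, _)) (Y := (_, _)) (k', l') ≫ (m c d).hom) ≫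
            F.map (B.map (X := (_, _)) (Y := (_, _)) (f', g')) := by
      rw [← Category.assoc, ← B'.map_comp, Category.assoc, ← hm, ← Category.assoc, ← B'.map_comp]
      exact congrArg₂ (fun f g => B'.map (X := (_, _)) (Y := (_, _)) (f, g) ≫ (m c' d').hom) h h'
    exact key ih ih'

end Comparison

section SMC

variable {M N P : SMC.{v, u}}

/-- The comparison isomorphisms of a symmetric monoidal functor. -/
abbrev smcComparison (F : SMC.Hom M N) {X : Type} (x : X → M.C) (t : MonTerm X) :
    (t.ev N.C).obj (fun i => F.functor.obj (x i)) ≅ F.functor.obj ((t.ev M.C).obj x) :=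
  comparison F.functor (Functor.Monoidal.εIso F.functor) (Functor.Monoidal.μIso F.functor) x t

/-- The comparison isomorphisms of a symmetric monoidal functor commute with the coherence
isomorphisms. -/
theorem smcComparison_iso (F : SMC.Hom M N) {X : Type} (x : X → M.C) {s t : MonTerm X}
    (f : Coh s t) :
    (f.iso fun i => F.functor.obj (x i)).hom ≫ (smcComparison F x t).hom =
      (smcComparison F x s).hom ≫ F.functor.map (f.iso x).hom := by
  induction f with
  | refl t =>
    exact (Category.id_comp _).trans ((congrArg (_ ≫ ·) (F.functor.map_id _)).trans
      (Category.comp_id _)).symm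
  | symm f ih =>
    refine (Iso.inv_comp_eq _).2 ?_
    rw [← Category.assoc, ih, Category.assoc, ← F.functor.map_comp]
    simp [Coh.iso]
  | trans f f' ih ih' =>
    simp only [Coh.iso, Iso.trans_hom, Category.assoc, ih', reassoc_of% ih, F.functor.map_comp]
  | @tensor s s' t t' f f' ih ih' =>
    have key {a b a' b' : N.C} {c d c' d' : M.C} {f : a ⟶ b} {f' : a' ⟶ b'} {g : c ⟶ d}
        {g' : c' ⟶ d'} {k : b ⟶ F.functor.obj d} {k' : b' ⟶ F.functor.obj d'}
        {l : a ⟶ F.functor.obj c} {l' : a' ⟶ F.functor.obj c'} (h : f ≫ k = l ≫ F.functor.map g)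
        (h' : f' ≫ k' = l' ≫ F.functor.map g') :
        (f ⊗ₘ f') ≫ (k ⊗ₘ k') ≫ μ F.functor d d' =
          ((l ⊗ₘ l') ≫ μ F.functor c c') ≫ F.functor.map (g ⊗ₘ g') := by
      rw [tensorHom_comp_tensorHom_assoc, h, h', ← tensorHom_comp_tensorHom_assoc,
        Functor.LaxMonoidal.μ_natural, Category.assoc]
    exact key ih ih'
  | assoc s t r =>
    have key {a b c : N.C} {a' b' c' : M.C} (f : a ⟶ F.functor.obj a') (g : b ⟶ F.functor.obj b')
        (h : c ⟶ F.functor.obj c') :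
        (α_ a b c).inv ≫ ((((f ⊗ₘ g) ≫ μ F.functor _ _) ⊗ₘ h) ≫ μ F.functor _ _) =
          ((f ⊗ₘ ((g ⊗ₘ h) ≫ μ F.functor _ _)) ≫ μ F.functor _ _) ≫
            F.functor.map (α_ a' b' c').inv := by
      have h1 : ((f ⊗ₘ g) ≫ μ F.functor a' b') ⊗ₘ h =
          ((f ⊗ₘ g) ⊗ₘ h) ≫ (μ F.functor a' b' ▷ F.functor.obj c') := by
        rw [← tensorHom_id, tensorHom_comp_tensorHom, Category.comp_id]
      have h2 : f ⊗ₘ ((g ⊗ₘ h) ≫ μ F.functor b' c') =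
          (f ⊗ₘ (g ⊗ₘ h)) ≫ (F.functor.obj a' ◁ μ F.functor b' c') := by
        rw [← id_tensorHom, tensorHom_comp_tensorHom, Category.comp_id]
      rw [h1, h2, Category.assoc, Category.assoc, Category.assoc,
        Functor.LaxMonoidal.associativity_inv, associator_inv_naturality_assoc]
    exact key _ _ _
  | unitl t =>
    have key {a : N.C} {a' : M.C} (f : a ⟶ F.functor.obj a') :
        (λ_ a).hom ≫ f = ((ε F.functor ⊗ₘ f) ≫ μ F.functor _ _) ≫ F.functor.map (λ_ a').hom := by
      rw [← leftUnitor_naturality, Functor.LaxMonoidal.left_unitality, ← id_tensorHom,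
        ← tensorHom_id, tensorHom_comp_tensorHom_assoc, Category.id_comp, Category.comp_id,
        Category.assoc]
    exact key _
  | unitr t =>
    have key {a : N.C} {a' : M.C} (f : a ⟶ F.functor.obj a') :
        (ρ_ a).hom ≫ f = ((f ⊗ₘ ε F.functor) ≫ μ F.functor _ _) ≫ F.functor.map (ρ_ a').hom := by
      rw [← rightUnitor_naturality, Functor.LaxMonoidal.right_unitality, ← id_tensorHom,
        ← tensorHom_id, tensorHom_comp_tensorHom_assoc, Category.id_comp, Category.comp_id,
        Category.assoc]
    exact key _
  | comm s t =>
    have key {a b : N.C} {a' b' : M.C} (f : a ⟶ F.functor.obj a') (g : b ⟶ F.functor.obj b') :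
        (β_ a b).hom ≫ ((g ⊗ₘ f) ≫ μ F.functor _ _) =
          ((f ⊗ₘ g) ≫ μ F.functor _ _) ≫ F.functor.map (β_ a' b').hom := by
      rw [Category.assoc, Functor.LaxBraided.braided,
        ← BraidedCategory.braiding_naturality_assoc]
    exact key _ _

/-- The weak map that is given by a symmetric monoidal functor. -/
noncomputable def smcWeakMap (F : SMC.Hom M N) : WeakMap (smcAlgebra M.C) (smcAlgebra N.C) where
  functor := F.functor
  coh q x := smcComparison F x (toMon q.1)
  coh_naturality q _ _ f :=
    comparison_naturality _ _ _ (fun f g => Functor.LaxMonoidal.μ_natural _ f g) (toMon q.1) f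
  coh_trans {_ q q'} _ x := smcComparison_iso F x (someCoh q q')
  coh_one _ := HEq.rfl
  coh_comp h q r x := comparison_comp _ _ _ h q r x
  coh_act σ q x := comparison_act _ _ _ σ q x

theorem smcComparison_id (M : SMC.{v, u}) {X : Type} (x : X → M.C) (t : MonTerm X) :
    (smcComparison (𝟙 M : M ⟶ M) x t).hom = 𝟙 _ := by
  induction t with
  | var i => rfl
  | unit => rfl
  | mul s t ih ih' =>
    have key {a b : M.C} {f : a ⟶ a} {g : b ⟶ b} (hf : f = 𝟙 a) (hg : g = 𝟙 b) :
        (f ⊗ₘ g) ≫ 𝟙 (a ⊗ b) = 𝟙 (a ⊗ b) := by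
      rw [hf, hg, Category.comp_id, id_tensorHom_id]
    exact key ih ih'

theorem smcComparison_comp (F : SMC.Hom M N) (G : SMC.Hom N P) {X : Type} (x : X → M.C)
    (t : MonTerm X) :
    (smcComparison ((show M ⟶ N from F) ≫ (show N ⟶ P from G) : M ⟶ P) x t).hom =
      (smcComparison G (fun i => F.functor.obj (x i)) t).hom ≫
        G.functor.map (smcComparison F x t).hom := by
  induction t with
  | var i => exact ((congrArg (_ ≫ ·) (G.functor.map_id _)).trans (Category.comp_id _)).symm
  | unit => rfl
  | mul s t ih ih' =>
    have key {a b : P.C} {c d : N.C} {c' d' : M.C} {f : a ⟶ G.functor.obj c}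
        {f' : b ⟶ G.functor.obj d} {g : c ⟶ F.functor.obj c'} {g' : d ⟶ F.functor.obj d'}
        {k : a ⟶ G.functor.obj (F.functor.obj c')} {k' : b ⟶ G.functor.obj (F.functor.obj d')}
        (hk : k = f ≫ G.functor.map g) (hk' : k' = f' ≫ G.functor.map g') :
        (k ⊗ₘ k') ≫ μ G.functor _ _ ≫ G.functor.map (μ F.functor c' d') =
          ((f ⊗ₘ f') ≫ μ G.functor _ _) ≫ G.functor.map ((g ⊗ₘ g') ≫ μ F.functor _ _) := by
      rw [hk, hk', ← tensorHom_comp_tensorHom, Category.assoc,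
        Functor.LaxMonoidal.μ_natural_assoc, Category.assoc, G.functor.map_comp]
    exact key ih ih'

/-- The functor that sends a symmetric monoidal category to the algebra that it defines. -/
noncomputable def smcToWk : SMC.{v, u} ⥤ WkPCat.{v, u} where
  obj M := ⟨M.C, smcAlgebra M.C⟩
  map F := smcWeakMap F
  map_id M := by
    refine WeakMap.ext rfl (heq_of_eq ?_)
    funext n q x
    exact Iso.ext (smcComparison_id M x _)
  map_comp F G := by
    refine WeakMap.ext rfl (heq_of_eq ?_)
    funext n q x
    exact Iso.ext (smcComparison_comp F G x _)

end SMC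

/-! ### Uniqueness of corresponding structures -/

theorem gen_dot : freeOperad.gen CMonOp.dot = CMonEq.dot :=
  Subtype.ext (congrArg (OpTerm.op CMonOp.dot) (funext fun i => by fin_cases i <;> rfl))

theorem gen_e : freeOperad.gen CMonOp.e = CMonEq.e :=
  Subtype.ext (congrArg (OpTerm.op CMonOp.e) (funext fun i => i.elim0))

/-- The interpretation of all operations is determined by that of the generating ones. -/
theorem app_eq_functor {C : Type u} [Category.{v} C] (h : Algebra (weakening CMonEq.φ) C)
    (B : C × C ⥤ C) (I : C)
    (hdot : h.app CMonEq.dot = (toMon CMonEq.dot.1).functor B I)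
    (he : h.app CMonEq.e = (toMon CMonEq.e.1).functor B I) {n : ℕ}
    (p : (freeOperad CMonOp).Op n) : h.app p = (toMon p.1).functor B I := by
  refine freeOperad.induction (P := fun {n} (p : (freeOperad CMonOp).Op n) =>
    h.app p = (toMon p.1).functor B I) ?_ ?_ ?_ ?_ p
  · exact h.app_one
  · intro n φ
    cases φ with
    | e => rwa [gen_e]
    | dot => rwa [gen_dot]
  · intro n m k hm p q hp hq
    refine (h.app_comp hm p q).trans ?_
    rw [functor_comp, ← hp, show (fun i => (toMon (q i).1).functor B I) = fun i => h.app (q i) from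
      funext fun i => (hq i).symm]
  · intro n σ p hp
    refine (h.app_act σ p).trans ?_
    rw [functor_act, ← hp]

/-- An algebra is determined by its interpretation of the 1-cells and of the 2-cells that name the
equations, because these 2-cells generate all others. -/
theorem algebra_ext {C : Type u} [Category.{v} C] {h h' : Algebra (weakening CMonEq.φ) C}
    (happ : ∀ {n : ℕ} (p : (freeOperad CMonOp).Op n), h.app p = h'.app p)
    (hcell : ∀ {n : ℕ} (E : CMonEq n), HEq (h.map (CMonEq.cell E)) (h'.map (CMonEq.cell E))) :
    h = h' := by
  obtain ⟨f, map, map_id, map_comp, map_compMap, map_actMap⟩ := h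
  obtain ⟨f', map', map_id', map_comp', map_compMap', map_actMap'⟩ := h'
  obtain rfl : f = f' := SymmOperad.Hom.ext (by funext n p; exact happ p)
  have key : ∀ {n : ℕ} {p q : (freeOperad CMonOp).Op n}, CMonEq.Rel p q →
      ∀ c : ((weakening CMonEq.φ).cat n).Hom p q, map c = map' c := by
    intro n p q hpq
    induction hpq with
    | refl p => exact fun c => (map_id p).trans (map_id' p).symm
    | @symm n p q _ ih =>
      intro c
      let c' : ((weakening CMonEq.φ).cat n).Hom p q := ⟨rfl⟩
      have h1 : map c ≫ map c' = 𝟙 _ := (map_comp c c').symm.trans (map_id _)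
      have h2 : map' c' ≫ map' c = 𝟙 _ := (map_comp' c' c).symm.trans (map_id' _)
      rw [← Category.comp_id (map c), ← h2, ← ih c', ← Category.assoc, h1, Category.id_comp]
    | @trans n p q r _ _ ih ih' =>
      intro c
      let a : ((weakening CMonEq.φ).cat n).Hom p q := ⟨rfl⟩
      let b : ((weakening CMonEq.φ).cat n).Hom q r := ⟨rfl⟩
      refine (map_comp a b).trans (Eq.trans ?_ (map_comp' a b).symm)
      rw [ih, ih']
    | eqn E => exact fun c => eq_of_heq (hcell E)
    | @comp n m k hm p p' q q' _ _ ih ih' =>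
      intro c
      let a : ((weakening CMonEq.φ).cat n).Hom p p' := ⟨rfl⟩
      let b (i : Fin n) : ((weakening CMonEq.φ).cat (k i)).Hom (q i) (q' i) := ⟨rfl⟩
      refine eq_of_heq ((map_compMap hm a b).trans (HEq.trans ?_ (map_compMap' hm a b).symm))
      rw [ih a, show (fun i => map (b i)) = fun i => map' (b i) from funext fun i => ih' i (b i)]
    | @act n σ p q _ ih =>
      intro c
      let a : ((weakening CMonEq.φ).cat n).Hom p q := ⟨rfl⟩
      refine eq_of_heq ((map_actMap σ a).trans (HEq.trans ?_ (map_actMap' σ a).symm))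
      rw [ih a]
  have : @map = @map' := by
    funext n p q c
    exact key (CMonEq.rel_all p q) c
  subst this
  rfl

section Vectors

variable {C : Type u}

theorem vec_eq_two (x : Fin 2 → C) : ![x 0, x 1] = x := by
  funext i
  fin_cases i <;> rfl

theorem vec_eq_three (x : Fin 3 → C) : ![x 0, x 1, x 2] = x := by
  funext i
  fin_cases i <;> rfl

theorem vec_eq_one (x : Fin 1 → C) : ![x 0] = x := by
  funext i
  fin_cases i
  rfl

end Vectors

section Matches

variable {C : Type u} [Category.{v} C]

/-- A functor out of `C ^ 0` is constant. -/
theorem functor_fin_zero_eq (F : (Fin 0 → C) ⥤ C) : F = (Functor.const _).obj (F.obj ![]) := by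
  refine Functor.hext (fun x => congrArg F.obj (Subsingleton.elim _ _)) fun x y f => ?_
  obtain rfl : x = ![] := Subsingleton.elim _ _
  obtain rfl : y = ![] := Subsingleton.elim _ _
  obtain rfl : f = 𝟙 _ := funext fun i => i.elim0
  exact heq_of_eq (F.map_id _)

variable [MonoidalCategory C] [SymmetricCategory C]

theorem Matches.app_eq {h : Algebra (weakening CMonEq.φ) C} (H : Matches C h) {n : ℕ}
    (p : (freeOperad CMonOp).Op n) : h.app p = (toMon p.1).ev C := by
  refine app_eq_functor h _ _ ?_ ?_ p
  · refine Functor.hext (fun x => ?_) fun x y f => H.dot_map f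
    rw [← vec_eq_two x]
    exact H.dot_obj _ _
  · exact (functor_fin_zero_eq _).trans (congrArg (Functor.const _).obj H.e_obj)

/-- A symmetric monoidal structure corresponds to at most one algebra structure. -/
theorem Matches.algebra_eq {h h' : Algebra (weakening CMonEq.φ) C} (H : Matches C h)
    (H' : Matches C h') : h = h' := by
  have happ {n : ℕ} (p : (freeOperad CMonOp).Op n) : h.app p = h'.app p :=
    (H.app_eq p).trans (H'.app_eq p).symm
  refine algebra_ext happ fun E => natTrans_heq (happ _) (happ _) fun x => ?_
  cases E with
  | assoc =>
    rw [← vec_eq_three x]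
    exact (H.assoc _ _ _).trans (H'.assoc _ _ _).symm
  | unitl =>
    rw [← vec_eq_one x]
    exact (H.unitl _).trans (H'.unitl _).symm
  | unitr =>
    rw [← vec_eq_one x]
    exact (H.unitr _).trans (H'.unitr _).symm
  | comm =>
    rw [← vec_eq_two x]
    exact (H.comm _ _).trans (H'.comm _ _).symm

end Matches

theorem monoidalCategory_ext {C : Type u} [Category.{v} C] {m m' : MonoidalCategory C}
    (hobj : ∀ A B, m.tensorObj A B = m'.tensorObj A B)
    (hmap : ∀ {A A' B B' : C} (f : A ⟶ A') (g : B ⟶ B'), HEq (m.tensorHom f g) (m'.tensorHom f g))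
    (hunit : m.tensorUnit = m'.tensorUnit)
    (hassoc : ∀ A B D, HEq (m.associator A B D).inv (m'.associator A B D).inv)
    (hunitl : ∀ A, HEq (m.leftUnitor A).hom (m'.leftUnitor A).hom)
    (hunitr : ∀ A, HEq (m.rightUnitor A).hom (m'.rightUnitor A).hom) : m = m' := by
  have hl (A : C) {B B' : C} (f : B ⟶ B') : HEq (m.whiskerLeft A f) (m'.whiskerLeft A f) :=
    (heq_of_eq (@id_tensorHom C _ m A _ _ f).symm).trans
      ((hmap _ _).trans (heq_of_eq (@id_tensorHom C _ m' A _ _ f)))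
  have hr {A A' : C} (f : A ⟶ A') (B : C) : HEq (m.whiskerRight f B) (m'.whiskerRight f B) :=
    (heq_of_eq (@tensorHom_id C _ m _ _ f B).symm).trans
      ((hmap _ _).trans (heq_of_eq (@tensorHom_id C _ m' _ _ f B)))
  obtain @⟨⟨o, wl, wr, th, I, a, l, r⟩, _, _, _, _, _, _, _, _, _, _⟩ := m
  obtain @⟨⟨o', wl', wr', th', I', a', l', r'⟩, _, _, _, _, _, _, _, _, _, _⟩ := m'
  obtain rfl : o = o' := funext fun A => funext fun B => hobj A B
  subst hunit
  obtain rfl : @th = @th' := by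
    funext A A' B B' f g
    exact eq_of_heq (hmap f g)
  obtain rfl : @wl = @wl' := by
    funext A B B' f
    exact eq_of_heq (hl A f)
  obtain rfl : @wr = @wr' := by
    funext A A' f B
    exact eq_of_heq (hr f B)
  obtain rfl : a = a' := by
    funext A B D
    exact Iso.ext_inv (eq_of_heq (hassoc A B D))
  obtain rfl : l = l' := by
    funext A
    exact Iso.ext (eq_of_heq (hunitl A))
  obtain rfl : r = r' := by
    funext A
    exact Iso.ext (eq_of_heq (hunitr A))
  rfl

/-- An algebra structure corresponds to at most one symmetric monoidal structure. -/
theorem Matches.smc_eq {C : Type u} [Category.{v} C] {m m' : MonoidalCategory C}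
    {s : @SymmetricCategory C _ m} {s' : @SymmetricCategory C _ m'}
    {h : Algebra (weakening CMonEq.φ) C} (H : @Matches C _ m s h) (H' : @Matches C _ m' s' h) :
    (⟨m, s⟩ : Sigma fun m => @SymmetricCategory C _ m) = ⟨m', s'⟩ := by
  obtain rfl : m = m' := monoidalCategory_ext
    (fun A B => (@Matches.dot_obj C _ m s h H A B).symm.trans (@Matches.dot_obj C _ m' s' h H' A B))
    (fun {A A' B B'} f g =>
      (@Matches.dot_map C _ m s h H ![A, B] ![A', B'] fun | 0 => f | 1 => g).symm.trans
        (@Matches.dot_map C _ m' s' h H' ![A, B] ![A', B'] fun | 0 => f | 1 => g))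
    ((@Matches.e_obj C _ m s h H).symm.trans (@Matches.e_obj C _ m' s' h H'))
    (fun A B D => (@Matches.assoc C _ m s h H A B D).symm.trans
      (@Matches.assoc C _ m' s' h H' A B D))
    (fun A => (@Matches.unitl C _ m s h H A).symm.trans (@Matches.unitl C _ m' s' h H' A))
    (fun A => (@Matches.unitr C _ m s h H A).symm.trans (@Matches.unitr C _ m' s' h H' A))
  have hb (A B : C) : s.braiding A B = s'.braiding A B :=
    Iso.ext (eq_of_heq ((@Matches.comm C _ m s h H A B).symm.trans
      (@Matches.comm C _ m s' h H' A B)))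
  obtain @⟨⟨b, _, _, _, _⟩, _⟩ := s
  obtain @⟨⟨b', _, _, _, _⟩, _⟩ := s'
  obtain rfl : b = b' := funext fun A => funext fun B => hb A B
  rfl

/-- A weak map is determined by its underlying functor and its components at the generating
operations. -/
theorem weakMap_ext {A B : Type u} [Category.{v} A] [Category.{v} B]
    {h : Algebra (weakening CMonEq.φ) A} {h' : Algebra (weakening CMonEq.φ) B}
    {G G' : WeakMap h h'} (hF : G.functor = G'.functor)
    (hdot : ∀ a b : A, HEq (G.coh CMonEq.dot ![a, b]).hom (G'.coh CMonEq.dot ![a, b]).hom)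
    (he : HEq (G.coh CMonEq.e ![]).hom (G'.coh CMonEq.e ![]).hom) : G = G' := by
  obtain ⟨F, c, nat, tr, one, comp, act⟩ := G
  obtain ⟨F', c', nat', tr', one', comp', act'⟩ := G'
  dsimp only at hF hdot he
  subst hF
  obtain rfl : @c = @c' := by
    funext n q
    refine freeOperad.induction (P := fun {n} (q : (freeOperad CMonOp).Op n) => c q = c' q)
      ?_ ?_ ?_ ?_ q
    · funext x
      exact Iso.ext (eq_of_heq ((one x).trans (one' x).symm))
    · intro n φ
      cases φ with
      | e =>
        rw [gen_e]
        funext x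
        obtain rfl : x = ![] := Subsingleton.elim _ _
        exact Iso.ext (eq_of_heq he)
      | dot =>
        rw [gen_dot]
        funext x
        rw [← vec_eq_two x]
        exact Iso.ext (eq_of_heq (hdot _ _))
    · intro n m k hm p q hp hq
      funext x
      refine Iso.ext (eq_of_heq ((comp hm p q x).trans (HEq.trans ?_ (comp' hm p q x).symm)))
      simp only [hp, hq]
      rfl
    · intro n σ p hp
      funext x
      refine Iso.ext (eq_of_heq ((act σ p x).trans (HEq.trans ?_ (act' σ p x).symm)))
      rw [hp]
  rfl

/-! ### Strictification of the interpretation of 1-cells -/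

/-- A copy of a map of symmetric `Cat`-operads with a new, equal, action on 1-cells. -/
def CatSymmOperad.Hom.copy {P : CatSymmOperad.{w, t}} {Q : CatSymmOperad.{w', t'}}
    (h : CatSymmOperad.Hom P Q) (app : ∀ n, P.Op n → Q.Op n) (happ : app = fun _ p => h.app p) :
    CatSymmOperad.Hom P Q where
  app := app _
  app_one := by subst happ; exact h.app_one
  app_comp := by subst happ; exact h.app_comp
  app_act := by subst happ; exact h.app_act
  map := by subst happ; exact h.map
  map_id := by subst happ; exact h.map_id
  map_comp := by subst happ; exact h.map_comp
  map_compMap := by subst happ; exact h.map_compMap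
  map_actMap := by subst happ; exact h.map_actMap

theorem CatSymmOperad.Hom.copy_eq {P : CatSymmOperad.{w, t}} {Q : CatSymmOperad.{w', t'}}
    (h : CatSymmOperad.Hom P Q) (app : ∀ n, P.Op n → Q.Op n) (happ : app = fun _ p => h.app p) :
    h.copy app happ = h := by
  subst happ
  rfl

theorem natTrans_app_heq {J : Type w} [Category.{w'} J] {C : Type u} [Category.{v} C]
    {F G F' G' : J ⥤ C} (hF : F = F') (hG : G = G') {α : F ⟶ G} {β : F' ⟶ G'} (h : HEq α β)
    (x : J) : HEq (α.app x) (β.app x) := by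
  subst hF hG
  rw [eq_of_heq h]

/-- The functor that sends a pair to a vector of length two. -/
def pairing (C : Type u) [Category.{v} C] : C × C ⥤ (Fin 2 → C) where
  obj p := ![p.1, p.2]
  map f
    | 0 => f.1
    | 1 => f.2
  map_id _ := by
    funext i
    fin_cases i <;> rfl
  map_comp _ _ := by
    funext i
    fin_cases i <;> rfl

namespace Algebra

section Strict

variable {C : Type u} [Category.{v} C] (h : Algebra (weakening CMonEq.φ) C)

/-- The interpretation of the binary operation, as a functor of two variables. -/
def tens : C × C ⥤ C :=
  pairing C ⋙ Algebra.fn h CMonEq.dot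

/-- The interpretation of the nullary operation. -/
def unitObj : C :=
  (Algebra.fn h CMonEq.e).obj ![]

theorem app_eq {n : ℕ} (p : (freeOperad CMonOp).Op n) :
    h.app p = (toMon p.1).functor h.tens h.unitObj := by
  refine app_eq_functor h _ _ ?_ (functor_fin_zero_eq _) p
  refine Functor.hext (fun x => congrArg (Algebra.fn h CMonEq.dot).obj (vec_eq_two x).symm)
    fun x y f => heq_map_pi (Algebra.fn h CMonEq.dot) (fun i => ?_) (fun i => ?_) fun i => ?_
  all_goals
    fin_cases i <;> rfl

/-- The same algebra, in which the interpretation of a composite operation is by definition an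
iterate of the interpretations of the generating operations. -/
def strict : Algebra (weakening CMonEq.φ) C :=
  CatSymmOperad.Hom.copy h (fun _ p => (toMon p.1).functor h.tens h.unitObj)
    (funext fun _ => funext fun p => (h.app_eq p).symm)

theorem strict_eq : h.strict = h :=
  CatSymmOperad.Hom.copy_eq h _ _

/-- The interpretation of the unique 2-cell between two operations of the same arity. -/
def cell {n : ℕ} (p q : (freeOperad CMonOp).Op n) :
    (toMon p.1).functor h.tens h.unitObj ⟶ (toMon q.1).functor h.tens h.unitObj :=
  h.strict.map (⟨rfl⟩ : ((weakening CMonEq.φ).cat n).Hom p q)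

theorem cell_refl {n : ℕ} (p : (freeOperad CMonOp).Op n) : h.cell p p = 𝟙 _ :=
  h.strict.map_id p

theorem cell_trans {n : ℕ} (p q r : (freeOperad CMonOp).Op n) :
    h.cell p q ≫ h.cell q r = h.cell p r :=
  (h.strict.map_comp (⟨rfl⟩ : ((weakening CMonEq.φ).cat n).Hom p q)
    (⟨rfl⟩ : ((weakening CMonEq.φ).cat n).Hom q r)).symm

theorem cell_trans_app {n : ℕ} (p q r : (freeOperad CMonOp).Op n) (x : Fin n → C) :
    (h.cell p q).app x ≫ (h.cell q r).app x = (h.cell p r).app x :=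
  congrArg (fun α => NatTrans.app α x) (h.cell_trans p q r)

theorem trans_heq_cell {n : ℕ} {p q : (freeOperad CMonOp).Op n}
    (δ : ((weakening CMonEq.φ).cat n).Hom p q) (x : Fin n → C) :
    HEq ((Algebra.trans h δ).app x) ((h.cell p q).app x) := by
  have key {h' : Algebra (weakening CMonEq.φ) C} (hh : h' = h) :
      HEq ((Algebra.trans h δ).app x) ((Algebra.trans h' δ).app x) := by
    rw [hh]
  exact key h.strict_eq

theorem cell_comp {n m : ℕ} {k : Fin n → ℕ} (hm : ∑ i, k i = m) (p p' : (freeOperad CMonOp).Op n)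
    (q q' : ∀ i, (freeOperad CMonOp).Op (k i)) (x : Fin m → C) :
    HEq ((h.cell ((freeOperad CMonOp).comp hm p q) ((freeOperad CMonOp).comp hm p' q')).app x)
      (((toMon p.1).functor h.tens h.unitObj).map
        (X := fun i => ((toMon (q i).1).functor h.tens h.unitObj).obj fun j => x (block hm i j))
        (Y := fun i => ((toMon (q' i).1).functor h.tens h.unitObj).obj fun j => x (block hm i j))
        (fun i => (h.cell (q i) (q' i)).app fun j => x (block hm i j)) ≫
      (h.cell p p').app fun i =>
        ((toMon (q' i).1).functor h.tens h.unitObj).obj fun j => x (block hm i j)) :=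
  natTrans_app_heq (h.strict.app_comp hm p q) (h.strict.app_comp hm p' q')
    (h.strict.map_compMap hm (⟨rfl⟩ : ((weakening CMonEq.φ).cat n).Hom p p')
      (fun i => (⟨rfl⟩ : ((weakening CMonEq.φ).cat (k i)).Hom (q i) (q' i)))) x

theorem cell_act {n : ℕ} (σ : Equiv.Perm (Fin n)) (p p' : (freeOperad CMonOp).Op n)
    (x : Fin n → C) :
    HEq ((h.cell ((freeOperad CMonOp).act σ p) ((freeOperad CMonOp).act σ p')).app x)
      ((h.cell p p').app fun i => x (σ i)) :=
  natTrans_app_heq (h.strict.app_act σ p) (h.strict.app_act σ p')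
    (h.strict.map_actMap σ (⟨rfl⟩ : ((weakening CMonEq.φ).cat n).Hom p p')) x

end Strict

end Algebra

theorem toMon_injective {X : Type} : Function.Injective (toMon (X := X)) :=
  Function.LeftInverse.injective ofMon_toMon

/-- If relabelled linear terms are substituted into a linear term, and the result is linear, then
the labels fit together to a bijection. -/
theorem bijective_of_bind {m n : ℕ} {k : Fin m → ℕ} {p : (freeOperad CMonOp).Op m}
    {q : ∀ i, (freeOperad CMonOp).Op (k i)} {g : ∀ i, Fin (k i) → Fin n}
    {r : (freeOperad CMonOp).Op n} (hr : r.1 = p.1.bind fun i => (q i).1.rename (g i)) :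
    Function.Bijective fun a : Σ i, Fin (k i) => g a.1 a.2 := by
  have hsum (y : Fin n) : (∑ a : Σ i, Fin (k i), if g a.1 a.2 = y then 1 else 0) = 1 := by
    have := r.2 y
    rw [hr, OpTerm.count_bind] at this
    simp only [OpTerm.count_rename, p.2 _, (q _).2 _, one_mul] at this
    rw [Fintype.sum_sigma]
    exact this
  refine (Function.bijective_iff_existsUnique _).2 fun y => ?_
  have := hsum y
  rw [← Finset.sum_filter, ← Finset.card_eq_sum_ones, Finset.card_eq_one] at this
  obtain ⟨a, ha⟩ := this
  have key (b : Σ i, Fin (k i)) : g b.1 b.2 = y ↔ b = a := by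
    have := Finset.ext_iff.1 ha b
    simpa using this
  exact ⟨a, (key a).2 rfl, fun b hb => (key b).1 hb⟩

namespace Algebra

section Cells

variable {C : Type u} [Category.{v} C] (h : Algebra (weakening CMonEq.φ) C)

/-- The interpretation of a 2-cell that is obtained by substitution of 2-cells into a 2-cell. -/
theorem cell_bind {m n : ℕ} {k : Fin m → ℕ} (p p' : (freeOperad CMonOp).Op m)
    (q q' : ∀ i, (freeOperad CMonOp).Op (k i)) (g : ∀ i, Fin (k i) → Fin n)
    {r r' : (freeOperad CMonOp).Op n}
    (hr : toMon r.1 = (toMon p.1).bind fun i => (toMon (q i).1).rename (g i))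
    (hr' : toMon r'.1 = (toMon p'.1).bind fun i => (toMon (q' i).1).rename (g i))
    (x : Fin n → C) :
    HEq ((h.cell r r').app x)
      (((toMon p.1).functor h.tens h.unitObj).map
        (X := fun i => ((toMon (q i).1).functor h.tens h.unitObj).obj fun j => x (g i j))
        (Y := fun i => ((toMon (q' i).1).functor h.tens h.unitObj).obj fun j => x (g i j))
        (fun i => (h.cell (q i) (q' i)).app fun j => x (g i j)) ≫
      (h.cell p p').app fun i =>
        ((toMon (q' i).1).functor h.tens h.unitObj).obj fun j => x (g i j)) := by
  simp only [← toMon_rename, ← toMon_bind] at hr hr'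
  replace hr := toMon_injective hr
  replace hr' := toMon_injective hr'
  obtain ⟨hn, σ, hσ⟩ := OpTerm.exists_perm_block g (bijective_of_bind hr)
  obtain rfl : g = fun i j => σ (block hn i j) := funext fun i => funext fun j => hσ i j
  obtain rfl : r = (freeOperad CMonOp).act σ ((freeOperad CMonOp).comp hn p q) :=
    Subtype.ext (hr.trans (freeOperad.act_comp_val hn σ p q).symm)
  obtain rfl : r' = (freeOperad CMonOp).act σ ((freeOperad CMonOp).comp hn p' q') :=
    Subtype.ext (hr'.trans (freeOperad.act_comp_val hn σ p' q').symm)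
  exact (h.cell_act σ _ _ x).trans (h.cell_comp hn p p' q q' _)

/-- The interpretation of a substitution instance of a 2-cell. -/
theorem cell_subst {m n : ℕ} (p p' : (freeOperad CMonOp).Op m) (us : Fin m → MonTerm (Fin n))
    {r r' : (freeOperad CMonOp).Op n} (hr : toMon r.1 = (toMon p.1).bind us)
    (hr' : toMon r'.1 = (toMon p'.1).bind us) (x : Fin n → C) (y : Fin m → C)
    (hy : y = fun i => ((us i).functor h.tens h.unitObj).obj x) :
    HEq ((h.cell r r').app x) ((h.cell p p').app y) := by
  obtain ⟨k, hn, σ, H⟩ := OpTerm.exists_linear_decomposition (fun i => ofMon (us i)) fun z => by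
    have := r.2 z
    rw [eq_bind_of_toMon_eq hr, OpTerm.count_bind] at this
    simpa [p.2 _] using this
  obtain ⟨q, hq⟩ := H _ fun _ _ => rfl
  obtain rfl : us = fun i => (toMon (q i).1).rename fun j => σ (block hn i j) := by
    funext i
    rw [← toMon_rename, ← hq i, toMon_ofMon]
  refine (h.cell_bind p p' q q _ hr hr' x).trans ?_
  obtain rfl : y = fun i => ((toMon (q i).1).functor h.tens h.unitObj).obj
      fun j => x (σ (block hn i j)) := hy.trans (funext fun i => functor_bind_obj _ _ _ _ x)
  simp only [cell_refl]
  refine heq_of_eq ?_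
  exact (congrArg (· ≫ _) (((toMon p.1).functor h.tens h.unitObj).map_id _)).trans
    (Category.id_comp _)

/-- The interpretation of a product of two 2-cells. -/
theorem cell_mul {n k k' : ℕ} (q q' : (freeOperad CMonOp).Op k) (s s' : (freeOperad CMonOp).Op k')
    (g : Fin k → Fin n) (g' : Fin k' → Fin n) {r r' : (freeOperad CMonOp).Op n}
    (hr : toMon r.1 = mul ((toMon q.1).rename g) ((toMon s.1).rename g'))
    (hr' : toMon r'.1 = mul ((toMon q'.1).rename g) ((toMon s'.1).rename g'))
    (x : Fin n → C) (y : Fin k → C) (z : Fin k' → C) (hy : y = fun j => x (g j))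
    (hz : z = fun j => x (g' j)) :
    HEq ((h.cell r r').app x)
      (h.tens.map (X := (_, _)) (Y := (_, _)) ((h.cell q q').app y, (h.cell s s').app z)) := by
  subst hy hz
  let K : Fin 2 → ℕ := ![k, k']
  let Q : ∀ i, (freeOperad CMonOp).Op (K i) := fun | 0 => q | 1 => s
  let Q' : ∀ i, (freeOperad CMonOp).Op (K i) := fun | 0 => q' | 1 => s'
  let G : ∀ i, Fin (K i) → Fin n := fun | 0 => g | 1 => g'
  refine (h.cell_bind CMonEq.dot CMonEq.dot Q Q' G hr hr' x).trans (heq_of_eq ?_)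
  rw [cell_refl]
  exact Category.comp_id _

end Cells

end Algebra

/-! ### The symmetric monoidal structure of an algebra -/

/-- The operation that is given by a linear binary term. -/
def linearOp {n : ℕ} (t : MonTerm (Fin n)) (ht : ∀ x, (ofMon t).count x = 1) :
    (freeOperad CMonOp).Op n :=
  ⟨ofMon t, ht⟩

/-- For a symmetry, the second hexagon identity is the inverse of the first one. -/
theorem hexagon_reverse_of_symmetric {C : Type u} [Category.{v} C] [MonoidalCategory C]
    (b : ∀ A B : C, A ⊗ B ⟶ B ⊗ A) (symm : ∀ A B, b A B ≫ b B A = 𝟙 (A ⊗ B))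
    (hex : ∀ A B D, (α_ A B D).hom ≫ b A (B ⊗ D) ≫ (α_ B D A).hom =
      b A B ▷ D ≫ (α_ B A D).hom ≫ B ◁ b A D) (A B D : C) :
    (α_ A B D).inv ≫ b (A ⊗ B) D ≫ (α_ D A B).inv =
      A ◁ b B D ≫ (α_ A D B).inv ≫ b A D ▷ B := by
  have h₁ : ((α_ A B D).inv ≫ b (A ⊗ B) D ≫ (α_ D A B).inv) ≫
      (α_ D A B).hom ≫ b D (A ⊗ B) ≫ (α_ A B D).hom = 𝟙 _ := by
    simp [reassoc_of% symm (A ⊗ B) D]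
  have h₂ : (b D A ▷ B ≫ (α_ A D B).hom ≫ A ◁ b D B) ≫
      A ◁ b B D ≫ (α_ A D B).inv ≫ b A D ▷ B = 𝟙 _ := by
    simp only [Category.assoc]
    rw [← whiskerLeft_comp_assoc, symm, whiskerLeft_id, Category.id_comp, Iso.hom_inv_id_assoc,
      ← comp_whiskerRight, symm, id_whiskerRight]
  rw [← hex] at h₂
  rw [← Category.comp_id (_ ≫ _ ≫ (α_ D A B).inv), ← h₂, ← Category.assoc, h₁, Category.id_comp]

namespace Algebra

section Monoidal

variable {C : Type u} [Category.{v} C] (h : Algebra (weakening CMonEq.φ) C)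

/-- The interpretation of an invertible 2-cell at a vector of objects. -/
def cellIso {n : ℕ} (p q : (freeOperad CMonOp).Op n) (x : Fin n → C) :
    ((toMon p.1).functor h.tens h.unitObj).obj x ≅ ((toMon q.1).functor h.tens h.unitObj).obj x where
  hom := (h.cell p q).app x
  inv := (h.cell q p).app x
  hom_inv_id := by rw [cell_trans_app, cell_refl]; rfl
  inv_hom_id := by rw [cell_trans_app, cell_refl]; rfl

/-- The data of a monoidal structure on an algebra. -/
abbrev monoidalStruct : MonoidalCategoryStruct C where
  tensorObj A B := h.tens.obj (A, B)
  whiskerLeft A _ _ f := h.tens.map (X := (_, _)) (Y := (_, _)) (𝟙 A, f)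
  whiskerRight f B := h.tens.map (X := (_, _)) (Y := (_, _)) (f, 𝟙 B)
  tensorHom f g := h.tens.map (X := (_, _)) (Y := (_, _)) (f, g)
  tensorUnit := h.unitObj
  associator A B D := h.cellIso (CMonEq.rhs .assoc) (CMonEq.lhs .assoc) ![A, B, D]
  leftUnitor A := h.cellIso (CMonEq.lhs .unitl) (CMonEq.rhs .unitl) ![A]
  rightUnitor A := h.cellIso (CMonEq.lhs .unitr) (CMonEq.rhs .unitr) ![A]

/-- The pentagon commutes because all of its edges are interpretations of 2-cells between operations
of arity four, and 2-cells with the same source and target are equal. The other axioms hold for the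
same reason. -/
theorem pentagon_cells (A B D E : C) :
    h.tens.map (X := (_, _)) (Y := (_, _))
        ((h.cell (CMonEq.rhs .assoc) (CMonEq.lhs .assoc)).app ![A, B, D], 𝟙 E) ≫
      (h.cell (CMonEq.rhs .assoc) (CMonEq.lhs .assoc)).app ![A, h.tens.obj (B, D), E] ≫
      h.tens.map (X := (_, _)) (Y := (_, _))
        (𝟙 A, (h.cell (CMonEq.rhs .assoc) (CMonEq.lhs .assoc)).app ![B, D, E]) =
    (h.cell (CMonEq.rhs .assoc) (CMonEq.lhs .assoc)).app ![h.tens.obj (A, B), D, E] ≫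
      (h.cell (CMonEq.rhs .assoc) (CMonEq.lhs .assoc)).app ![A, B, h.tens.obj (D, E)] := by
  let p₁ := linearOp (n := 4) (mul (mul (mul (var 0) (var 1)) (var 2)) (var 3)) (by decide)
  let p₂ := linearOp (n := 4) (mul (mul (var 0) (mul (var 1) (var 2))) (var 3)) (by decide)
  let p₃ := linearOp (n := 4) (mul (var 0) (mul (mul (var 1) (var 2)) (var 3))) (by decide)
  let p₄ := linearOp (n := 4) (mul (var 0) (mul (var 1) (mul (var 2) (var 3)))) (by decide)
  let p₅ := linearOp (n := 4) (mul (mul (var 0) (var 1)) (mul (var 2) (var 3))) (by decide)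
  have e₁ := h.cell_mul (CMonEq.rhs .assoc) (CMonEq.lhs .assoc) (freeOperad CMonOp).one
    (freeOperad CMonOp).one ![0, 1, 2] ![3] (r := p₁) (r' := p₂) rfl rfl ![A, B, D, E] ![A, B, D]
    ![E] (by funext j; fin_cases j <;> rfl) (by funext j; fin_cases j; rfl)
  have e₂ := h.cell_subst (CMonEq.rhs .assoc) (CMonEq.lhs .assoc)
    ![var 0, mul (var 1) (var 2), var 3] (r := p₂) (r' := p₃) rfl rfl ![A, B, D, E]
    ![A, h.tens.obj (B, D), E] (by funext j; fin_cases j <;> rfl)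
  have e₃ := h.cell_mul (freeOperad CMonOp).one (freeOperad CMonOp).one (CMonEq.rhs .assoc)
    (CMonEq.lhs .assoc) ![0] ![1, 2, 3] (r := p₃) (r' := p₄) rfl rfl ![A, B, D, E] ![A] ![B, D, E]
    (by funext j; fin_cases j; rfl) (by funext j; fin_cases j <;> rfl)
  have e₄ := h.cell_subst (CMonEq.rhs .assoc) (CMonEq.lhs .assoc)
    ![mul (var 0) (var 1), var 2, var 3] (r := p₁) (r' := p₅) rfl rfl ![A, B, D, E]
    ![h.tens.obj (A, B), D, E] (by funext j; fin_cases j <;> rfl)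
  have e₅ := h.cell_subst (CMonEq.rhs .assoc) (CMonEq.lhs .assoc)
    ![var 0, var 1, mul (var 2) (var 3)] (r := p₅) (r' := p₄) rfl rfl ![A, B, D, E]
    ![A, B, h.tens.obj (D, E)] (by funext j; fin_cases j <;> rfl)
  rw [cell_refl] at e₁ e₃
  refine Eq.trans ?_ ((h.cell_trans_app p₁ p₂ p₄ ![A, B, D, E]).trans
    ((h.cell_trans_app p₁ p₅ p₄ ![A, B, D, E]).symm.trans
      (congrArg₂ (· ≫ ·) (eq_of_heq e₄) (eq_of_heq e₅))))
  rw [← h.cell_trans_app p₂ p₃ p₄]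
  exact congrArg₂ (· ≫ ·) (eq_of_heq e₁).symm (congrArg₂ (· ≫ ·) (eq_of_heq e₂).symm
    (eq_of_heq e₃).symm)

theorem triangle_cells (A B : C) :
    (h.cell (CMonEq.rhs .assoc) (CMonEq.lhs .assoc)).app ![A, h.unitObj, B] ≫
      h.tens.map (X := (_, _)) (Y := (_, _))
        (𝟙 A, (h.cell (CMonEq.lhs .unitl) (CMonEq.rhs .unitl)).app ![B]) =
    h.tens.map (X := (_, _)) (Y := (_, _))
      ((h.cell (CMonEq.lhs .unitr) (CMonEq.rhs .unitr)).app ![A], 𝟙 B) := by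
  let p₁ := linearOp (n := 2) (mul (mul (var 0) unit) (var 1)) (by decide)
  let p₂ := linearOp (n := 2) (mul (var 0) (mul unit (var 1))) (by decide)
  have e₁ := h.cell_subst (CMonEq.rhs .assoc) (CMonEq.lhs .assoc) ![var 0, unit, var 1]
    (r := p₁) (r' := p₂) rfl rfl ![A, B] ![A, h.unitObj, B] (by funext j; fin_cases j <;> rfl)
  have e₂ := h.cell_mul (freeOperad CMonOp).one (freeOperad CMonOp).one (CMonEq.lhs .unitl)
    (CMonEq.rhs .unitl) ![0] ![1] (r := p₂) (r' := CMonEq.dot) rfl rfl ![A, B] ![A] ![B]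
    (by funext j; fin_cases j; rfl) (by funext j; fin_cases j; rfl)
  have e₃ := h.cell_mul (CMonEq.lhs .unitr) (CMonEq.rhs .unitr) (freeOperad CMonOp).one
    (freeOperad CMonOp).one ![0] ![1] (r := p₁) (r' := CMonEq.dot) rfl rfl ![A, B] ![A] ![B]
    (by funext j; fin_cases j; rfl) (by funext j; fin_cases j; rfl)
  rw [cell_refl] at e₂ e₃
  refine Eq.trans ?_ ((h.cell_trans_app p₁ p₂ CMonEq.dot ![A, B]).trans (eq_of_heq e₃))
  exact congrArg₂ (· ≫ ·) (eq_of_heq e₁).symm (eq_of_heq e₂).symm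

/-- The monoidal structure of an algebra. -/
abbrev monoidal : MonoidalCategory C :=
  letI := h.monoidalStruct
  MonoidalCategory.ofTensorHom
    (id_tensorHom_id := fun _ _ => h.tens.map_id _)
    (id_tensorHom := fun _ _ _ _ => rfl)
    (tensorHom_id := fun _ _ => rfl)
    (tensorHom_comp_tensorHom := fun _ _ _ _ => (h.tens.map_comp _ _).symm)
    (associator_naturality := fun {X₁ X₂ X₃ Y₁ Y₂ Y₃} f₁ f₂ f₃ =>
      (h.cell (CMonEq.rhs .assoc) (CMonEq.lhs .assoc)).naturality
        (X := ![X₁, X₂, X₃]) (Y := ![Y₁, Y₂, Y₃]) fun | 0 => f₁ | 1 => f₂ | 2 => f₃)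
    (leftUnitor_naturality := fun {X Y} f =>
      (h.cell (CMonEq.lhs .unitl) (CMonEq.rhs .unitl)).naturality
        (X := ![X]) (Y := ![Y]) fun | 0 => f)
    (rightUnitor_naturality := fun {X Y} f =>
      (h.cell (CMonEq.lhs .unitr) (CMonEq.rhs .unitr)).naturality
        (X := ![X]) (Y := ![Y]) fun | 0 => f)
    (pentagon := h.pentagon_cells)
    (triangle := h.triangle_cells)

theorem hexagon_forward_cells (A B D : C) :
    (h.cell (CMonEq.rhs .assoc) (CMonEq.lhs .assoc)).app ![A, B, D] ≫
      (h.cell (CMonEq.lhs .comm) (CMonEq.rhs .comm)).app ![A, h.tens.obj (B, D)] ≫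
      (h.cell (CMonEq.rhs .assoc) (CMonEq.lhs .assoc)).app ![B, D, A] =
    h.tens.map (X := (_, _)) (Y := (_, _))
        ((h.cell (CMonEq.lhs .comm) (CMonEq.rhs .comm)).app ![A, B], 𝟙 D) ≫
      (h.cell (CMonEq.rhs .assoc) (CMonEq.lhs .assoc)).app ![B, A, D] ≫
      h.tens.map (X := (_, _)) (Y := (_, _))
        (𝟙 B, (h.cell (CMonEq.lhs .comm) (CMonEq.rhs .comm)).app ![A, D]) := by
  let p₁ := linearOp (n := 3) (mul (mul (var 0) (var 1)) (var 2)) (by decide)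
  let p₂ := linearOp (n := 3) (mul (var 0) (mul (var 1) (var 2))) (by decide)
  let p₃ := linearOp (n := 3) (mul (mul (var 1) (var 2)) (var 0)) (by decide)
  let p₄ := linearOp (n := 3) (mul (var 1) (mul (var 2) (var 0))) (by decide)
  let p₅ := linearOp (n := 3) (mul (mul (var 1) (var 0)) (var 2)) (by decide)
  let p₆ := linearOp (n := 3) (mul (var 1) (mul (var 0) (var 2))) (by decide)
  have e₁ := h.cell_subst (CMonEq.rhs .assoc) (CMonEq.lhs .assoc) ![var 0, var 1, var 2]
    (r := p₁) (r' := p₂) rfl rfl ![A, B, D] ![A, B, D] (by funext j; fin_cases j <;> rfl)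
  have e₂ := h.cell_subst (CMonEq.lhs .comm) (CMonEq.rhs .comm) ![var 0, mul (var 1) (var 2)]
    (r := p₂) (r' := p₃) rfl rfl ![A, B, D] ![A, h.tens.obj (B, D)]
    (by funext j; fin_cases j <;> rfl)
  have e₃ := h.cell_subst (CMonEq.rhs .assoc) (CMonEq.lhs .assoc) ![var 1, var 2, var 0]
    (r := p₃) (r' := p₄) rfl rfl ![A, B, D] ![B, D, A] (by funext j; fin_cases j <;> rfl)
  have e₄ := h.cell_mul (CMonEq.lhs .comm) (CMonEq.rhs .comm) (freeOperad CMonOp).one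
    (freeOperad CMonOp).one ![0, 1] ![2] (r := p₁) (r' := p₅) rfl rfl ![A, B, D] ![A, B] ![D]
    (by funext j; fin_cases j <;> rfl) (by funext j; fin_cases j; rfl)
  have e₅ := h.cell_subst (CMonEq.rhs .assoc) (CMonEq.lhs .assoc) ![var 1, var 0, var 2]
    (r := p₅) (r' := p₆) rfl rfl ![A, B, D] ![B, A, D] (by funext j; fin_cases j <;> rfl)
  have e₆ := h.cell_mul (freeOperad CMonOp).one (freeOperad CMonOp).one (CMonEq.lhs .comm)
    (CMonEq.rhs .comm) ![1] ![0, 2] (r := p₆) (r' := p₄) rfl rfl ![A, B, D] ![B] ![A, D]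
    (by funext j; fin_cases j; rfl) (by funext j; fin_cases j <;> rfl)
  rw [cell_refl] at e₄ e₆
  have l := h.cell_trans_app p₁ p₂ p₄ ![A, B, D]
  have r := h.cell_trans_app p₁ p₅ p₄ ![A, B, D]
  rw [← h.cell_trans_app p₂ p₃ p₄] at l
  rw [← h.cell_trans_app p₅ p₆ p₄] at r
  refine Eq.trans ?_ ((l.trans r.symm).trans (congrArg₂ (· ≫ ·) (eq_of_heq e₄)
    (congrArg₂ (· ≫ ·) (eq_of_heq e₅) (eq_of_heq e₆))))
  exact congrArg₂ (· ≫ ·) (eq_of_heq e₁).symm (congrArg₂ (· ≫ ·) (eq_of_heq e₂).symm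
    (eq_of_heq e₃).symm)

theorem symmetry_cells (A B : C) :
    (h.cell (CMonEq.lhs .comm) (CMonEq.rhs .comm)).app ![A, B] ≫
      (h.cell (CMonEq.lhs .comm) (CMonEq.rhs .comm)).app ![B, A] = 𝟙 (h.tens.obj (A, B)) := by
  have e := h.cell_subst (CMonEq.lhs .comm) (CMonEq.rhs .comm) ![var 1, var 0]
    (r := CMonEq.rhs .comm) (r' := CMonEq.lhs .comm) rfl rfl ![A, B] ![B, A]
    (by funext j; fin_cases j <;> rfl)
  refine (congrArg (_ ≫ ·) (eq_of_heq e).symm).trans ((h.cell_trans_app _ _ _ _).trans ?_)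
  rw [cell_refl]
  rfl

/-- The symmetric monoidal structure of an algebra. -/
abbrev symmetric : @SymmetricCategory C _ h.monoidal :=
  letI := h.monoidal
  { braiding := fun A B => h.cellIso (CMonEq.lhs .comm) (CMonEq.rhs .comm) ![A, B]
    braiding_naturality_right := fun A {B B'} f =>
      (h.cell (CMonEq.lhs .comm) (CMonEq.rhs .comm)).naturality
        (X := ![A, B]) (Y := ![A, B']) fun | 0 => 𝟙 A | 1 => f
    braiding_naturality_left := fun {A A'} f B =>
      (h.cell (CMonEq.lhs .comm) (CMonEq.rhs .comm)).naturality
        (X := ![A, B]) (Y := ![A', B]) fun | 0 => f | 1 => 𝟙 B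
    hexagon_forward := h.hexagon_forward_cells
    hexagon_reverse := hexagon_reverse_of_symmetric
      (fun A B => (h.cell (CMonEq.lhs .comm) (CMonEq.rhs .comm)).app ![A, B])
      h.symmetry_cells h.hexagon_forward_cells
    symmetry := h.symmetry_cells }

theorem matches_symmetric : @Matches C _ h.monoidal h.symmetric h :=
  letI := h.monoidal
  letI := h.symmetric
  { dot_obj := fun _ _ => rfl
    dot_map := fun {x y} f => by
      refine heq_map_pi (Algebra.fn h CMonEq.dot) (fun i => ?_) (fun i => ?_) fun i => ?_
      all_goals
        fin_cases i <;> rfl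
    e_obj := rfl
    assoc := fun _ _ _ => h.trans_heq_cell _ _
    unitl := fun _ => h.trans_heq_cell _ _
    unitr := fun _ => h.trans_heq_cell _ _
    comm := fun _ _ => h.trans_heq_cell _ _ }

end Monoidal
end Algebra
/-! ### The symmetric monoidal functor of a weak map -/

/-- A weak map between equal algebras. -/
def WeakMap.copy {Q : CatSymmOperad.{w, t}} {A B : Type u} [Category.{v} A] [Category.{v} B]
    {h k : Algebra Q A} {h' k' : Algebra Q B} (G : WeakMap h h') (e : k = h) (e' : k' = h') :
    WeakMap k k' where
  functor := G.functor
  coh := by subst e e'; exact G.coh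
  coh_naturality := by subst e e'; exact G.coh_naturality
  coh_trans := by subst e e'; exact G.coh_trans
  coh_one := by subst e e'; exact G.coh_one
  coh_comp := by subst e e'; exact G.coh_comp
  coh_act := by subst e e'; exact G.coh_act

theorem WeakMap.copy_coh_heq {Q : CatSymmOperad.{w, t}} {A B : Type u} [Category.{v} A]
    [Category.{v} B] {h k : Algebra Q A} {h' k' : Algebra Q B} (G : WeakMap h h') (e : k = h)
    (e' : k' = h') {n : ℕ} (q : Q.Op n) (x : Fin n → A) :
    HEq ((G.copy e e').coh q x).hom (G.coh q x).hom := by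
  subst e e'
  rfl

namespace WeakMap

section Components

variable {A B : Type u} [Category.{v} A] [Category.{v} B]
  {h : Algebra (weakening CMonEq.φ) A} {h' : Algebra (weakening CMonEq.φ) B} (G : WeakMap h h')

/-- The same weak map, between strictified algebras. -/
def strict : WeakMap h.strict h'.strict :=
  G.copy h.strict_eq h'.strict_eq

/-- The component at the constant. -/
def unitIso : h'.unitObj ≅ G.functor.obj h.unitObj :=
  G.strict.coh CMonEq.e ![]

/-- The component at the binary operation. -/
def tensIso (a b : A) :
    h'.tens.obj (G.functor.obj a, G.functor.obj b) ≅ G.functor.obj (h.tens.obj (a, b)) :=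
  G.strict.coh CMonEq.dot ![a, b]

theorem coh_e_heq : HEq (G.coh CMonEq.e ![]).hom G.unitIso.hom :=
  (G.copy_coh_heq _ _ _ _).symm

theorem coh_dot_heq (a b : A) : HEq (G.coh CMonEq.dot ![a, b]).hom (G.tensIso a b).hom :=
  (G.copy_coh_heq _ _ _ _).symm

theorem comparison_dot {X : Type} (y : X → A) (i j : X) :
    (comparison G.functor G.unitIso G.tensIso y (mul (var i) (var j))).hom =
      (G.tensIso (y i) (y j)).hom :=
  (congrArg (· ≫ _) (h'.tens.map_id _)).trans (Category.id_comp _)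

/-- All components of a weak map are determined by those at the generating operations. -/
theorem strict_coh_hom {n : ℕ} (q : (freeOperad CMonOp).Op n) (x : Fin n → A) :
    (G.strict.coh q x).hom =
      (comparison G.functor G.unitIso G.tensIso x (toMon q.1)).hom := by
  revert x
  refine freeOperad.induction (P := fun {n} (q : (freeOperad CMonOp).Op n) => ∀ x : Fin n → A,
    (G.strict.coh q x).hom = (comparison G.functor G.unitIso G.tensIso x (toMon q.1)).hom)
      ?_ ?_ ?_ ?_ q
  · exact fun x => eq_of_heq (G.strict.coh_one x)
  · intro n φ
    cases φ with
    | e =>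
      rw [gen_e]
      intro x
      obtain rfl : x = ![] := Subsingleton.elim _ _
      rfl
    | dot =>
      rw [gen_dot]
      intro x
      rw [← vec_eq_two x]
      exact ((congrArg (· ≫ _) (h'.tens.map_id _)).trans (Category.id_comp _)).symm
  · intro n m k hm p q hp hq x
    refine eq_of_heq ((G.strict.coh_comp hm p q x).trans
      (HEq.trans ?_ (comparison_comp _ _ _ hm p q x).symm))
    simp only [hp, hq]
    rfl
  · intro n σ p hp x
    refine eq_of_heq ((G.strict.coh_act σ p x).trans
      (HEq.trans ?_ (comparison_act _ _ _ σ p x).symm))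
    rw [hp]
    rfl

/-- The components of a weak map commute with the 2-cells. The images `F xᵢ` and the two components
may be given in any form that is equal to the one that the definition yields. -/
theorem cell_comparison {n : ℕ} (p q : (freeOperad CMonOp).Op n) (x : Fin n → A) (y : Fin n → B)
    (hy : y = fun i => G.functor.obj (x i))
    {f : ((toMon p.1).functor h'.tens h'.unitObj).obj y ⟶
      G.functor.obj (((toMon p.1).functor h.tens h.unitObj).obj x)}
    {g : ((toMon q.1).functor h'.tens h'.unitObj).obj y ⟶
      G.functor.obj (((toMon q.1).functor h.tens h.unitObj).obj x)}
    (hf : HEq (comparison G.functor G.unitIso G.tensIso x (toMon p.1)).hom f)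
    (hg : HEq (comparison G.functor G.unitIso G.tensIso x (toMon q.1)).hom g) :
    (h'.cell p q).app y ≫ g = f ≫ G.functor.map ((h.cell p q).app x) := by
  subst hy
  rw [← eq_of_heq hf, ← eq_of_heq hg, ← strict_coh_hom, ← strict_coh_hom]
  exact G.strict.coh_trans (⟨rfl⟩ : ((weakening CMonEq.φ).cat n).Hom p q) x

theorem tensIso_naturality {a a' b b' : A} (f : a ⟶ a') (g : b ⟶ b') :
    h'.tens.map (X := (_, _)) (Y := (_, _)) (G.functor.map f, G.functor.map g) ≫
        (G.tensIso a' b').hom =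
      (G.tensIso a b).hom ≫ G.functor.map (h.tens.map (X := (_, _)) (Y := (_, _)) (f, g)) :=
  G.strict.coh_naturality CMonEq.dot (x := ![a, b]) (y := ![a', b']) fun | 0 => f | 1 => g

theorem tensIso_associativity (a b c : A) :
    h'.tens.map (X := (_, _)) (Y := (_, _)) ((G.tensIso a b).hom, 𝟙 (G.functor.obj c)) ≫
        (G.tensIso (h.tens.obj (a, b)) c).hom ≫
        G.functor.map ((h.cell (CMonEq.rhs .assoc) (CMonEq.lhs .assoc)).app ![a, b, c]) =
      (h'.cell (CMonEq.rhs .assoc) (CMonEq.lhs .assoc)).app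
          ![G.functor.obj a, G.functor.obj b, G.functor.obj c] ≫
        h'.tens.map (X := (_, _)) (Y := (_, _)) (𝟙 (G.functor.obj a), (G.tensIso b c).hom) ≫
        (G.tensIso a (h.tens.obj (b, c))).hom := by
  have hf := congrArg (fun f => h'.tens.map (X := (_, _)) (Y := (_, _))
    (f, 𝟙 (G.functor.obj c)) ≫ (G.tensIso (h.tens.obj (a, b)) c).hom)
    (G.comparison_dot (![a, b, c] : Fin 3 → A) 0 1)
  have hg := congrArg (fun g => h'.tens.map (X := (_, _)) (Y := (_, _))
    (𝟙 (G.functor.obj a), g) ≫ (G.tensIso a (h.tens.obj (b, c))).hom)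
    (G.comparison_dot (![a, b, c] : Fin 3 → A) 1 2)
  exact (Category.assoc _ _ _).symm.trans (G.cell_comparison (CMonEq.rhs .assoc) (CMonEq.lhs .assoc)
    ![a, b, c] ![G.functor.obj a, G.functor.obj b, G.functor.obj c] (by funext i; fin_cases i <;> rfl) (heq_of_eq hf) (heq_of_eq hg)).symm

theorem unitIso_left_unitality (a : A) :
    (h'.cell (CMonEq.lhs .unitl) (CMonEq.rhs .unitl)).app ![G.functor.obj a] =
      h'.tens.map (X := (_, _)) (Y := (_, _)) (G.unitIso.hom, 𝟙 (G.functor.obj a)) ≫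
        (G.tensIso h.unitObj a).hom ≫
        G.functor.map ((h.cell (CMonEq.lhs .unitl) (CMonEq.rhs .unitl)).app ![a]) :=
  (Category.comp_id _).symm.trans ((G.cell_comparison (CMonEq.lhs .unitl) (CMonEq.rhs .unitl)
    ![a] ![G.functor.obj a] (by funext i; fin_cases i; rfl) HEq.rfl HEq.rfl).trans (Category.assoc _ _ _))

theorem unitIso_right_unitality (a : A) :
    (h'.cell (CMonEq.lhs .unitr) (CMonEq.rhs .unitr)).app ![G.functor.obj a] =
      h'.tens.map (X := (_, _)) (Y := (_, _)) (𝟙 (G.functor.obj a), G.unitIso.hom) ≫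
        (G.tensIso a h.unitObj).hom ≫
        G.functor.map ((h.cell (CMonEq.lhs .unitr) (CMonEq.rhs .unitr)).app ![a]) :=
  (Category.comp_id _).symm.trans ((G.cell_comparison (CMonEq.lhs .unitr) (CMonEq.rhs .unitr)
    ![a] ![G.functor.obj a] (by funext i; fin_cases i; rfl) HEq.rfl HEq.rfl).trans (Category.assoc _ _ _))

theorem tensIso_braided (a b : A) :
    (G.tensIso a b).hom ≫
        G.functor.map ((h.cell (CMonEq.lhs .comm) (CMonEq.rhs .comm)).app ![a, b]) =
      (h'.cell (CMonEq.lhs .comm) (CMonEq.rhs .comm)).app ![G.functor.obj a, G.functor.obj b] ≫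
        (G.tensIso b a).hom :=
  (G.cell_comparison (CMonEq.lhs .comm) (CMonEq.rhs .comm) ![a, b]
    ![G.functor.obj a, G.functor.obj b]
    (by funext i; fin_cases i <;> rfl)
    (heq_of_eq (G.comparison_dot (![a, b] : Fin 2 → A) 0 1))
    (heq_of_eq (G.comparison_dot (![a, b] : Fin 2 → A) 1 0))).symm

end Components

end WeakMap

/-- The symmetric monoidal category of an algebra. -/
def wkObj (X : WkPCat.{v, u}) : SMC.{v, u} :=
  letI := X.alg.monoidal
  letI := X.alg.symmetric
  ⟨X.C⟩

/-- The underlying functor of a weak map, as a functor between symmetric monoidal categories. -/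
def WeakMap.smcFunctor {X Y : WkPCat.{v, u}} (G : WeakMap X.alg Y.alg) :
    (wkObj X).C ⥤ (wkObj Y).C :=
  G.functor

/-- The monoidal structure on the underlying functor of a weak map. -/
def WeakMap.coreMonoidal {X Y : WkPCat.{v, u}} (G : WeakMap X.alg Y.alg) :
    G.smcFunctor.CoreMonoidal where
  εIso := G.unitIso
  μIso := G.tensIso
  μIso_hom_natural_left f b :=
    (congrArg (fun g => Y.alg.tens.map (X := (_, _)) (Y := (_, _)) (G.functor.map f, g) ≫ _)
      (G.functor.map_id b).symm).trans (G.tensIso_naturality f (𝟙 b))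
  μIso_hom_natural_right b f :=
    (congrArg (fun g => Y.alg.tens.map (X := (_, _)) (Y := (_, _)) (g, G.functor.map f) ≫ _)
      (G.functor.map_id b).symm).trans (G.tensIso_naturality (𝟙 b) f)
  associativity := G.tensIso_associativity
  left_unitality := G.unitIso_left_unitality
  right_unitality := G.unitIso_right_unitality

/-- The symmetric monoidal functor of a weak map. -/
def WeakMap.toSMC {X Y : WkPCat.{v, u}} (G : WeakMap X.alg Y.alg) :
    SMC.Hom (wkObj X) (wkObj Y) where
  functor := G.smcFunctor
  braided := { G.coreMonoidal.toMonoidal with braided := G.tensIso_braided }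

theorem WeakMap.coh_heq {Q : CatSymmOperad.{w, t}} {A B : Type u} [Category.{v} A]
    [Category.{v} B] {h : Algebra Q A} {h' : Algebra Q B} (G : WeakMap h h') {n : ℕ} (q : Q.Op n)
    {x y : Fin n → A} (e : x = y) : HEq (G.coh q x).hom (G.coh q y).hom := by
  rw [e]

/-- The functor that sends an algebra to the symmetric monoidal category that it defines. -/
def wkToSmc : WkPCat.{v, u} ⥤ SMC.{v, u} where
  obj X := wkObj X
  map G := WeakMap.toSMC G
  map_id X := SMC.Hom.ext' rfl (WeakMap.coh_e_heq (WeakMap.id X.alg)).symm fun a b =>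
    (WeakMap.coh_dot_heq (WeakMap.id X.alg) a b).symm
  map_comp {X Y Z} F G := by
    have hvec (a b : X.C) : (fun i => (WeakMap.functor F).obj (![a, b] i)) =
        ![(WeakMap.functor F).obj a, (WeakMap.functor F).obj b] := by
      funext i
      fin_cases i <;> rfl
    have hvec' (a b : X.C) :
        (fun i => (WeakMap.functor G).obj ((WeakMap.functor F).obj (![a, b] i))) =
        ![(WeakMap.functor G).obj ((WeakMap.functor F).obj a),
          (WeakMap.functor G).obj ((WeakMap.functor F).obj b)] := by
      funext i
      fin_cases i <;> rfl
    refine SMC.Hom.ext' rfl ?_ fun a b => ?_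
    · refine (WeakMap.coh_e_heq (WeakMap.comp F G)).symm.trans ?_
      exact heq_comp (congrArg _ (Subsingleton.elim _ _))
        (congrArg (fun x => (WeakMap.functor G).obj ((Algebra.fn Y.alg CMonEq.e).obj x))
          (Subsingleton.elim _ _)) rfl
        ((WeakMap.coh_heq G _ (Subsingleton.elim _ _)).trans (WeakMap.coh_e_heq G))
        (heq_map _ (congrArg _ (Subsingleton.elim _ _)) rfl (WeakMap.coh_e_heq F))
    · refine (WeakMap.coh_dot_heq (WeakMap.comp F G) a b).symm.trans ?_
      exact heq_comp (congrArg _ (hvec' a b))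
        (congrArg (fun x => (WeakMap.functor G).obj ((Algebra.fn Y.alg CMonEq.dot).obj x))
          (hvec a b)) rfl
        ((WeakMap.coh_heq G _ (hvec a b)).trans (WeakMap.coh_dot_heq G _ _))
        (heq_map _ (congrArg _ (hvec a b)) rfl (WeakMap.coh_dot_heq F a b))

/-! ### The two functors are mutually inverse -/

theorem smc_mk_eq {C : Type u} [Category.{v} C] {m m' : MonoidalCategory C}
    {s : @SymmetricCategory C _ m} {s' : @SymmetricCategory C _ m'}
    (e : (⟨m, s⟩ : Sigma fun m => @SymmetricCategory C _ m) = ⟨m', s'⟩) :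
    @SMC.mk C _ m s = @SMC.mk C _ m' s' := by
  cases e
  rfl

/-- Symmetric monoidal functors between equal categories are equal if their underlying functors and
their structure morphisms are. -/
theorem smcHom_heq {M N M' N' : SMC.{v, u}} (e : M = M') (e' : N = N') {F : SMC.Hom M N}
    {G : SMC.Hom M' N'} (h : HEq F.functor G.functor) (h0 : HEq (ε F.functor) (ε G.functor))
    (h2 : ∀ (a b : M.C) (a' b' : M'.C), HEq a a' → HEq b b' →
      HEq (μ F.functor a b) (μ G.functor a' b')) : HEq F G := by
  subst e e'
  exact heq_of_eq (SMC.Hom.ext' (eq_of_heq h) h0 fun a b => h2 a b a b HEq.rfl HEq.rfl)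

/-- Weak maps between equal algebras are equal if their underlying functors and their components at
the generating operations are. -/
theorem weakMap_heq {A B : Type u} [Category.{v} A] [Category.{v} B]
    {h k : Algebra (weakening CMonEq.φ) A} {h' k' : Algebra (weakening CMonEq.φ) B}
    {G : WeakMap h h'} {G' : WeakMap k k'} (e : h = k) (e' : h' = k')
    (hF : G.functor = G'.functor)
    (hdot : ∀ a b : A, HEq (G.coh CMonEq.dot ![a, b]).hom (G'.coh CMonEq.dot ![a, b]).hom)
    (he : HEq (G.coh CMonEq.e ![]).hom (G'.coh CMonEq.e ![]).hom) : HEq G G' := by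
  subst e e'
  exact heq_of_eq (weakMap_ext hF hdot he)

theorem smcWeakMap_coh_dot {M N : SMC.{v, u}} (F : SMC.Hom M N) (a b : M.C) :
    HEq ((smcWeakMap F).coh CMonEq.dot ![a, b]).hom (μ F.functor a b) :=
  heq_of_eq ((congrArg (· ≫ _) (id_tensorHom_id _ _)).trans (Category.id_comp _))

theorem smcWeakMap_coh_e {M N : SMC.{v, u}} (F : SMC.Hom M N) :
    HEq ((smcWeakMap F).coh CMonEq.e ![]).hom (ε F.functor) :=
  HEq.rfl

/-- The symmetric monoidal structure of the algebra of a symmetric monoidal category is the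
original one. -/
theorem smcAlgebra_monoidal (M : SMC.{v, u}) :
    (⟨(smcAlgebra M.C).monoidal, (smcAlgebra M.C).symmetric⟩ :
      Sigma fun m => @SymmetricCategory M.C _ m) = ⟨M.monoidal, M.symmetric⟩ :=
  (smcAlgebra M.C).matches_symmetric.smc_eq (smcAlgebra_matches M.C)

/-- The algebra of the symmetric monoidal category of an algebra is the original one. -/
theorem smcAlgebra_wkObj (X : WkPCat.{v, u}) : smcAlgebra (wkObj X).C = X.alg :=
  Matches.algebra_eq (C := (wkObj X).C) (smcAlgebra_matches _) X.alg.matches_symmetric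

theorem smcToWk_comp_wkToSmc : smcToWk ⋙ wkToSmc = 𝟭 SMC.{v, u} := by
  refine Functor.hext (fun M => smc_mk_eq (smcAlgebra_monoidal M)) fun M N F => ?_
  refine smcHom_heq (smc_mk_eq (smcAlgebra_monoidal M)) (smc_mk_eq (smcAlgebra_monoidal N)) (G := F)
    HEq.rfl ?_ fun (a b a' b' : M.C) ha hb => ?_
  · exact (WeakMap.coh_e_heq (smcWeakMap F)).symm.trans (smcWeakMap_coh_e F)
  · rw [← eq_of_heq ha, ← eq_of_heq hb]
    exact (WeakMap.coh_dot_heq (smcWeakMap F) a b).symm.trans (smcWeakMap_coh_dot F a b)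

theorem wkToSmc_comp_smcToWk : wkToSmc ⋙ smcToWk = 𝟭 WkPCat.{v, u} := by
  refine Functor.hext (fun X => congrArg (AlgCat.mk X.C) (smcAlgebra_wkObj X)) fun X Y G => ?_
  refine weakMap_heq (G' := G) (smcAlgebra_wkObj X) (smcAlgebra_wkObj Y) rfl (fun a b => ?_) ?_
  · exact (smcWeakMap_coh_dot (WeakMap.toSMC G) a b).trans (WeakMap.coh_dot_heq G a b).symm
  · exact (smcWeakMap_coh_e (WeakMap.toSMC G)).trans (WeakMap.coh_e_heq G).symm

end WkOperad

theorem mainTheorem4 :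
    Nonempty (Limits.IsColimit (Limits.Cofork.ofπ WkOperad.CMonEq.φ WkOperad.CMonEq.condition)) ∧
    ∃ (S : WkOperad.SMC.{v, u} ⥤ WkOperad.WkPCat.{v, u})
      (R : WkOperad.WkPCat.{v, u} ⥤ WkOperad.SMC.{v, u}),
      S ⋙ R = 𝟭 WkOperad.SMC.{v, u} ∧
      R ⋙ S = 𝟭 WkOperad.WkPCat.{v, u} ∧
      S ⋙ WkOperad.AlgCat.forget _ = WkOperad.SMC.forget ∧
      R ⋙ WkOperad.SMC.forget = WkOperad.AlgCat.forget _ ∧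
      (∀ M : WkOperad.SMC.{v, u}, WkOperad.Corresponds M (S.obj M)) ∧
      (∀ {M N : WkOperad.SMC.{v, u}} (F : M ⟶ N), WkOperad.CorrespondsHom F (S.map F)) ∧
      (∀ X : WkOperad.WkPCat.{v, u}, WkOperad.Corresponds (R.obj X) X) ∧
      (∀ {X Y : WkOperad.WkPCat.{v, u}} (G : X ⟶ Y), WkOperad.CorrespondsHom (R.map G) G) := by
  refine ⟨⟨WkOperad.CMonEq.isColimit⟩, WkOperad.smcToWk, WkOperad.wkToSmc,
    WkOperad.smcToWk_comp_wkToSmc, WkOperad.wkToSmc_comp_smcToWk, rfl, rfl, ?_, ?_, ?_, ?_⟩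
  · exact fun M => ⟨_, rfl, WkOperad.smcAlgebra_matches M.C⟩
  · exact fun {M N} F => ⟨_, _, WkOperad.smcWeakMap F, rfl, WkOperad.smcAlgebra_matches M.C, rfl,
      WkOperad.smcAlgebra_matches N.C, HEq.rfl, rfl, WkOperad.smcWeakMap_coh_dot F,
      WkOperad.smcWeakMap_coh_e F⟩
  · exact fun X => ⟨X.alg, rfl, X.alg.matches_symmetric⟩
  · exact fun {X Y} G => ⟨X.alg, Y.alg, G, rfl, X.alg.matches_symmetric, rfl,
      Y.alg.matches_symmetric, HEq.rfl, rfl, WkOperad.WeakMap.coh_dot_heq G,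
      WkOperad.WeakMap.coh_e_heq G⟩
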